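/- **Proposition (bi-parameter basic averaging formula).** Let $n,m\ge 1$, and use the $\ell^\infty$ metric on $\mathbb R^n$ and $\mathbb R^m$. *Random grids.* Let $w_n=(w_n^i)_{i\in\mathbb Z}$, $w_n^i\in\{0,1\}^n$, be independent and uniformly distributed. For a cube $I$ of side length $\ell(I)$ in the standard dyadic grid $\mathcal D_n^0$ of $\mathbb R^n$ put $I+w_n:=I+\sum_{i:\,2^{-i}<\ell(I)}2^{-i}w_n^i$ and $\mathcal D_n:=\{I+w_n: I\in\mathcal D_n^0\}$. Define $w_m$ and $\mathcal D_m$ in $\mathbb R^m$ in the same way, independently. Fix $\delta>0$, $r\in\{0,1,2,\dots\}$ and let $\gamma_n=\delta/(2n+2\delta)$. A cube $I\in\mathcal D_n$ is bad if there is $\tilde I\in\mathcal D_n$ with $\ell(\tilde I)\ge 2^r\ell(I)$ and $d(I,\partial\tilde I)\le 2\ell(I)^{\gamma_n}\ell(\tilde I)^{1-\gamma_n}$; otherwise it is good. Let $\pi_{\rm good}^n$ be the probability that $I+w_n$ is good for $I=[0,1)^n$; $\pi_{\rm good}^m$ is defined similarly. Assume that $r$ is such that $\pi^n_{\rm good},\pi^m_{\rm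 good}>0$. Let $\chi_{\rm good}$ be $1$ for good cubes and $0$ for bad ones, and let $\mathrm{smaller}(I_1,I_2)$ be the one of $I_1,I_2$ with the smaller side length ($I_1$ if they are equal). *Haar functions.* For $I=I_1\times\dots\times I_n\in\mathcal D_n$ let $h_I$ run through the $2^n-1$ cancellative $L^2$ normalized Haar functions $h_I^\eta=h_{I_1}^{\eta_1}\otimes\dots\otimes h_{I_n}^{\eta_n}$, $\eta\in\{0,1\}^n\setminus\{0\}$, where $h^0_{I_i}=|I_i|^{-1/2}\chi_{I_i}$ and $h^1_{I_i}=|I_i|^{-1/2}(\chi_{I_{i,l}}-\chi_{I_{i,r}})$ with $I_{i,l},I_{i,r}$ the left and right halves of $I_i$. For $J\in\mathcal D_m$ let $u_J$ run through the $2^m-1$ cancellative Haar functions of $J$. In the sums below, each sum over a cube includes the finite sum over its cancellative Haar functions. *Operator.* Let $T$ be a linear operator acting on the bounded Borel functions $\mathbb R^{n+m}\to\mathbb C$ with bounded support, given by a complex bilinear form $(f,g)\mapsto\langle Tf,g\rangle$ on this class that is continuous in the qualitative sense that $|\langle Tf,g\rangle|\le A\|f\|_{L^p}\|g\|_{L^q}$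 for some $p,q\in(1,\infty)$ and some $A<\infty$. (For instance, $T$ may be any operator bounded on $L^2(\mathbb R^{n+m})$, in particular an $L^2$ bounded bi-parameter singular integral; no kernel is needed.) Write also $\langle f,h\rangle=\int fh$. Then $\mathbb P(I+w_n\text{ is good})=\pi_{\rm good}^n$ for every $I\in\mathcal D^0_n$ and $\mathbb P(J+w_m\text{ is good})=\pi_{\rm good}^m$ for every $J\in\mathcal D^0_m$, and for all $f,g\in C^1_c(\mathbb R^{n+m})$ (complex-valued) $$\langle Tf,g\rangle=\frac1{\pi_{\rm good}^n\pi_{\rm good}^m}\,\mathbb E_{w_n}\mathbb E_{w_m}\sum_{I_1,I_2\in\mathcal D_n}\ \sum_{J_1,J_2\in\mathcal D_m}\chi_{\rm good}(\mathrm{smaller}(I_1,I_2))\,\chi_{\rm good}(\mathrm{smaller}(J_1,J_2))\,\langle T(h_{I_1}\otimes u_{J_1}),h_{I_2}\otimes u_{J_2}\rangle\,\langle f,h_{I_1}\otimes u_{J_1}\rangle\,\langle g,h_{I_2}\otimes u_{J_2}\rangle .$$ Here the sum is arranged by side lengths: for all $w_n,w_m$, only finitely many terms with given $\ell(I_1),\ell(I_2),\ell(J_1),\ell(J_2)$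 are nonzero, and the sums of these terms form an absolutely convergent series over the quadruples of side lengths; the total is an integrable function of $(w_n,w_m)$. -/

import Mathlib

open MeasureTheory Set
open scoped ENNReal

namespace BiHaar

/-- A cube of the standard dyadic grid on `ℝⁿ`, namely `2 ^ (-scale) • (pos + [0, 1)ⁿ)`. -/
structure DyadicCube (n : ℕ) where
  scale : ℤ
  pos : Fin n → ℤ

/-- The parameter space of the random grids: sequences `w = (wⁱ)` over `i ∈ ℤ` of bit vectors
`wⁱ ∈ {0,1}ⁿ` (`true` stands for `1`, `false` for `0`). -/
abbrev GridParam (n : ℕ) : Type := ℤ → Fin n → Bool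

/-- The natural product probability: the `wⁱ` are independent and uniform on `{0,1}ⁿ`. -/
noncomputable def gridMeasure (n : ℕ) : Measure (GridParam n) :=
  Measure.infinitePi fun _ : ℤ => (PMF.uniformOfFintype (Fin n → Bool)).toMeasure

namespace DyadicCube

variable {n : ℕ}

/-- The side length `ℓ(I)`. -/
noncomputable def side (I : DyadicCube n) : ℝ := (2 : ℝ) ^ (-I.scale)

/-- The lower corner of the translated cube `I + w`, where
`I + w = I + ∑ 2 ^ (-i) wⁱ`, the sum being over all `i` with `2 ^ (-i) < ℓ(I)`. -/
noncomputable def corner (w : GridParam n) (I : DyadicCube n) (a : Fin n) : ℝ :=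
  I.side * I.pos a + ∑' i : {i : ℤ // (2 : ℝ) ^ (-i) < I.side},
    (2 : ℝ) ^ (-(i : ℤ)) * (if w i a then 1 else 0)

/-- The cube `I + w`. For fixed `w`, these cubes form the dyadic grid with parameter `w`. -/
def translate (w : GridParam n) (I : DyadicCube n) : Set (Fin n → ℝ) :=
  Set.pi univ fun a => Ico (I.corner w a) (I.corner w a + I.side)

/-- The cube with the smaller side length (the first one if the side lengths agree). -/
noncomputable def smaller (I₁ I₂ : DyadicCube n) : DyadicCube n :=
  if I₁.side ≤ I₂.side then I₁ else I₂

end DyadicCube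

/-- Distance of two subsets of `ℝⁿ`, in the `ℓ^∞` metric (which is the metric of `Fin n → ℝ`). -/
noncomputable def setDist {n : ℕ} (A B : Set (Fin n → ℝ)) : ℝ := sInf (Set.image2 dist A B)

/-- The exponent `γ = δ / (2n + 2δ)`. -/
noncomputable def gammaExp (n : ℕ) (δ : ℝ) : ℝ := δ / (2 * n + 2 * δ)

/-- `I + w` is bad: some cube `I' + w` of the same grid has `ℓ(I') ≥ 2 ^ r ℓ(I)` and has its
boundary within distance `2 ℓ(I) ^ γ ℓ(I') ^ (1 - γ)` of `I + w`. -/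
def IsBad {n : ℕ} (δ : ℝ) (r : ℕ) (w : GridParam n) (I : DyadicCube n) : Prop :=
  ∃ I' : DyadicCube n, 2 ^ r * I.side ≤ I'.side ∧
    setDist (I.translate w) (frontier (I'.translate w)) ≤
      2 * I.side ^ gammaExp n δ * I'.side ^ (1 - gammaExp n δ)

/-- `I + w` is good. -/
def IsGood {n : ℕ} (δ : ℝ) (r : ℕ) (w : GridParam n) (I : DyadicCube n) : Prop :=
  ¬ IsBad δ r w I

open scoped Classical in
/-- The indicator `χ_good(I + w)`. -/
noncomputable def goodInd {n : ℕ} (δ : ℝ) (r : ℕ) (w : GridParam n) (I : DyadicCube n) : ℂ :=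
  if IsGood δ r w I then 1 else 0

/-- `π_good`: the probability that `I + w` is good, for the unit cube `I = [0,1)ⁿ`. -/
noncomputable def goodProb (n : ℕ) (δ : ℝ) (r : ℕ) : ℝ :=
  (gridMeasure n).real {w | IsGood δ r w ⟨0, 0⟩}

/-- The Haar functions of the interval `[a, a + l)`: the non-cancellative one (`η = false`) and
the cancellative one (`η = true`). -/
noncomputable def haarInterval (a l : ℝ) (η : Bool) (x : ℝ) : ℝ :=
  (√l)⁻¹ * if η then
      (Ico a (a + l / 2)).indicator 1 x - (Ico (a + l / 2) (a + l)).indicator 1 x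
    else (Ico a (a + l)).indicator 1 x

/-- The Haar function `h^η` of the cube `I + w`. -/
noncomputable def haar {n : ℕ} (w : GridParam n) (I : DyadicCube n) (η : Fin n → Bool)
    (x : Fin n → ℝ) : ℝ :=
  ∏ a, haarInterval (I.corner w a) I.side (η a) (x a)

/-- The indices `η ≠ 0` of the `2ⁿ - 1` cancellative Haar functions of a cube. -/
abbrev CancIndex (n : ℕ) : Type := {η : Fin n → Bool // ∃ a, η a = true}

/-- `ℝⁿ × ℝᵐ`. -/
abbrev Space (n m : ℕ) : Type := (Fin n → ℝ) × (Fin m → ℝ)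

/-- The bounded (Borel) measurable functions `ℝⁿ × ℝᵐ → ℂ` with bounded support. -/
def TestFun (n m : ℕ) : Submodule ℂ (Space n m → ℂ) where
  carrier := {f | Measurable f ∧ (∃ C : ℝ, ∀ x, ‖f x‖ ≤ C) ∧
    Bornology.IsBounded (Function.support f)}
  add_mem' := by
    rintro f g ⟨hf, ⟨C, hC⟩, hfs⟩ ⟨hg, ⟨D, hD⟩, hgs⟩
    exact ⟨hf.add hg, ⟨C + D, fun x => (norm_add_le _ _).trans (add_le_add (hC x) (hD x))⟩,
      (hfs.union hgs).subset (Function.support_add f g)⟩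
  zero_mem' := ⟨measurable_zero, ⟨0, fun x => by simp⟩, by simp⟩
  smul_mem' := by
    rintro c f ⟨hf, ⟨C, hC⟩, hfs⟩
    refine ⟨hf.const_smul c, ⟨‖c‖ * C, fun x => ?_⟩,
      hfs.subset (Function.support_const_smul_subset c f)⟩
    simpa using mul_le_mul_of_nonneg_left (hC x) (norm_nonneg c)

theorem measurable_haarInterval (a l : ℝ) (η : Bool) : Measurable (haarInterval a l η) := by
  have h : ∀ s : Set ℝ, MeasurableSet s → Measurable (s.indicator (1 : ℝ → ℝ)) :=
    fun s hs => measurable_one.indicator hs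
  unfold haarInterval
  cases η
  · simpa using (h _ measurableSet_Ico).const_mul _
  · simpa using ((h _ measurableSet_Ico).sub (h _ measurableSet_Ico)).const_mul _

theorem abs_haarInterval_le (a l : ℝ) (η : Bool) (x : ℝ) :
    |haarInterval a l η x| ≤ (√l)⁻¹ * 2 := by
  have h : ∀ s : Set ℝ, 0 ≤ s.indicator (1 : ℝ → ℝ) x ∧ s.indicator (1 : ℝ → ℝ) x ≤ 1 := by
    intro s
    by_cases hx : x ∈ s <;> simp [hx]
  have h1 := h (Ico a (a + l / 2))
  have h2 := h (Ico (a + l / 2) (a + l))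
  have h3 := h (Ico a (a + l))
  unfold haarInterval
  rw [abs_mul, abs_of_nonneg (a := (√l)⁻¹) (by positivity)]
  refine mul_le_mul_of_nonneg_left ?_ (by positivity)
  cases η
  · simp only [Bool.false_eq_true, if_false]
    rw [abs_le]; constructor <;> linarith [h3.1, h3.2]
  · simp only [if_true]
    rw [abs_le]; constructor <;> linarith [h1.1, h1.2, h2.1, h2.2]

theorem mem_of_haarInterval_ne_zero {a l : ℝ} (hl : 0 ≤ l) {η : Bool} {x : ℝ}
    (h : haarInterval a l η x ≠ 0) : x ∈ Ico a (a + l) := by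
  by_contra hx
  apply h
  have h1 : x ∉ Ico a (a + l / 2) := fun hh => hx ⟨hh.1, by linarith [hh.2]⟩
  have h2 : x ∉ Ico (a + l / 2) (a + l) := fun hh => hx ⟨by linarith [hh.1], hh.2⟩
  simp only [haarInterval, indicator_of_notMem hx, indicator_of_notMem h1,
    indicator_of_notMem h2]
  simp

theorem measurable_haar {n : ℕ} (w : GridParam n) (I : DyadicCube n) (η : Fin n → Bool) :
    Measurable (haar w I η) := by
  unfold haar
  exact Finset.measurable_fun_prod _
    fun a _ => (measurable_haarInterval _ _ _).comp (measurable_pi_apply a)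

theorem abs_haar_le {n : ℕ} (w : GridParam n) (I : DyadicCube n) (η : Fin n → Bool)
    (x : Fin n → ℝ) : |haar w I η x| ≤ ((√I.side)⁻¹ * 2) ^ n := by
  unfold haar
  rw [Finset.abs_prod]
  calc ∏ a, |haarInterval (I.corner w a) I.side (η a) (x a)|
      ≤ ∏ _a : Fin n, (√I.side)⁻¹ * 2 :=
        Finset.prod_le_prod (fun _ _ => abs_nonneg _) fun a _ => abs_haarInterval_le _ _ _ _
    _ = ((√I.side)⁻¹ * 2) ^ n := by simp

theorem support_haar_subset {n : ℕ} (w : GridParam n) (I : DyadicCube n) (η : Fin n → Bool) :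
    Function.support (haar w I η) ⊆ I.translate w := by
  intro x hx a _
  have h0 : (0 : ℝ) ≤ I.side := by unfold DyadicCube.side; positivity
  exact mem_of_haarInterval_ne_zero h0 (Finset.prod_ne_zero_iff.1 hx a (Finset.mem_univ a))

theorem isBounded_translate {n : ℕ} (w : GridParam n) (I : DyadicCube n) :
    Bornology.IsBounded (I.translate w) :=
  Bornology.IsBounded.pi fun _ => Metric.isBounded_Ico _ _

/-- The tensor product `h ⊗ u` of a Haar function `h` of the cube `I + w` in `ℝⁿ` and a Haar
function `u` of the cube `J + v` in `ℝᵐ`. -/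
noncomputable def haarTensor {n m : ℕ} (w : GridParam n) (v : GridParam m)
    (I : DyadicCube n) (η : Fin n → Bool) (J : DyadicCube m) (θ : Fin m → Bool) :
    TestFun n m :=
  ⟨fun x => (haar w I η x.1 : ℂ) * (haar v J θ x.2 : ℂ), by
    refine ⟨?_, ⟨((√I.side)⁻¹ * 2) ^ n * ((√J.side)⁻¹ * 2) ^ m, fun x => ?_⟩, ?_⟩
    · exact (Complex.measurable_ofReal.comp ((measurable_haar w I η).comp measurable_fst)).mul
        (Complex.measurable_ofReal.comp ((measurable_haar v J θ).comp measurable_snd))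
    · rw [norm_mul, Complex.norm_real, Complex.norm_real]
      exact mul_le_mul (abs_haar_le w I η x.1) (abs_haar_le v J θ x.2) (abs_nonneg _)
        (by positivity)
    · refine ((isBounded_translate w I).prod (isBounded_translate v J)).subset fun x hx => ?_
      have hx' : (haar w I η x.1 : ℂ) ≠ 0 ∧ (haar v J θ x.2 : ℂ) ≠ 0 := mul_ne_zero_iff.1 hx
      exact ⟨support_haar_subset w I η (by simpa using hx'.1),
        support_haar_subset v J θ (by simpa using hx'.2)⟩⟩

/-- The bilinear pairing `⟨f, h⟩ = ∫ f h`. -/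
noncomputable def pairing {n m : ℕ} (f h : TestFun n m) : ℂ :=
  ∫ x, (f : Space n m → ℂ) x * (h : Space n m → ℂ) x

/-- The summand with cubes `I₁ + w`, `I₂ + w`, `J₁ + v`, `J₂ + v`, including the finite summation
over the cancellative Haar functions of these cubes. Here `T` is an operator given by the bilinear
form `⟨T f, g⟩ = T f g`. -/
noncomputable def averagingTerm {n m : ℕ} (δ : ℝ) (r : ℕ)
    (T : TestFun n m →ₗ[ℂ] TestFun n m →ₗ[ℂ] ℂ) (f g : TestFun n m)
    (w : GridParam n) (v : GridParam m) (I₁ I₂ : DyadicCube n) (J₁ J₂ : DyadicCube m) : ℂ :=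
  goodInd δ r w (I₁.smaller I₂) * goodInd δ r v (J₁.smaller J₂) *
    ∑ η₁ : CancIndex n, ∑ η₂ : CancIndex n, ∑ θ₁ : CancIndex m, ∑ θ₂ : CancIndex m,
      T (haarTensor w v I₁ η₁ J₁ θ₁) (haarTensor w v I₂ η₂ J₂ θ₂) *
        pairing f (haarTensor w v I₁ η₁ J₁ θ₁) * pairing g (haarTensor w v I₂ η₂ J₂ θ₂)

/-- The summand, as a function of the positions of the four cubes, for given scales
`K = (k₁, k₂, l₁, l₂)`, that is `ℓ(I₁) = 2 ^ (-k₁)`, `ℓ(I₂) = 2 ^ (-k₂)`, `ℓ(J₁) = 2 ^ (-l₁)`,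
`ℓ(J₂) = 2 ^ (-l₂)`. -/
noncomputable def scaleTerm {n m : ℕ} (δ : ℝ) (r : ℕ)
    (T : TestFun n m →ₗ[ℂ] TestFun n m →ₗ[ℂ] ℂ) (f g : TestFun n m)
    (w : GridParam n) (v : GridParam m) (K : ℤ × ℤ × ℤ × ℤ)
    (P : (Fin n → ℤ) × (Fin n → ℤ) × (Fin m → ℤ) × (Fin m → ℤ)) : ℂ :=
  averagingTerm δ r T f g w v ⟨K.1, P.1⟩ ⟨K.2.1, P.2.1⟩ ⟨K.2.2.1, P.2.2.1⟩ ⟨K.2.2.2, P.2.2.2⟩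

/-- The sum over all cubes of given scales. -/
noncomputable def scaleSum {n m : ℕ} (δ : ℝ) (r : ℕ)
    (T : TestFun n m →ₗ[ℂ] TestFun n m →ₗ[ℂ] ℂ) (f g : TestFun n m)
    (w : GridParam n) (v : GridParam m) (K : ℤ × ℤ × ℤ × ℤ) : ℂ :=
  ∑' P, scaleTerm δ r T f g w v K P

/-- The sum over all cubes `I₁, I₂` of the grid with parameter `w` and all cubes `J₁, J₂` of the
grid with parameter `v`, arranged according to the scales of the cubes. -/
noncomputable def gridSum {n m : ℕ} (δ : ℝ) (r : ℕ)
    (T : TestFun n m →ₗ[ℂ] TestFun n m →ₗ[ℂ] ℂ) (f g : TestFun n m)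
    (w : GridParam n) (v : GridParam m) : ℂ :=
  ∑' K, scaleSum δ r T f g w v K

end BiHaar

open BiHaar

/-! Summing the Haar expansion over all cubes of one scale gives the martingale difference `D_k =
E_{k+1} - E_k`, where `E_k` averages over the cubes of side length `2 ^ (-k)`. The formula thus
concerns sums of `T (D_{k₁} f) (D_{k₂} g)` in which the positions of the smaller cubes are
restricted to the good ones.

In one parameter, restrict to scales in `[a, b)` and sum over the larger cubes before taking
expectations. The sum telescopes (`sum_scaleForm`) to terms `T (D_k^good f) (E_{k+1} g) + T (E_k f)
(D_k^good g)`, up to remainders containing `E_a`. This order is essential. Goodness of a cube of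
scale `k` depends only on the bits `wⁱ` with `i ≤ k` (`isGood_congr`), whereas `E_k`, `E_{k+1}` and
each martingale difference on a cube of scale `k` depend only on the bits with `i > k`; individual
larger cubes depend on both kinds. After telescoping, independence extracts the factor `π_good`
(`integral_goodInd_mul`). Undoing the telescoping without goodness leaves `π_good * T (E_b f - E_a
f) (E_b g - E_a g)`, which tends to `π_good * T f g`, and the remainders vanish because averages
over huge cubes decay in `L^p` for `p > 1`. This is `hasSum_integral_scaleForm`.

In two parameters, for fixed `v` and fixed scales in `ℝᵐ`, the one-parameter formula is applied in
`ℝⁿ` to martingale differences in the second variable. What remains is a one-parameter sum in `ℝᵐ`,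
handled by the same formula for `swapForm T` (`integral_gridSum`).

Interchanging sums and expectations rests on bounds uniform in the grids
(`TestFun.lpNorm_diff_diffSnd_le`): the Lipschitz condition gives decay at small scales, and `p, q >
1` give decay at large scales. Measurability in the grid parameters comes from continuity: the
functions involved vary continuously in `L^p` (`TameFamily`), and goodness is a countable
intersection of conditions on finitely many bits. -/

namespace BiHaar

open MeasureTheory Set Filter
open scoped ENNReal Topology

variable {n m : ℕ}

/-! ### Translations of the grids and positions of points. -/

/-- The bit of a Boolean, as a real number. -/
def bit (b : Bool) : ℝ := if b then 1 else 0

theorem bit_nonneg (b : Bool) : 0 ≤ bit b := by cases b <;> simp [bit]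

theorem bit_le_one (b : Bool) : bit b ≤ 1 := by cases b <;> simp [bit]

/-- The translation `∑_{i > k} 2 ^ (-i) wⁱ` of the cubes of scale `k`. -/
noncomputable def shift (w : GridParam n) (k : ℤ) (a : Fin n) : ℝ :=
  ∑' j : ℕ, (2 : ℝ) ^ (-(k + 1 + j)) * bit (w (k + 1 + j) a)

theorem two_zpow_neg_add (k : ℤ) (j : ℕ) :
    (2 : ℝ) ^ (-(k + 1 + j)) = (2 : ℝ) ^ (-(k + 1)) * (1 / 2) ^ j := by
  rw [neg_add, zpow_add₀ two_ne_zero, zpow_neg _ (j : ℤ), zpow_natCast, one_div, inv_pow]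

theorem summable_two_zpow_neg_add (k : ℤ) : Summable fun j : ℕ => (2 : ℝ) ^ (-(k + 1 + j)) := by
  simp_rw [two_zpow_neg_add]
  exact summable_geometric_two.mul_left _

theorem norm_shift_term_le (w : GridParam n) (k : ℤ) (a : Fin n) (j : ℕ) :
    ‖(2 : ℝ) ^ (-(k + 1 + j)) * bit (w (k + 1 + j) a)‖ ≤ (2 : ℝ) ^ (-(k + 1 + j)) := by
  rw [Real.norm_of_nonneg (mul_nonneg (by positivity) (bit_nonneg _))]
  exact mul_le_of_le_one_right (by positivity) (bit_le_one _)

theorem summable_shift (w : GridParam n) (k : ℤ) (a : Fin n) :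
    Summable fun j : ℕ => (2 : ℝ) ^ (-(k + 1 + j)) * bit (w (k + 1 + j) a) :=
  Summable.of_norm_bounded (summable_two_zpow_neg_add k) (norm_shift_term_le w k a)

theorem shift_eq_add (w : GridParam n) (k : ℤ) (a : Fin n) :
    shift w k a = (2 : ℝ) ^ (-(k + 1)) * bit (w (k + 1) a) + shift w (k + 1) a := by
  rw [shift, (summable_shift w k a).tsum_eq_zero_add, shift]
  congr 1
  · simp
  · refine tsum_congr fun j => ?_
    have : k + 1 + ((j + 1 : ℕ) : ℤ) = k + 1 + 1 + j := by push_cast; ring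
    rw [this]

/-- One half of the independence argument: the grid at scale `k` sees only the bits beyond `k`. The
other half is `isGood_congr`. -/
theorem shift_congr {w w' : GridParam n} {k : ℤ} (h : ∀ i, k < i → w i = w' i) :
    shift w k = shift w' k := by
  funext a
  refine tsum_congr fun j => ?_
  rw [h _ (by lia)]

theorem shift_nonneg (w : GridParam n) (k : ℤ) (a : Fin n) : 0 ≤ shift w k a :=
  tsum_nonneg fun _ => mul_nonneg (by positivity) (bit_nonneg _)

theorem shift_le (w : GridParam n) (k : ℤ) (a : Fin n) : shift w k a ≤ (2 : ℝ) ^ (-k) := by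
  refine ((summable_shift w k a).tsum_le_tsum
    (fun j => (Real.le_norm_self _).trans (norm_shift_term_le w k a j))
    (summable_two_zpow_neg_add k)).trans_eq ?_
  simp_rw [two_zpow_neg_add]
  rw [tsum_mul_left, tsum_geometric_two, neg_add, zpow_add₀ two_ne_zero, mul_assoc]
  norm_num

@[fun_prop]
theorem continuous_shift (k : ℤ) (a : Fin n) :
    Continuous fun w : GridParam n => shift w k a := by
  refine continuous_tsum (fun j => ?_) (summable_two_zpow_neg_add k)
    fun j w => norm_shift_term_le w k a j
  refine continuous_const.mul ((continuous_of_discreteTopology (f := bit)).comp ?_)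
  exact (continuous_apply a).comp (continuous_apply (k + 1 + (j : ℤ)))

namespace DyadicCube

theorem side_pos (I : DyadicCube n) : 0 < I.side := by unfold side; positivity

theorem corner_eq (w : GridParam n) (I : DyadicCube n) (a : Fin n) :
    I.corner w a = I.side * I.pos a + shift w I.scale a := by
  have key : ∀ i : ℤ, (2 : ℝ) ^ (-i) < I.side ↔ I.scale < i := fun i => by
    rw [side, zpow_lt_zpow_iff_right₀ one_lt_two, neg_lt_neg_iff]
  let e : ℕ ≃ {i : ℤ // (2 : ℝ) ^ (-i) < I.side} :=
    { toFun := fun j => ⟨I.scale + 1 + j, (key _).2 (by lia)⟩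
      invFun := fun i => (i.1 - I.scale - 1).toNat
      left_inv := fun j => by
        simp only
        lia
      right_inv := fun i => by
        have := (key _).1 i.2
        ext
        simp only
        lia }
  unfold corner shift
  rw [← e.tsum_eq]
  rfl

end DyadicCube

/-- The position of the cube of scale `k` of the grid with parameter `w` that contains `x`. -/
noncomputable def idx (w : GridParam n) (k : ℤ) (x : Fin n → ℝ) : Fin n → ℤ :=
  fun a => ⌊(x a - shift w k a) * 2 ^ k⌋

theorem floor_eq_iff_mem_Ico (t s : ℝ) (k p : ℤ) :
    ⌊(t - s) * 2 ^ k⌋ = p ↔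
      t ∈ Ico ((2 : ℝ) ^ (-k) * p + s) ((2 : ℝ) ^ (-k) * p + s + (2 : ℝ) ^ (-k)) := by
  have h2 : (0 : ℝ) < 2 ^ k := by positivity
  rw [Int.floor_eq_iff, mem_Ico, zpow_neg, ← le_sub_iff_add_le, inv_mul_le_iff₀ h2,
    mul_comm _ ((2 : ℝ) ^ k)]
  refine and_congr Iff.rfl ?_
  rw [show ((2 : ℝ) ^ k)⁻¹ * p + s + ((2 : ℝ) ^ k)⁻¹ = ((2 : ℝ) ^ k)⁻¹ * (p + 1) + s by ring,
    ← sub_lt_iff_lt_add (a := t), lt_inv_mul_iff₀ h2]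

theorem mem_translate_iff (w : GridParam n) (I : DyadicCube n) (x : Fin n → ℝ) :
    x ∈ I.translate w ↔ idx w I.scale x = I.pos := by
  simp only [DyadicCube.translate, mem_univ_pi, funext_iff, idx, floor_eq_iff_mem_Ico,
    DyadicCube.corner_eq]
  rfl

theorem idx_congr {w w' : GridParam n} {k : ℤ} (h : ∀ i, k < i → w i = w' i)
    (x : Fin n → ℝ) : idx w k x = idx w' k x := by
  unfold idx
  rw [shift_congr h]

theorem measurable_idx (w : GridParam n) (k : ℤ) : Measurable (idx w k) :=
  measurable_pi_iff.2 fun a =>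
    (((measurable_pi_apply a).sub_const _).mul_const _).floor

/-- The cube of the grid that has the given position. -/
theorem setOf_idx_eq (w : GridParam n) (k : ℤ) (p : Fin n → ℤ) :
    {x | idx w k x = p} = (⟨k, p⟩ : DyadicCube n).translate w := by
  ext x
  exact (mem_translate_iff w ⟨k, p⟩ x).symm

theorem volume_setOf_idx_eq (w : GridParam n) (k : ℤ) (p : Fin n → ℤ) :
    volume {x | idx w k x = p} = ENNReal.ofReal (((2 : ℝ) ^ (-k)) ^ n) := by
  rw [setOf_idx_eq, DyadicCube.translate, Real.volume_pi_Ico, ENNReal.ofReal_pow (by positivity)]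
  simp [DyadicCube.side]

theorem measureReal_setOf_idx_eq (w : GridParam n) (k : ℤ) (p : Fin n → ℤ) :
    volume.real {x | idx w k x = p} = ((2 : ℝ) ^ (-k)) ^ n := by
  rw [Measure.real, volume_setOf_idx_eq, ENNReal.toReal_ofReal (by positivity)]

theorem dist_le_of_idx_eq {w : GridParam n} {k : ℤ} {x x' : Fin n → ℝ}
    (h : idx w k x = idx w k x') : dist x x' ≤ (2 : ℝ) ^ (-k) := by
  refine (dist_pi_le_iff (by positivity)).2 fun a => ?_
  have h1 := (floor_eq_iff_mem_Ico _ _ _ _).1 (congrFun h a)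
  have h2 := (floor_eq_iff_mem_Ico (x' a) (shift w k a) k _).1 rfl
  rw [Real.dist_eq, abs_le]
  simp only [mem_Ico, idx] at h1 h2
  constructor <;> linarith [h1.1, h1.2, h2.1, h2.2]

/-- The finitely many positions of the cubes of scale `k` that may meet the ball of radius `R`. -/
noncomputable def window (n : ℕ) (k : ℤ) (R : ℝ) : Finset (Fin n → ℤ) :=
  Fintype.piFinset fun _ => Finset.Icc ⌊-(R * 2 ^ k) - 1⌋ ⌊R * 2 ^ k⌋

theorem idx_mem_window (w : GridParam n) (k : ℤ) {R : ℝ} {x : Fin n → ℝ} (hx : ‖x‖ ≤ R) :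
    idx w k x ∈ window n k R := by
  simp only [window, Fintype.mem_piFinset, Finset.mem_Icc, idx]
  intro a
  have h2 : (0 : ℝ) < 2 ^ k := by positivity
  have h1 := abs_le.1 ((norm_le_pi_norm x a).trans hx)
  have h3 := shift_nonneg w k a
  have h4 := shift_le w k a
  -- The rescaled shift lies in `[0, 1]`; this is the source of the `-1` at the lower end of
  -- `window`.
  rw [zpow_neg, ← one_div, le_div_iff₀ h2] at h4
  constructor <;> apply Int.floor_le_floor <;> nlinarith

/-- Nesting of the grid: the shift at scale `k` exceeds that at scale `k + 1` by the bit times the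
side of a child, so a parent at `p` has children at `2 p + bit` and `2 p + bit + 1` in each
coordinate. -/
theorem idx_add_one (w : GridParam n) (k : ℤ) (x : Fin n → ℝ) (a : Fin n) :
    idx w k x a = (idx w (k + 1) x a - (if w (k + 1) a then 1 else 0)) / 2 := by
  have h2 : (0 : ℝ) < 2 ^ k := by positivity
  have e : (x a - shift w k a) * 2 ^ k
      = ((x a - shift w (k + 1) a) * 2 ^ (k + 1) - bit (w (k + 1) a)) / 2 := by
    rw [shift_eq_add, zpow_neg, zpow_add₀ two_ne_zero]
    field_simp
    ring
  have e2 : bit (w (k + 1) a) = ((if w (k + 1) a then 1 else 0 : ℤ) : ℝ) := by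
    cases w (k + 1) a <;> simp [bit]
  unfold idx
  rw [e, e2, show (2 : ℝ) = ((2 : ℕ) : ℝ) by norm_num, Int.floor_div_natCast, Int.floor_sub_intCast]
  norm_num

/-- For almost every `x`, the cube of scale `k` that contains `x` is locally constant in `w`. -/
theorem ae_eventually_idx_eq (w₀ : GridParam n) (k : ℤ) :
    ∀ᵐ x : Fin n → ℝ, ∀ᶠ w in 𝓝 w₀, idx w k x = idx w₀ k x := by
  have h : ∀ᵐ x : Fin n → ℝ, ∀ (a : Fin n) (p : ℤ), x a ≠ (2 : ℝ) ^ (-k) * p + shift w₀ k a := by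
    simp only [ae_all_iff]
    intro a p
    exact Measure.ae_eval_ne _ _ _
  filter_upwards [h] with x hx
  have : ∀ a, ∀ᶠ w in 𝓝 w₀, idx w k x a = idx w₀ k x a := by
    intro a
    have h1 := (floor_eq_iff_mem_Ico (x a) (shift w₀ k a) k _).1 rfl
    -- Off the null set of grid hyperplanes, `x` is interior to its cube, and this persists under
    -- small changes of the shift.
    have h2 : x a ∈ Ioo ((2 : ℝ) ^ (-k) * (idx w₀ k x a) + shift w₀ k a)
        ((2 : ℝ) ^ (-k) * (idx w₀ k x a) + shift w₀ k a + (2 : ℝ) ^ (-k)) :=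
      ⟨lt_of_le_of_ne h1.1 (hx a _).symm, h1.2⟩
    have c := (continuous_shift (n := n) k a).continuousAt (x := w₀)
    have c1 : ContinuousAt (fun w => (2 : ℝ) ^ (-k) * (idx w₀ k x a) + shift w k a) w₀ :=
      continuousAt_const.add c
    filter_upwards [c1.eventually_lt continuousAt_const h2.1,
      continuousAt_const.eventually_lt (c1.add continuousAt_const) h2.2] with w h3 h4
    exact (floor_eq_iff_mem_Ico _ _ _ _).2 ⟨h3.le, h4⟩
  filter_upwards [eventually_all.2 this] with w hw
  exact funext hw

/-! ### Pointwise estimates of averages and martingale differences. -/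

/-- The average of `φ` over the cube of scale `k` that contains `x`. -/
noncomputable def avg (w : GridParam n) (k : ℤ) (φ : (Fin n → ℝ) → ℂ) (x : Fin n → ℝ) : ℂ :=
  (((2 : ℝ) ^ k) ^ n) • ∫ x' in {x' | idx w k x' = idx w k x}, φ x'

/-- The martingale difference of `φ` at the scale `k`. -/
noncomputable def dif (w : GridParam n) (k : ℤ) (φ : (Fin n → ℝ) → ℂ) (x : Fin n → ℝ) : ℂ :=
  avg w (k + 1) φ x - avg w k φ x

/-- The side length `2 ^ (-k)` cut off from below at `1`. -/
noncomputable def largePart (k : ℤ) : ℝ := max 1 ((2 : ℝ) ^ (-k))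

/-- The side length `2 ^ (-k)` cut off from above at `1`. -/
noncomputable def smallPart (k : ℤ) : ℝ := min 1 ((2 : ℝ) ^ (-k))

theorem one_le_largePart (k : ℤ) : 1 ≤ largePart k := le_max_left _ _

theorem largePart_pos (k : ℤ) : 0 < largePart k := one_pos.trans_le (one_le_largePart k)

theorem smallPart_pos (k : ℤ) : 0 < smallPart k := lt_min one_pos (by positivity)

theorem smallPart_le_one (k : ℤ) : smallPart k ≤ 1 := min_le_left _ _

theorem largePart_le_two_mul (k : ℤ) : largePart k ≤ 2 * largePart (k + 1) := by
  refine max_le (by linarith [one_le_largePart (k + 1)]) ?_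
  have h : (2 : ℝ) ^ (-(k + 1)) ≤ largePart (k + 1) := le_max_right _ _
  rw [neg_add, zpow_add₀ two_ne_zero] at h
  norm_num at h
  rw [zpow_neg]
  linarith

theorem two_zpow_mul_measureReal (w : GridParam n) (k : ℤ) (x : Fin n → ℝ) :
    ((2 : ℝ) ^ k) ^ n * volume.real {x' | idx w k x' = idx w k x} = 1 := by
  rw [measureReal_setOf_idx_eq, ← mul_pow, ← zpow_add₀ two_ne_zero]
  simp

theorem volume_setOf_idx_lt_top (w : GridParam n) (k : ℤ) (p : Fin n → ℤ) :
    volume {x' | idx w k x' = p} < ⊤ := by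
  rw [volume_setOf_idx_eq]
  exact ENNReal.ofReal_lt_top

theorem measurableSet_setOf_idx_eq (w : GridParam n) (k : ℤ) (p : Fin n → ℤ) :
    MeasurableSet {x' | idx w k x' = p} :=
  measurable_idx w k (measurableSet_singleton p)

theorem norm_avg_le_of_le (w : GridParam n) (k : ℤ) {φ : (Fin n → ℝ) → ℂ} {M : ℝ}
    (hM : ∀ x, ‖φ x‖ ≤ M) (x : Fin n → ℝ) : ‖avg w k φ x‖ ≤ M := by
  have h := norm_setIntegral_le_of_norm_le_const (f := φ)
    (volume_setOf_idx_lt_top w k (idx w k x)) fun x' _ => hM x'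
  rw [avg, norm_smul, Real.norm_of_nonneg (by positivity)]
  calc _ ≤ ((2 : ℝ) ^ k) ^ n * (M * volume.real {x' | idx w k x' = idx w k x}) := by gcongr
    _ = M := by rw [mul_left_comm, two_zpow_mul_measureReal, mul_one]

theorem norm_avg_le_of_support (w : GridParam n) (k : ℤ) {φ : (Fin n → ℝ) → ℂ} {M R : ℝ}
    (hM : ∀ x, ‖φ x‖ ≤ M) (hR : 0 ≤ R) (hφ : ∀ x, φ x ≠ 0 → ‖x‖ ≤ R) (x : Fin n → ℝ) :
    ‖avg w k φ x‖ ≤ M * (((2 : ℝ) ^ k) ^ n * (2 * R) ^ n) := by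
  have hM0 : 0 ≤ M := (norm_nonneg _).trans (hM 0)
  have hb : volume.real (Metric.closedBall (0 : Fin n → ℝ) R) = (2 * R) ^ n := by
    rw [Measure.real, Real.volume_pi_closedBall _ hR, ENNReal.toReal_ofReal (by positivity)]
    simp
  have hb' : volume (Metric.closedBall (0 : Fin n → ℝ) R) < ⊤ := measure_closedBall_lt_top
  set S := {x' | idx w k x' = idx w k x} with hS
  have e : ∫ x' in S, φ x' = ∫ x' in S ∩ Metric.closedBall 0 R, φ x' := by
    refine setIntegral_eq_of_subset_of_forall_sdiff_eq_zero (μ := volume) (f := φ)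
      (s := S ∩ Metric.closedBall 0 R) (measurableSet_setOf_idx_eq w k (idx w k x))
      inter_subset_left fun x' hx' => ?_
    by_contra h
    exact hx'.2 ⟨hx'.1, mem_closedBall_zero_iff.2 (hφ x' h)⟩
  have h := norm_setIntegral_le_of_norm_le_const (f := φ) (μ := volume)
    (s := S ∩ Metric.closedBall 0 R) ((measure_mono inter_subset_right).trans_lt hb')
    fun x' _ => hM x'
  rw [avg, norm_smul, Real.norm_of_nonneg (by positivity), e, mul_left_comm, ← hb]
  refine mul_le_mul_of_nonneg_left (h.trans ?_) (by positivity)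
  exact mul_le_mul_of_nonneg_left (measureReal_mono inter_subset_right hb'.ne) hM0

/-- On cubes of side at most `1` the trivial bound `M` is used, on larger ones the volume `(2 * R) ^
n` of the support divided by that of the cube; the constant adds the two cases. -/
theorem norm_avg_le (w : GridParam n) (k : ℤ) {φ : (Fin n → ℝ) → ℂ} {M R : ℝ}
    (hM : ∀ x, ‖φ x‖ ≤ M) (hR : 0 ≤ R) (hφ : ∀ x, φ x ≠ 0 → ‖x‖ ≤ R) (x : Fin n → ℝ) :
    ‖avg w k φ x‖ ≤ (1 + (2 * R) ^ n) * M / largePart k ^ n := by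
  have hM0 : 0 ≤ M := (norm_nonneg _).trans (hM 0)
  have hR' : 0 ≤ (2 * R) ^ n := by positivity
  rcases le_total 1 ((2 : ℝ) ^ (-k)) with h | h
  · rw [largePart, max_eq_right h, zpow_neg, inv_pow, div_inv_eq_mul]
    refine (norm_avg_le_of_support w k hM hR hφ x).trans ?_
    have : 0 ≤ ((2 : ℝ) ^ k) ^ n := by positivity
    nlinarith [mul_nonneg hM0 this]
  · rw [largePart, max_eq_left h, one_pow, div_one]
    refine (norm_avg_le_of_le w k hM x).trans ?_
    nlinarith

theorem norm_avg_sub_le (w : GridParam n) (k : ℤ) {φ : (Fin n → ℝ) → ℂ} {L : ℝ}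
    (hφi : Integrable φ) (hL : ∀ x x', ‖φ x - φ x'‖ ≤ L * ‖x - x'‖) (hL0 : 0 ≤ L)
    (x : Fin n → ℝ) : ‖avg w k φ x - φ x‖ ≤ L * (2 : ℝ) ^ (-k) := by
  have hfin := volume_setOf_idx_lt_top w k (idx w k x)
  have e : avg w k φ x - φ x
      = (((2 : ℝ) ^ k) ^ n) • ∫ x' in {x' | idx w k x' = idx w k x}, (φ x' - φ x) := by
    rw [integral_sub hφi.integrableOn (integrableOn_const hfin.ne), setIntegral_const, smul_sub,
      smul_smul, two_zpow_mul_measureReal, one_smul, avg]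
  have h := norm_setIntegral_le_of_norm_le_const (f := fun x' => φ x' - φ x)
    (C := L * (2 : ℝ) ^ (-k)) hfin fun x' hx' => by
      refine (hL x' x).trans ?_
      rw [← dist_eq_norm]
      exact mul_le_mul_of_nonneg_left (dist_le_of_idx_eq hx') hL0
  rw [e, norm_smul, Real.norm_of_nonneg (by positivity)]
  calc _ ≤ ((2 : ℝ) ^ k) ^ n
        * (L * (2 : ℝ) ^ (-k) * volume.real {x' | idx w k x' = idx w k x}) := by gcongr
    _ = L * (2 : ℝ) ^ (-k) := by rw [mul_left_comm, two_zpow_mul_measureReal, mul_one]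

theorem exists_ne_zero_of_avg_ne_zero {w : GridParam n} {k : ℤ} {φ : (Fin n → ℝ) → ℂ}
    {x : Fin n → ℝ} (h : avg w k φ x ≠ 0) : ∃ x', idx w k x' = idx w k x ∧ φ x' ≠ 0 := by
  by_contra! h'
  apply h
  rw [avg, setIntegral_eq_zero_of_forall_eq_zero (t := {x' | idx w k x' = idx w k x}) h',
    smul_zero]

theorem norm_le_of_avg_ne_zero {w : GridParam n} {k : ℤ} {φ : (Fin n → ℝ) → ℂ} {R : ℝ}
    (hφ : ∀ x, φ x ≠ 0 → ‖x‖ ≤ R) {x : Fin n → ℝ} (h : avg w k φ x ≠ 0) :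
    ‖x‖ ≤ R + (2 : ℝ) ^ (-k) := by
  obtain ⟨x', h1, h2⟩ := exists_ne_zero_of_avg_ne_zero h
  have h3 := dist_le_of_idx_eq h1
  rw [dist_eq_norm, norm_sub_rev] at h3
  linarith [hφ x' h2, norm_le_norm_add_norm_sub' x x']

theorem norm_le_of_dif_ne_zero {w : GridParam n} {k : ℤ} {φ : (Fin n → ℝ) → ℂ} {R : ℝ}
    (hφ : ∀ x, φ x ≠ 0 → ‖x‖ ≤ R) {x : Fin n → ℝ} (h : dif w k φ x ≠ 0) :
    ‖x‖ ≤ R + (2 : ℝ) ^ (-k) := by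
  by_cases h1 : avg w k φ x = 0
  · refine (norm_le_of_avg_ne_zero (w := w) (k := k + 1) hφ (x := x) fun h2 => h ?_).trans ?_
    · rw [dif, h1, h2, sub_zero]
    · gcongr
      · norm_num
      · lia
  · exact norm_le_of_avg_ne_zero hφ h1

theorem avg_sub (w : GridParam n) (k : ℤ) {φ ψ : (Fin n → ℝ) → ℂ} (hφ : Integrable φ)
    (hψ : Integrable ψ) (x : Fin n → ℝ) :
    avg w k (fun x => φ x - ψ x) x = avg w k φ x - avg w k ψ x := by
  simp only [avg]
  rw [integral_sub hφ.integrableOn hψ.integrableOn, smul_sub]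

theorem dif_sub (w : GridParam n) (k : ℤ) {φ ψ : (Fin n → ℝ) → ℂ} (hφ : Integrable φ)
    (hψ : Integrable ψ) (x : Fin n → ℝ) :
    dif w k (fun x => φ x - ψ x) x = dif w k φ x - dif w k ψ x := by
  simp only [dif]
  rw [avg_sub _ _ hφ hψ, avg_sub _ _ hφ hψ]
  ring

/-- The constant of the size estimates of martingale differences. -/
noncomputable def difConst (n : ℕ) (R : ℝ) : ℝ := (2 ^ n + 1) * (1 + (2 * R) ^ n)

theorem difConst_nonneg (n : ℕ) {R : ℝ} (hR : 0 ≤ R) : 0 ≤ difConst n R := by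
  unfold difConst
  positivity

theorem norm_dif_le (w : GridParam n) (k : ℤ) {φ : (Fin n → ℝ) → ℂ} {M R : ℝ}
    (hM : ∀ x, ‖φ x‖ ≤ M) (hR : 0 ≤ R) (hφ : ∀ x, φ x ≠ 0 → ‖x‖ ≤ R) (x : Fin n → ℝ) :
    ‖dif w k φ x‖ ≤ difConst n R * M / largePart k ^ n := by
  have hM0 : 0 ≤ M := (norm_nonneg _).trans (hM 0)
  have hl := largePart_pos k
  have hl' := largePart_pos (k + 1)
  -- Expressing the bound for the finer average at scale `k` costs the factor `2 ^ n` in `difConst`.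
  have h1 : 1 / largePart (k + 1) ^ n ≤ 2 ^ n / largePart k ^ n := by
    rw [div_le_div_iff₀ (by positivity) (by positivity), one_mul, ← mul_pow]
    exact pow_le_pow_left₀ hl.le (largePart_le_two_mul k) n
  calc ‖dif w k φ x‖ ≤ (1 + (2 * R) ^ n) * M / largePart (k + 1) ^ n
        + (1 + (2 * R) ^ n) * M / largePart k ^ n :=
        (norm_sub_le _ _).trans (add_le_add (norm_avg_le w _ hM hR hφ x) (norm_avg_le w _ hM hR hφ x))
    _ = (1 + (2 * R) ^ n) * M * (1 / largePart (k + 1) ^ n)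
        + (1 + (2 * R) ^ n) * M / largePart k ^ n := by ring
    _ ≤ (1 + (2 * R) ^ n) * M * (2 ^ n / largePart k ^ n)
        + (1 + (2 * R) ^ n) * M / largePart k ^ n := by gcongr
    _ = _ := by rw [difConst]; ring

/-- At small scales both averages differ from `φ x` by at most `L * 2 ^ (-k)`, which gives the
additional factor `smallPart k`; at large scales that factor is `1`. -/
theorem norm_dif_le_of_lipschitz (w : GridParam n) (k : ℤ) {φ : (Fin n → ℝ) → ℂ} {M L R : ℝ}
    (hφi : Integrable φ) (hM : ∀ x, ‖φ x‖ ≤ M) (hR : 0 ≤ R) (hφ : ∀ x, φ x ≠ 0 → ‖x‖ ≤ R)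
    (hL : ∀ x x', ‖φ x - φ x'‖ ≤ L * ‖x - x'‖) (hL0 : 0 ≤ L) (x : Fin n → ℝ) :
    ‖dif w k φ x‖ ≤ (2 * L + difConst n R * M) * smallPart k / largePart k ^ n := by
  have hM0 : 0 ≤ M := (norm_nonneg _).trans (hM 0)
  have hC := mul_nonneg (difConst_nonneg n hR) hM0
  have hl := largePart_pos k
  rcases le_total 1 ((2 : ℝ) ^ (-k)) with h | h
  · refine (norm_dif_le w k hM hR hφ x).trans ?_
    rw [smallPart, min_eq_left h, mul_one]
    gcongr
    linarith
  · rw [largePart, max_eq_left h, one_pow, div_one, smallPart, min_eq_right h]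
    have e : dif w k φ x = (avg w (k + 1) φ x - φ x) - (avg w k φ x - φ x) := by
      rw [dif]; ring
    have h1 : (2 : ℝ) ^ (-(k + 1)) ≤ (2 : ℝ) ^ (-k) := by
      gcongr
      · norm_num
      · lia
    have h2 := norm_avg_sub_le w (k + 1) hφi hL hL0 x
    have h3 := norm_avg_sub_le w k hφi hL hL0 x
    have h4 := mul_le_mul_of_nonneg_left h1 hL0
    have h5 : 0 ≤ difConst n R * M * (2 : ℝ) ^ (-k) := by positivity
    rw [e]
    refine (norm_sub_le _ _).trans ?_
    linarith

/-! ### Haar functions and the kernels of martingale differences. -/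

theorem sqrt_inv_mul_self (k : ℤ) : (√((2 : ℝ) ^ (-k)))⁻¹ * (√((2 : ℝ) ^ (-k)))⁻¹ = 2 ^ k := by
  rw [← mul_inv, Real.mul_self_sqrt (by positivity), zpow_neg, inv_inv]

theorem haarInterval_false_mul (w : GridParam n) (I : DyadicCube n) (a : Fin n)
    (x x' : Fin n → ℝ) :
    haarInterval (I.corner w a) I.side false (x a) * haarInterval (I.corner w a) I.side false (x' a)
      = if idx w I.scale x a = I.pos a ∧ idx w I.scale x' a = I.pos a
        then 2 ^ I.scale else 0 := by
  have h : ∀ y : Fin n → ℝ, y a ∈ Ico (I.corner w a) (I.corner w a + I.side) ↔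
      idx w I.scale y a = I.pos a := fun y => by
    rw [idx, floor_eq_iff_mem_Ico, DyadicCube.corner_eq]; rfl
  simp only [haarInterval, Bool.false_eq_true, if_false, indicator_apply, h, Pi.one_apply]
  rw [mul_mul_mul_comm, DyadicCube.side, sqrt_inv_mul_self]
  by_cases h1 : idx w I.scale x a = I.pos a <;> by_cases h2 : idx w I.scale x' a = I.pos a <;>
    simp [h1, h2]

/-- The two Haar functions of an interval form an orthonormal basis of the functions constant on
each half, so their reproducing kernel is that of averaging over halves. -/
theorem haarInterval_sum_mul (w : GridParam n) (I : DyadicCube n) (a : Fin n)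
    (x x' : Fin n → ℝ) :
    ∑ b : Bool, haarInterval (I.corner w a) I.side b (x a)
        * haarInterval (I.corner w a) I.side b (x' a)
      = if idx w I.scale x a = I.pos a ∧ idx w (I.scale + 1) x' a = idx w (I.scale + 1) x a
        then 2 ^ (I.scale + 1) else 0 := by
  rw [Fintype.sum_bool, haarInterval_false_mul]
  set k := I.scale with hk
  set b : ℤ := if w (k + 1) a then 1 else 0 with hb
  have hb' : (b : ℝ) = bit (w (k + 1) a) := by rw [hb]; cases w (k + 1) a <;> simp [bit]
  have e0 : (2 : ℝ) ^ (-k) = 2 * 2 ^ (-(k + 1)) := by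
    rw [neg_add, zpow_add₀ two_ne_zero]; norm_num; ring
  have hs : I.side = 2 * 2 ^ (-(k + 1)) := e0
  -- The lower corner of `I`, read at scale `k + 1`, so that the halves get the positions `2 * I.pos
  -- a + b` and `2 * I.pos a + b + 1`.
  have hc : I.corner w a = (2 : ℝ) ^ (-(k + 1)) * ((2 * I.pos a + b : ℤ) : ℝ)
      + shift w (k + 1) a := by
    rw [DyadicCube.corner_eq, shift_eq_add, hs, ← hk]
    push_cast
    rw [hb']
    ring
  have hl : ∀ y : Fin n → ℝ, y a ∈ Ico (I.corner w a) (I.corner w a + I.side / 2) ↔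
      idx w (k + 1) y a = 2 * I.pos a + b := fun y => by
    rw [idx, floor_eq_iff_mem_Ico, hc, hs]
    ring_nf
  have hr : ∀ y : Fin n → ℝ, y a ∈ Ico (I.corner w a + I.side / 2) (I.corner w a + I.side) ↔
      idx w (k + 1) y a = 2 * I.pos a + b + 1 := fun y => by
    rw [idx, floor_eq_iff_mem_Ico, hc, hs]
    push_cast
    ring_nf
  simp only [haarInterval, if_true, indicator_apply, hl, hr, Pi.one_apply]
  rw [mul_mul_mul_comm, DyadicCube.side, sqrt_inv_mul_self, zpow_add₀ two_ne_zero, zpow_one]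
  have hx := idx_add_one w k x a
  have hx' := idx_add_one w k x' a
  rw [← hb] at hx hx'
  rw [hx, hx', ← hk]
  have hb2 : 0 ≤ b ∧ b ≤ 1 := by rw [hb]; split_ifs <;> simp
  generalize idx w (k + 1) x a = u at *
  generalize idx w (k + 1) x' a = v at *
  generalize I.pos a = p at *
  have key : ∀ z : ℤ, (z - b) / 2 = p ↔ z = 2 * p + b ∨ z = 2 * p + b + 1 := by intro z; lia
  simp only [key]
  by_cases h1 : u = 2 * p + b
  · subst h1
    by_cases h3 : v = 2 * p + b
    · subst h3; simp; ring
    · by_cases h4 : v = 2 * p + b + 1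
      · subst h4; simp
      · simp [h3, h4]
  · by_cases h2 : u = 2 * p + b + 1
    · subst h2
      by_cases h3 : v = 2 * p + b
      · subst h3; simp
      · by_cases h4 : v = 2 * p + b + 1
        · subst h4; simp; ring
        · simp [h3, h4]
    · simp [h1, h2]

/-- The sum over all `η` factorizes over the coordinates into the kernel of averaging over the
children; removing `η = 0` subtracts the kernel of averaging over `I`. -/
theorem sum_haar_mul_haar (w : GridParam n) (I : DyadicCube n) (x x' : Fin n → ℝ) :
    ∑ η : CancIndex n, haar w I η x * haar w I η x'
      = if idx w I.scale x = I.pos then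
          (if idx w (I.scale + 1) x' = idx w (I.scale + 1) x then ((2 : ℝ) ^ (I.scale + 1)) ^ n
            else 0) - (if idx w I.scale x' = idx w I.scale x then ((2 : ℝ) ^ I.scale) ^ n else 0)
        else 0 := by
  classical
  have e1 : ∑ η : CancIndex n, haar w I η x * haar w I η x'
      = (∑ η : Fin n → Bool, haar w I η x * haar w I η x')
        - haar w I (fun _ => false) x * haar w I (fun _ => false) x' := by
    rw [← Finset.sum_erase_eq_sub (Finset.mem_univ _)]
    refine (Finset.sum_subtype _ (fun η => ?_) fun η => haar w I η x * haar w I η x').symm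
    simp [funext_iff]
  have e2 : ∑ η : Fin n → Bool, haar w I η x * haar w I η x'
      = ∏ a, ∑ b : Bool, haarInterval (I.corner w a) I.side b (x a)
        * haarInterval (I.corner w a) I.side b (x' a) := by
    rw [Finset.prod_univ_sum, Fintype.piFinset_univ]
    simp only [haar, Finset.prod_mul_distrib]
  rw [e1, e2]
  simp only [haar, ← Finset.prod_mul_distrib, haarInterval_sum_mul, haarInterval_false_mul,
    Finset.prod_ite_zero, Finset.prod_const, Finset.card_univ, Fintype.card_fin, Finset.mem_univ,
    forall_true_left, forall_and, funext_iff]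
  by_cases h : ∀ a, idx w I.scale x a = I.pos a
  · simp [h]
  · simp only [h, false_and, if_false, sub_zero]

theorem integrable_haar_mul (w : GridParam n) (I : DyadicCube n) (η : Fin n → Bool)
    {φ : (Fin n → ℝ) → ℂ} (hφ : Integrable φ) :
    Integrable fun x' => (haar w I η x' : ℂ) * φ x' := by
  refine hφ.bdd_mul (c := ((√I.side)⁻¹ * 2) ^ n)
    (Complex.measurable_ofReal.comp (measurable_haar w I η)).aestronglyMeasurable
    (Eventually.of_forall fun x' => ?_)
  rw [Complex.norm_real]
  exact abs_haar_le w I η x'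

/-- The Haar expansion on a cube gives the martingale difference. -/
theorem sum_haar_mul_integral (w : GridParam n) (I : DyadicCube n) {φ : (Fin n → ℝ) → ℂ}
    (hφ : Integrable φ) (x : Fin n → ℝ) :
    ∑ η : CancIndex n, (haar w I η x : ℂ) * ∫ x', (haar w I η x' : ℂ) * φ x'
      = if idx w I.scale x = I.pos then dif w I.scale φ x else 0 := by
  have e : ∀ k, avg w k φ x = ∫ x', ((if idx w k x' = idx w k x then
      ((2 : ℝ) ^ k) ^ n else 0 : ℝ) : ℂ) * φ x' := by
    intro k
    rw [avg, ← integral_indicator (measurableSet_setOf_idx_eq _ _ _), ← integral_smul]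
    refine integral_congr_ae (Eventually.of_forall fun x' => ?_)
    by_cases h : idx w k x' = idx w k x <;> simp [h]
  have hi : ∀ k, Integrable fun x' => ((if idx w k x' = idx w k x then
      ((2 : ℝ) ^ k) ^ n else 0 : ℝ) : ℂ) * φ x' := by
    intro k
    refine hφ.bdd_mul (c := ((2 : ℝ) ^ k) ^ n) ?_ (Eventually.of_forall fun x' => ?_)
    · exact (Complex.measurable_ofReal.comp (Measurable.ite (measurableSet_setOf_idx_eq _ _ _)
        measurable_const measurable_const)).aestronglyMeasurable
    · rw [Complex.norm_real]
      split_ifs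
      · rw [Real.norm_of_nonneg (by positivity)]
      · simp only [norm_zero]; positivity
  simp_rw [← integral_const_mul]
  rw [← integral_finsetSum (f := fun (η : CancIndex n) x' =>
    (haar w I η x : ℂ) * ((haar w I η x' : ℂ) * φ x')) _
    fun η _ => (integrable_haar_mul w I η hφ).const_mul _]
  have e3 : ∀ x', ∑ η : CancIndex n, (haar w I η x : ℂ) * ((haar w I η x' : ℂ) * φ x')
      = ((∑ η : CancIndex n, haar w I η x * haar w I η x' : ℝ) : ℂ) * φ x' := by
    intro x'
    push_cast
    rw [Finset.sum_mul]
    exact Finset.sum_congr rfl fun η _ => by ring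
  simp_rw [e3, sum_haar_mul_haar]
  split_ifs with h
  · rw [dif, e, e, ← integral_sub (hi _) (hi _)]
    refine integral_congr_ae (Eventually.of_forall fun x' => ?_)
    simp only
    push_cast
    ring
  · simp

/-! ### Operators on test functions and their norms. -/

theorem integrable_of_bounded {X : Type*} [MeasurableSpace X] [PseudoMetricSpace X]
    [ProperSpace X] {μ : Measure X} [IsFiniteMeasureOnCompacts μ] {φ : X → ℂ}
    (hφ : Measurable φ) {C : ℝ} (hC : ∀ x, ‖φ x‖ ≤ C)
    (hs : Bornology.IsBounded (Function.support φ)) : Integrable φ μ := by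
  rw [← integrableOn_iff_integrable_of_support_subset (subset_closure (s := Function.support φ))]
  exact Measure.integrableOn_of_bounded hs.isCompact_closure.measure_lt_top.ne
    hφ.aestronglyMeasurable (Eventually.of_forall hC)

namespace TestFun

theorem measurable (f : TestFun n m) : Measurable (f : Space n m → ℂ) := f.2.1

theorem exists_bound (f : TestFun n m) : ∃ M R : ℝ, 0 ≤ M ∧ 0 ≤ R ∧
    (∀ x, ‖(f : Space n m → ℂ) x‖ ≤ M) ∧
    ∀ x, (f : Space n m → ℂ) x ≠ 0 → ‖x.1‖ ≤ R ∧ ‖x.2‖ ≤ R := by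
  obtain ⟨M, hM⟩ := f.2.2.1
  obtain ⟨R, hR⟩ := f.2.2.2.exists_norm_le
  refine ⟨M, max R 0, (norm_nonneg _).trans (hM 0), le_max_right _ _, hM, fun x hx => ?_⟩
  have := (hR x hx).trans (le_max_left R 0)
  exact ⟨(norm_fst_le x).trans this, (norm_snd_le x).trans this⟩

theorem integrable (f : TestFun n m) : Integrable (f : Space n m → ℂ) := by
  obtain ⟨M, hM⟩ := f.2.2.1
  exact integrable_of_bounded (TestFun.measurable f) hM f.2.2.2

theorem integrable_slice (f : TestFun n m) (y : Fin m → ℝ) :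
    Integrable fun x => (f : Space n m → ℂ) (x, y) := by
  obtain ⟨M, R, _, _, hM, hR⟩ := TestFun.exists_bound f
  refine integrable_of_bounded ((TestFun.measurable f).comp (by fun_prop)) (fun x => hM (x, y)) ?_
  exact isBounded_iff_forall_norm_le.2 ⟨R, fun x hx => (hR _ hx).1⟩

/-- Interchange of the two variables. -/
def swap (n m : ℕ) : TestFun n m →ₗ[ℂ] TestFun m n where
  toFun f := ⟨fun x => (f : Space n m → ℂ) x.swap, (TestFun.measurable f).comp measurable_swap, by
    obtain ⟨M, R, _, _, hM, hR⟩ := TestFun.exists_bound f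
    refine ⟨⟨M, fun x => hM x.swap⟩, isBounded_iff_forall_norm_le.2 ⟨R, fun x hx => ?_⟩⟩
    have := hR _ hx
    exact max_le this.2 this.1⟩
  map_add' _ _ := rfl
  map_smul' _ _ := rfl

theorem sub_apply (f g : TestFun n m) (x : Space n m) :
    ((f - g : TestFun n m) : Space n m → ℂ) x = (f : Space n m → ℂ) x - (g : Space n m → ℂ) x :=
  rfl

theorem measurable_avg (w : GridParam n) (k : ℤ) (f : TestFun n m) :
    Measurable fun x : Space n m => avg w k (fun x' => (f : Space n m → ℂ) (x', x.2)) x.1 := by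
  have e : (fun x : Space n m => avg w k (fun x' => (f : Space n m → ℂ) (x', x.2)) x.1)
      = fun x => (((2 : ℝ) ^ k) ^ n) • ∫ x', (if idx w k x' = idx w k x.1 then
          (f : Space n m → ℂ) (x', x.2) else 0) := by
    funext x
    rw [avg, ← integral_indicator (measurableSet_setOf_idx_eq _ _ _)]
    simp only [indicator_apply, mem_ofPred_eq]
  rw [e]
  refine Measurable.fun_const_smul ?_ _
  refine (StronglyMeasurable.integral_prod_right (f := fun (x : Space n m) (x' : Fin n → ℝ) =>
    if idx w k x' = idx w k x.1 then (f : Space n m → ℂ) (x', x.2) else 0) ?_).measurable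
  refine Measurable.stronglyMeasurable (Measurable.ite ?_ ?_ measurable_const)
  · exact measurableSet_eq_fun ((measurable_idx w k).comp (by fun_prop))
      ((measurable_idx w k).comp (by fun_prop))
  · exact (TestFun.measurable f).comp (by fun_prop)

/-- The averaging operator at scale `k`, in the first variable. -/
noncomputable def average (w : GridParam n) (k : ℤ) (f : TestFun n m) : TestFun n m :=
  ⟨fun x => avg w k (fun x' => (f : Space n m → ℂ) (x', x.2)) x.1, measurable_avg w k f, by
    obtain ⟨M, R, _, _, hM, hR⟩ := TestFun.exists_bound f
    refine ⟨⟨M, fun x => norm_avg_le_of_le _ _ (fun x' => hM _) _⟩,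
      isBounded_iff_forall_norm_le.2 ⟨R + 2 ^ (-k), fun x hx => ?_⟩⟩
    refine max_le (norm_le_of_avg_ne_zero (fun x' hx' => (hR _ hx').1) hx) ?_
    obtain ⟨x', _, hx'⟩ := exists_ne_zero_of_avg_ne_zero hx
    have : (0 : ℝ) ≤ 2 ^ (-k) := by positivity
    linarith [(hR _ hx').2]⟩

theorem average_apply (w : GridParam n) (k : ℤ) (f : TestFun n m) (x : Space n m) :
    (average w k f : Space n m → ℂ) x
      = avg w k (fun x' => (f : Space n m → ℂ) (x', x.2)) x.1 := rfl

open scoped Classical in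
/-- The restriction of a function to the cubes of scale `k` with positions in `G`, in the first
variable. -/
noncomputable def restrict (w : GridParam n) (k : ℤ) (G : Set (Fin n → ℤ)) (f : TestFun n m) :
    TestFun n m :=
  ⟨fun x => if idx w k x.1 ∈ G then (f : Space n m → ℂ) x else 0, by
    obtain ⟨M, R, h0, _, hM, hR⟩ := TestFun.exists_bound f
    refine ⟨Measurable.ite ?_ (TestFun.measurable f) measurable_const, ⟨M, fun x => ?_⟩,
      f.2.2.2.subset fun x hx => ?_⟩
    · exact ((measurable_idx w k).comp measurable_fst) (Set.to_countable G).measurableSet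
    · beta_reduce
      split_ifs
      · exact hM x
      · simpa using h0
    · simp only [Function.mem_support, ne_eq, ite_eq_right_iff, not_forall] at hx
      exact hx.2⟩

open scoped Classical in
theorem restrict_apply (w : GridParam n) (k : ℤ) (G : Set (Fin n → ℤ)) (f : TestFun n m)
    (x : Space n m) : (restrict w k G f : Space n m → ℂ) x
      = if idx w k x.1 ∈ G then (f : Space n m → ℂ) x else 0 := rfl

/-- The martingale difference operator at scale `k` in the first variable, restricted to the cubes
with positions in `G`. -/
noncomputable def diff (w : GridParam n) (k : ℤ) (G : Set (Fin n → ℤ)) (f : TestFun n m) :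
    TestFun n m :=
  restrict w k G (average w (k + 1) f - average w k f)

open scoped Classical in
theorem diff_apply (w : GridParam n) (k : ℤ) (G : Set (Fin n → ℤ)) (f : TestFun n m)
    (x : Space n m) : (diff w k G f : Space n m → ℂ) x
      = if idx w k x.1 ∈ G then dif w k (fun x' => (f : Space n m → ℂ) (x', x.2)) x.1 else 0 := rfl

theorem diff_univ (w : GridParam n) (k : ℤ) (f : TestFun n m) :
    diff w k univ f = average w (k + 1) f - average w k f := by
  ext x
  simp [diff, restrict_apply]

/-- The martingale difference operator in the second variable. -/
noncomputable def diffSnd (v : GridParam m) (l : ℤ) (H : Set (Fin m → ℤ)) (f : TestFun n m) :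
    TestFun n m :=
  swap m n (diff v l H (swap n m f))

open scoped Classical in
theorem diffSnd_apply (v : GridParam m) (l : ℤ) (H : Set (Fin m → ℤ)) (f : TestFun n m)
    (x : Space n m) : (diffSnd v l H f : Space n m → ℂ) x
      = if idx v l x.2 ∈ H then dif v l (fun y => (f : Space n m → ℂ) (x.1, y)) x.2 else 0 := rfl

/-- The `L^p` norm, as a real number. -/
noncomputable def lpNorm (p : ℝ≥0∞) (f : TestFun n m) : ℝ :=
  (eLpNorm (f : Space n m → ℂ) p volume).toReal

theorem lpNorm_nonneg (p : ℝ≥0∞) (f : TestFun n m) : 0 ≤ lpNorm p f := ENNReal.toReal_nonneg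

theorem lpNorm_swap (p : ℝ≥0∞) (f : TestFun n m) : lpNorm p (swap n m f) = lpNorm p f := by
  have h : MeasurePreserving (Prod.swap : Space m n → Space n m) volume volume :=
    Measure.measurePreserving_swap
  rw [lpNorm, lpNorm, ← eLpNorm_comp_measurePreserving (TestFun.measurable f).aestronglyMeasurable h]
  rfl

theorem lpNorm_le (p : ℝ≥0∞) (f : TestFun n m) {a R S : ℝ} (hR : 0 ≤ R) (hS : 0 ≤ S)
    (ha : ∀ x, ‖(f : Space n m → ℂ) x‖ ≤ a)
    (hf : ∀ x, (f : Space n m → ℂ) x ≠ 0 → ‖x.1‖ ≤ R ∧ ‖x.2‖ ≤ S) :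
    lpNorm p f ≤ a * ((2 * R) ^ n * (2 * S) ^ m) ^ p.toReal⁻¹ := by
  have ha0 : 0 ≤ a := (norm_nonneg _).trans (ha 0)
  set B : Set (Space n m) := Metric.closedBall 0 R ×ˢ Metric.closedBall 0 S
  have hB : volume B = ENNReal.ofReal ((2 * R) ^ n * (2 * S) ^ m) := by
    rw [Measure.volume_eq_prod, Measure.prod_prod, Real.volume_pi_closedBall _ hR,
      Real.volume_pi_closedBall _ hS, ← ENNReal.ofReal_mul (by positivity)]
    simp
  have hs : Function.support (f : Space n m → ℂ) ⊆ B := fun x hx =>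
    ⟨mem_closedBall_zero_iff.2 (hf x hx).1, mem_closedBall_zero_iff.2 (hf x hx).2⟩
  have h := eLpNorm_le_of_ae_bound (p := p) (μ := volume.restrict B)
    (f := (f : Space n m → ℂ)) (Eventually.of_forall ha)
  rw [eLpNorm_restrict_eq_of_support_subset hs, Measure.restrict_apply_univ, hB,
    ENNReal.ofReal_rpow_of_nonneg (by positivity) (by positivity),
    ← ENNReal.ofReal_mul (by positivity)] at h
  refine (ENNReal.toReal_mono ENNReal.ofReal_ne_top h).trans_eq ?_
  rw [ENNReal.toReal_ofReal (by positivity), mul_comm]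

end TestFun

/-! ### Bounds in `L^p`, uniform in the grids and summable over the scales. -/

/-- The decay of the `L^p` norms of averages at large scales. -/
noncomputable def decay (p : ℝ≥0∞) (k : ℤ) : ℝ := largePart k ^ (-(1 - p.toReal⁻¹))

theorem decay_pos (p : ℝ≥0∞) (k : ℤ) : 0 < decay p k := Real.rpow_pos_of_pos (largePart_pos k) _

theorem toReal_inv_lt_one {p : ℝ≥0∞} (hp : 1 < p) : p.toReal⁻¹ < 1 := by
  rcases eq_or_ne p ⊤ with rfl | hp'
  · simp
  · have : 1 < p.toReal := by
      rw [← ENNReal.toReal_one]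
      exact (ENNReal.toReal_lt_toReal ENNReal.one_ne_top hp').2 hp
    exact inv_lt_one_of_one_lt₀ this

/-- The left side is `largePart k` to the power `-n (1 - 1/p)`; since `n ≥ 1` and `largePart k ≥ 1`,
dropping `n` gives one weight that serves in both variables. -/
theorem rpow_div_le_decay (hn : 0 < n) {p : ℝ≥0∞} (hp : 1 < p) (k : ℤ) :
    (largePart k ^ n) ^ p.toReal⁻¹ / largePart k ^ n ≤ decay p k := by
  have hl := largePart_pos k
  have h1 : (1 : ℝ) ≤ n := by exact_mod_cast hn
  have h2 := toReal_inv_lt_one hp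
  rw [← Real.rpow_natCast, ← Real.rpow_mul hl.le, ← Real.rpow_sub hl]
  refine Real.rpow_le_rpow_of_exponent_le (one_le_largePart k) ?_
  nlinarith

/-- Spreading bounded mass over a set of volume comparable to `largePart k ^ n * largePart l ^ m`
makes the `L^p` norm small when `p > 1`. One-parameter estimates use `l = 0`, where `largePart` is
`1`. -/
theorem TestFun.lpNorm_le_decay (hn : 0 < n) (hm : 0 < m) {p : ℝ≥0∞} (hp : 1 < p)
    (f : TestFun n m) {c R : ℝ} (k l : ℤ) (hR : 0 ≤ R)
    (ha : ∀ x, ‖(f : Space n m → ℂ) x‖ ≤ c / (largePart k ^ n * largePart l ^ m))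
    (hf : ∀ x, (f : Space n m → ℂ) x ≠ 0 → ‖x.1‖ ≤ R * largePart k ∧ ‖x.2‖ ≤ R * largePart l) :
    lpNorm p f ≤ c * ((2 * R) ^ n * (2 * R) ^ m) ^ p.toReal⁻¹ * (decay p k * decay p l) := by
  have hk := largePart_pos k
  have hl := largePart_pos l
  have hc : 0 ≤ c := by
    have := (norm_nonneg _).trans (ha 0)
    rw [le_div_iff₀ (by positivity)] at this
    simpa using this
  refine (lpNorm_le p f (by positivity) (by positivity) ha hf).trans ?_
  have e : ((2 * (R * largePart k)) ^ n * (2 * (R * largePart l)) ^ m) ^ p.toReal⁻¹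
      = ((2 * R) ^ n * (2 * R) ^ m) ^ p.toReal⁻¹
        * ((largePart k ^ n) ^ p.toReal⁻¹ * (largePart l ^ m) ^ p.toReal⁻¹) := by
    rw [← Real.mul_rpow (by positivity) (by positivity),
      ← Real.mul_rpow (by positivity) (by positivity)]
    congr 1
    ring
  rw [e]
  calc _ = c * ((2 * R) ^ n * (2 * R) ^ m) ^ p.toReal⁻¹
        * (((largePart k ^ n) ^ p.toReal⁻¹ / largePart k ^ n)
          * ((largePart l ^ m) ^ p.toReal⁻¹ / largePart l ^ m)) := by ring
    _ ≤ _ := by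
      gcongr
      · exact (decay_pos p k).le
      · exact rpow_div_le_decay hn hp k
      · exact rpow_div_le_decay hm hp l

/-- Quantitative bounds for a test function that is Lipschitz in the first variable. -/
structure LipBound (f : TestFun n m) (M L R : ℝ) : Prop where
  M_nonneg : 0 ≤ M
  L_nonneg : 0 ≤ L
  R_nonneg : 0 ≤ R
  bound : ∀ x, ‖(f : Space n m → ℂ) x‖ ≤ M
  support : ∀ x, (f : Space n m → ℂ) x ≠ 0 → ‖x.1‖ ≤ R ∧ ‖x.2‖ ≤ R
  lip : ∀ x x' y, ‖(f : Space n m → ℂ) (x, y) - (f : Space n m → ℂ) (x', y)‖ ≤ L * ‖x - x'‖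

theorem add_two_zpow_le {R : ℝ} (hR : 0 ≤ R) (k : ℤ) :
    R + (2 : ℝ) ^ (-k) ≤ (R + 1) * largePart k := by
  have h1 := one_le_largePart k
  have h2 : (2 : ℝ) ^ (-k) ≤ largePart k := le_max_right _ _
  nlinarith

theorem le_mul_largePart {R : ℝ} (hR : 0 ≤ R) (k : ℤ) : R ≤ (R + 1) * largePart k := by
  have h1 := one_le_largePart k
  nlinarith

theorem largePart_zero : largePart 0 = 1 := by simp [largePart]

theorem decay_zero (p : ℝ≥0∞) : decay p 0 = 1 := by simp [decay, largePart_zero]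

namespace TestFun

/-- The constant in the `L^p` bounds of functions with support in the cube of radius `R`. -/
noncomputable def lpConst (n m : ℕ) (p : ℝ≥0∞) (R : ℝ) : ℝ :=
  ((2 * R) ^ n * (2 * R) ^ m) ^ p.toReal⁻¹

theorem lpConst_nonneg (n m : ℕ) (p : ℝ≥0∞) {R : ℝ} (hR : 0 ≤ R) : 0 ≤ lpConst n m p R := by
  unfold lpConst
  positivity

theorem support_average {f : TestFun n m} {R S : ℝ}
    (hf : ∀ x, (f : Space n m → ℂ) x ≠ 0 → ‖x.1‖ ≤ R ∧ ‖x.2‖ ≤ S) (w : GridParam n) (k : ℤ)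
    (x : Space n m) (hx : (average w k f : Space n m → ℂ) x ≠ 0) :
    ‖x.1‖ ≤ R + 2 ^ (-k) ∧ ‖x.2‖ ≤ S := by
  refine ⟨norm_le_of_avg_ne_zero (fun x' hx' => (hf _ hx').1) hx, ?_⟩
  obtain ⟨x', _, hx'⟩ := exists_ne_zero_of_avg_ne_zero hx
  exact (hf _ hx').2

theorem support_diff {f : TestFun n m} {R S : ℝ}
    (hf : ∀ x, (f : Space n m → ℂ) x ≠ 0 → ‖x.1‖ ≤ R ∧ ‖x.2‖ ≤ S) (w : GridParam n) (k : ℤ)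
    (G : Set (Fin n → ℤ)) (x : Space n m) (hx : (diff w k G f : Space n m → ℂ) x ≠ 0) :
    ‖x.1‖ ≤ R + 2 ^ (-k) ∧ ‖x.2‖ ≤ S := by
  classical
  have hd : dif w k (fun x' => (f : Space n m → ℂ) (x', x.2)) x.1 ≠ 0 := fun h => hx (by
    rw [diff_apply, h, ite_self])
  refine ⟨norm_le_of_dif_ne_zero (fun x' hx' => (hf _ hx').1) hd, ?_⟩
  by_cases h1 : avg w k (fun x' => (f : Space n m → ℂ) (x', x.2)) x.1 = 0
  · obtain ⟨x', _, hx'⟩ := exists_ne_zero_of_avg_ne_zero (w := w) (k := k + 1)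
      (φ := fun x' => (f : Space n m → ℂ) (x', x.2)) (x := x.1) fun h2 => hd (by
        rw [dif, h1, h2, sub_zero])
    exact (hf _ hx').2
  · exact (support_average hf w k x h1).2

theorem norm_diff_apply_le (w : GridParam n) (k : ℤ) (G : Set (Fin n → ℤ)) (f : TestFun n m)
    (x : Space n m) : ‖(diff w k G f : Space n m → ℂ) x‖
      ≤ ‖dif w k (fun x' => (f : Space n m → ℂ) (x', x.2)) x.1‖ := by
  classical
  rw [diff_apply]
  split_ifs
  · rfl
  · simp

theorem lpNorm_average_le (hn : 0 < n) (hm : 0 < m) {p : ℝ≥0∞} (hp : 1 < p) {f : TestFun n m}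
    {M L R : ℝ} (hf : LipBound f M L R) (w : GridParam n) (k : ℤ) :
    lpNorm p (average w k f)
      ≤ (1 + (2 * R) ^ n) * M * lpConst n m p (R + 1) * decay p k := by
  have h := lpNorm_le_decay (c := (1 + (2 * R) ^ n) * M) (R := R + 1) hn hm hp (average w k f) k 0
    (by linarith [hf.R_nonneg]) (fun x => ?_) (fun x hx => ?_)
  · rwa [decay_zero, mul_one] at h
  · rw [largePart_zero, one_pow, mul_one]
    exact norm_avg_le w k (fun x' => hf.bound _) hf.R_nonneg (fun x' hx' => (hf.support _ hx').1) _
  · have := support_average hf.support w k x hx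
    exact ⟨this.1.trans (add_two_zpow_le hf.R_nonneg k),
      this.2.trans (le_mul_largePart hf.R_nonneg 0)⟩

theorem lpNorm_diff_le (hn : 0 < n) (hm : 0 < m) {p : ℝ≥0∞} (hp : 1 < p) {f : TestFun n m}
    {M L R : ℝ} (hf : LipBound f M L R) (w : GridParam n) (k : ℤ) (G : Set (Fin n → ℤ)) :
    lpNorm p (diff w k G f)
      ≤ (2 * L + difConst n R * M) * lpConst n m p (R + 1) * (smallPart k * decay p k) := by
  have h := lpNorm_le_decay (c := (2 * L + difConst n R * M) * smallPart k) (R := R + 1)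
    hn hm hp (diff w k G f) k 0 (by linarith [hf.R_nonneg]) (fun x => ?_) (fun x hx => ?_)
  · rw [decay_zero, mul_one] at h
    refine h.trans_eq ?_
    rw [lpConst]
    ring
  · rw [largePart_zero, one_pow, mul_one]
    exact (norm_diff_apply_le w k G f x).trans
      (norm_dif_le_of_lipschitz w k (integrable_slice f x.2) (fun x' => hf.bound _) hf.R_nonneg
        (fun x' hx' => (hf.support _ hx').1) (fun _ _ => hf.lip _ _ _) hf.L_nonneg _)
  · have := support_diff hf.support w k G x hx
    exact ⟨this.1.trans (add_two_zpow_le hf.R_nonneg k),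
      this.2.trans (le_mul_largePart hf.R_nonneg 0)⟩

theorem lpNorm_average_sub_le (p : ℝ≥0∞) {f : TestFun n m}
    {M L R : ℝ} (hf : LipBound f M L R) (w : GridParam n) {k : ℤ} (hk : 0 ≤ k) :
    lpNorm p (average w k f - f) ≤ L * (2 : ℝ) ^ (-k) * lpConst n m p (R + 1) := by
  have hk' : (2 : ℝ) ^ (-k) ≤ 1 := zpow_le_one_of_nonpos₀ (by norm_num) (by lia)
  refine lpNorm_le p _ (by linarith [hf.R_nonneg]) (by linarith [hf.R_nonneg]) (fun x => ?_)
    (fun x hx => ?_)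
  · exact norm_avg_sub_le w k (integrable_slice f x.2) (fun _ _ => hf.lip _ _ _) hf.L_nonneg _
  · have h0 : (0 : ℝ) < 2 ^ (-k) := by positivity
    by_cases h : (f : Space n m → ℂ) x = 0
    · rw [sub_apply, h, sub_zero] at hx
      have := support_average hf.support w k x hx
      exact ⟨by linarith, by linarith⟩
    · have := hf.support x h
      exact ⟨by linarith, by linarith⟩

/-- A martingale difference in the second variable keeps the Lipschitz bound in the first. -/
theorem diffSnd_bound {f : TestFun n m} {M L R : ℝ} (hf : LipBound f M L R)
    (hf' : LipBound (swap n m f) M L R) (v : GridParam m) (l : ℤ) (H : Set (Fin m → ℤ)) :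
    LipBound (diffSnd v l H f) (difConst m R * M / largePart l ^ m)
        (difConst m R * L / largePart l ^ m) (R + 2 ^ (-l)) ∧
      (∀ x, ‖(diffSnd v l H f : Space n m → ℂ) x‖
        ≤ (2 * L + difConst m R * M) * smallPart l / largePart l ^ m) ∧
      ∀ x, (diffSnd v l H f : Space n m → ℂ) x ≠ 0 → ‖x.1‖ ≤ R ∧ ‖x.2‖ ≤ R + 2 ^ (-l) := by
  classical
  have hC := difConst_nonneg m hf.R_nonneg
  have hl := largePart_pos l
  have hM := hf.M_nonneg
  have hL := hf.L_nonneg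
  have h0 : (0 : ℝ) < 2 ^ (-l) := by positivity
  have hs : ∀ x, (diffSnd v l H f : Space n m → ℂ) x ≠ 0 → ‖x.1‖ ≤ R ∧ ‖x.2‖ ≤ R + 2 ^ (-l) :=
    fun x hx => (support_diff hf'.support v l H x.swap hx).symm
  refine ⟨⟨by positivity, by positivity, by linarith [hf.R_nonneg], fun x => ?_, fun x hx => ?_,
    fun x x' y => ?_⟩, fun x => ?_, hs⟩
  · exact (norm_diff_apply_le v l H (swap n m f) x.swap).trans
      (norm_dif_le v l (fun x' => hf'.bound _) hf.R_nonneg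
        (fun x' hx' => (hf'.support _ hx').1) _)
  · have := hs x hx
    exact ⟨by linarith, this.2⟩
  · have e : (diffSnd v l H f : Space n m → ℂ) (x, y) - (diffSnd v l H f : Space n m → ℂ) (x', y)
        = if idx v l y ∈ H then dif v l (fun y => (f : Space n m → ℂ) (x, y)
            - (f : Space n m → ℂ) (x', y)) y else 0 := by
      rw [diffSnd_apply, diffSnd_apply]
      split_ifs
      · exact (dif_sub v l (integrable_slice (swap n m f) x)
          (integrable_slice (swap n m f) x') y).symm
      · simp
    -- By linearity the Lipschitz estimate is the size estimate for the martingale difference of `f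
    -- (x, ·) - f (x', ·)`, which is bounded by `L * ‖x - x'‖`.
    have h1 := norm_dif_le v l (φ := fun y => (f : Space n m → ℂ) (x, y)
            - (f : Space n m → ℂ) (x', y)) (fun y => hf.lip x x' y) hf.R_nonneg (fun y hy => by
        by_cases h : (f : Space n m → ℂ) (x, y) = 0
        · rw [h, zero_sub, neg_ne_zero] at hy
          exact (hf.support _ hy).2
        · exact (hf.support _ h).2) y
    rw [e]
    refine le_trans ?_ (h1.trans_eq (by ring))
    split_ifs
    · rfl
    · simp
  · exact (norm_diff_apply_le v l H (swap n m f) x.swap).trans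
      (norm_dif_le_of_lipschitz v l (integrable_slice (swap n m f) x.1) (fun x' => hf'.bound _)
        hf.R_nonneg (fun x' hx' => (hf'.support _ hx').1) (fun _ _ => hf'.lip _ _ _) hf.L_nonneg _)

/-- The weights that bound the `L^p` norms of martingale differences. -/
noncomputable def weight (p : ℝ≥0∞) (k : ℤ) : ℝ := √(smallPart k) * decay p k

/-- Without a bound on mixed second derivatives, smoothness can be exploited in only one variable at
a time. The gain is the minimum of `smallPart k` and `smallPart l`, not their product; the geometric
mean separates the variables and explains the square root in `weight`. -/
theorem lpNorm_diff_diffSnd_le (hn : 0 < n) (hm : 0 < m) {p : ℝ≥0∞} (hp : 1 < p)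
    {f : TestFun n m} {M L R : ℝ} (hf : LipBound f M L R) (hf' : LipBound (swap n m f) M L R) :
    ∃ C, ∀ (w : GridParam n) (v : GridParam m) (k l : ℤ) (G : Set (Fin n → ℤ))
      (H : Set (Fin m → ℤ)),
      lpNorm p (diff w k G (diffSnd v l H f)) ≤ C * (weight p k * weight p l) := by
  have hR := hf.R_nonneg
  have hM := hf.M_nonneg
  have hL := hf.L_nonneg
  have hCm := difConst_nonneg m hR
  have hCn := difConst_nonneg n hR
  set C₁ := difConst n R * (2 * L + difConst m R * M) with hC₁
  set C₂ := 2 * (difConst m R * L) + difConst n R * (difConst m R * M) with hC₂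
  have hC₁0 : 0 ≤ C₁ := by positivity
  have hC₂0 : 0 ≤ C₂ := by positivity
  refine ⟨(C₁ + C₂) * lpConst n m p (R + 1), fun w v k l G H => ?_⟩
  obtain ⟨h1, h2, h3⟩ := diffSnd_bound hf hf' v l H
  have hk := largePart_pos k
  have hl := largePart_pos l
  have sk := smallPart_pos k
  have sl := smallPart_pos l
  have h := lpNorm_le_decay (c := (C₁ + C₂) * (√(smallPart k) * √(smallPart l))) (R := R + 1)
    hn hm hp (diff w k G (diffSnd v l H f)) k l (by linarith) (fun x => ?_) (fun x hx => ?_)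
  · refine h.trans_eq ?_
    rw [lpConst, weight, weight]
    ring
  · have b1 : ‖(diff w k G (diffSnd v l H f) : Space n m → ℂ) x‖
        ≤ C₁ * smallPart l / (largePart k ^ n * largePart l ^ m) := by
      refine (norm_diff_apply_le w k G _ x).trans ((norm_dif_le w k (fun x' => h2 _) hR
        (fun x' hx' => (h3 _ hx').1) _).trans_eq ?_)
      rw [hC₁]
      field_simp
    have b2 : ‖(diff w k G (diffSnd v l H f) : Space n m → ℂ) x‖
        ≤ C₂ * smallPart k / (largePart k ^ n * largePart l ^ m) := by
      refine (norm_diff_apply_le w k G _ x).trans ((norm_dif_le_of_lipschitz w k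
        (integrable_slice _ x.2) (fun x' => h1.bound _) hR (fun x' hx' => (h3 _ hx').1)
        (fun _ _ => h1.lip _ _ _) h1.L_nonneg _).trans_eq ?_)
      rw [hC₂]
      field_simp
    have e : min (smallPart k) (smallPart l) ≤ √(smallPart k) * √(smallPart l) := by
      have hmin : 0 < min (smallPart k) (smallPart l) := lt_min sk sl
      rw [← Real.sqrt_mul sk.le]
      refine Real.le_sqrt_of_sq_le ?_
      rw [sq]
      exact mul_le_mul (min_le_left _ _) (min_le_right _ _) hmin.le sk.le
    have b3 : ‖(diff w k G (diffSnd v l H f) : Space n m → ℂ) x‖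
        ≤ (C₁ + C₂) * min (smallPart k) (smallPart l) / (largePart k ^ n * largePart l ^ m) := by
      rcases le_total (smallPart k) (smallPart l) with h | h
      · rw [min_eq_left h]
        refine b2.trans ?_
        gcongr
        linarith
      · rw [min_eq_right h]
        refine b1.trans ?_
        gcongr
        linarith
    refine b3.trans ?_
    gcongr
  · have := support_diff h3 w k G x hx
    exact ⟨this.1.trans (add_two_zpow_le hR k), this.2.trans (add_two_zpow_le hR l)⟩

theorem weight_nonneg (p : ℝ≥0∞) (k : ℤ) : 0 ≤ weight p k :=
  mul_nonneg (Real.sqrt_nonneg _) (decay_pos p k).le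

theorem smallPart_mul_decay_le_weight (p : ℝ≥0∞) (k : ℤ) :
    smallPart k * decay p k ≤ weight p k := by
  refine mul_le_mul_of_nonneg_right (Real.le_sqrt_of_sq_le ?_) (decay_pos p k).le
  nlinarith [smallPart_le_one k, smallPart_pos k]

theorem tendsto_decay_neg {p : ℝ≥0∞} (hp : 1 < p) :
    Tendsto (fun N : ℕ => decay p (-(N : ℤ))) atTop (𝓝 0) := by
  have e : ∀ N : ℕ, decay p (-(N : ℤ)) = ((2 : ℝ) ^ (-(1 - p.toReal⁻¹))) ^ N := by
    intro N
    rw [decay, largePart, neg_neg, zpow_natCast, max_eq_right (one_le_pow₀ one_le_two),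
      ← Real.rpow_natCast, ← Real.rpow_natCast, ← Real.rpow_mul two_pos.le,
      ← Real.rpow_mul two_pos.le, mul_comm]
  simp_rw [e]
  refine tendsto_pow_atTop_nhds_zero_of_lt_one (by positivity) ?_
  exact Real.rpow_lt_one_of_one_lt_of_neg one_lt_two (by linarith [toReal_inv_lt_one hp])

/-- Geometric decay on both sides: `√(smallPart k)` acts for `k ≥ 0`, and `decay p k` for `k ≤ 0`,
where `p > 1` is needed. -/
theorem summable_weight {p : ℝ≥0∞} (hp : 1 < p) : Summable (weight p) := by
  refine Summable.of_nat_of_neg ?_ ?_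
  · have : ∀ N : ℕ, weight p N = (√(1 / 2)) ^ N := by
      intro N
      have h1 : (2 : ℝ) ^ (-(N : ℤ)) = (1 / 2) ^ N := by
        rw [zpow_neg, zpow_natCast, one_div, inv_pow]
      have h2 : ((1 : ℝ) / 2) ^ N ≤ 1 := pow_le_one₀ (by norm_num) (by norm_num)
      rw [weight, decay, largePart, smallPart, h1, max_eq_left h2, min_eq_right h2, Real.one_rpow,
        mul_one]
      rw [Real.sqrt_eq_iff_mul_self_eq (by positivity) (by positivity), ← mul_pow,
        Real.mul_self_sqrt (by norm_num)]
    simp_rw [this]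
    refine summable_geometric_of_lt_one (by positivity) ?_
    rw [Real.sqrt_lt' one_pos]
    norm_num
  · have : ∀ N : ℕ, weight p (-(N : ℤ)) = ((2 : ℝ) ^ (-(1 - p.toReal⁻¹))) ^ N := by
      intro N
      rw [weight, decay, largePart, smallPart, neg_neg, zpow_natCast,
        max_eq_right (one_le_pow₀ one_le_two), min_eq_left (one_le_pow₀ one_le_two),
        ← Real.rpow_natCast, ← Real.rpow_natCast, ← Real.rpow_mul two_pos.le,
        ← Real.rpow_mul two_pos.le, mul_comm (N : ℝ)]
      simp
    simp_rw [this]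
    refine summable_geometric_of_lt_one (by positivity) ?_
    exact Real.rpow_lt_one_of_one_lt_of_neg one_lt_two (by linarith [toReal_inv_lt_one hp])

end TestFun

/-! ### Continuity in the grid parameter. -/

/-- A family of test functions that is uniformly bounded, has its supports in a fixed bounded set,
and depends continuously on the parameter, almost everywhere. -/
structure TameFamily {α : Type*} [TopologicalSpace α] (F : α → TestFun n m) : Prop where
  bound : ∃ C, ∀ w x, ‖(F w : Space n m → ℂ) x‖ ≤ C
  support : ∃ R, ∀ w x, (F w : Space n m → ℂ) x ≠ 0 → ‖x‖ ≤ R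
  continuousAt : ∀ w₀, ∀ᵐ x, ContinuousAt (fun w => (F w : Space n m → ℂ) x) w₀

/-- The bilinear form is bounded with respect to the `L^p` and the `L^q` norm. -/
def FormBound (p q : ℝ≥0∞) (T : TestFun n m →ₗ[ℂ] TestFun n m →ₗ[ℂ] ℂ) (A : ℝ) : Prop :=
  0 ≤ A ∧ ∀ f g, ‖T f g‖ ≤ A * TestFun.lpNorm p f * TestFun.lpNorm q g

namespace TameFamily

variable {α : Type*} [TopologicalSpace α]

theorem sub {F G : α → TestFun n m} (hF : TameFamily F) (hG : TameFamily G) :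
    TameFamily fun w => F w - G w := by
  obtain ⟨C, hC⟩ := hF.bound
  obtain ⟨D, hD⟩ := hG.bound
  obtain ⟨R, hR⟩ := hF.support
  obtain ⟨S, hS⟩ := hG.support
  refine ⟨⟨C + D, fun w x => (norm_sub_le _ _).trans (add_le_add (hC w x) (hD w x))⟩,
    ⟨max R S, fun w x hx => ?_⟩, fun w₀ => ?_⟩
  · by_cases h : (F w : Space n m → ℂ) x = 0
    · rw [TestFun.sub_apply, h, zero_sub, neg_ne_zero] at hx
      exact (hS w x hx).trans (le_max_right _ _)
    · exact (hR w x h).trans (le_max_left _ _)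
  · filter_upwards [hF.continuousAt w₀, hG.continuousAt w₀] with x h1 h2
    exact h1.sub h2

theorem tendsto_lpNorm [FirstCountableTopology α] {F : α → TestFun n m} (hF : TameFamily F)
    {p : ℝ≥0∞} (hp : 1 < p) (hp' : p ≠ ⊤) (w₀ : α) :
    Tendsto (fun w => TestFun.lpNorm p (F w - F w₀)) (𝓝 w₀) (𝓝 0) := by
  obtain ⟨C, hC⟩ := hF.bound
  obtain ⟨R, hR⟩ := hF.support
  have hp0 : p ≠ 0 := (one_pos.trans hp).ne'
  have hpr : 0 < p.toReal := ENNReal.toReal_pos hp0 hp'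
  set B : Set (Space n m) := Metric.closedBall 0 R
  have hB : volume B < ⊤ := measure_closedBall_lt_top
  have h : Tendsto (fun w => ∫⁻ x, ‖((F w - F w₀ : TestFun n m) : Space n m → ℂ) x‖ₑ ^ p.toReal)
      (𝓝 w₀) (𝓝 (∫⁻ _ : Space n m, 0)) := by
    refine tendsto_lintegral_filter_of_dominated_convergence
      (B.indicator fun _ => ENNReal.ofReal (C + C) ^ p.toReal) ?_ ?_ ?_ ?_
    · exact Eventually.of_forall fun w =>
        ((TestFun.measurable (F w - F w₀)).enorm.pow_const _)
    · refine Eventually.of_forall fun w => Eventually.of_forall fun x => ?_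
      by_cases hx : x ∈ B
      · rw [indicator_of_mem hx]
        gcongr
        rw [← ofReal_norm]
        exact ENNReal.ofReal_le_ofReal
          ((norm_sub_le _ _).trans (add_le_add (hC w x) (hC w₀ x)))
      · have h0 : ∀ w, (F w : Space n m → ℂ) x = 0 := fun w => by
          by_contra h
          exact hx (mem_closedBall_zero_iff.2 (hR w x h))
        rw [TestFun.sub_apply, h0, h0, sub_zero, enorm_zero, ENNReal.zero_rpow_of_pos hpr]
        exact bot_le
    · rw [lintegral_indicator Metric.isClosed_closedBall.measurableSet, lintegral_const,
        Measure.restrict_apply_univ]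
      exact ENNReal.mul_ne_top (ENNReal.rpow_ne_top_of_nonneg hpr.le ENNReal.ofReal_ne_top) hB.ne
    · filter_upwards [hF.continuousAt w₀] with x hx
      have h1 : Tendsto (fun w => ((F w - F w₀ : TestFun n m) : Space n m → ℂ) x) (𝓝 w₀) (𝓝 0) := by
        have := hx.tendsto.sub_const ((F w₀ : Space n m → ℂ) x)
        rwa [sub_self] at this
      have h2 := (ENNReal.continuous_rpow_const (y := p.toReal)).tendsto 0 |>.comp
        (enorm_zero (E := ℂ) ▸ h1.enorm)
      rw [ENNReal.zero_rpow_of_pos hpr] at h2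
      exact h2
  rw [lintegral_zero] at h
  have h3 := (ENNReal.continuous_rpow_const (y := 1 / p.toReal)).tendsto 0 |>.comp h
  rw [ENNReal.zero_rpow_of_pos (by positivity)] at h3
  have h4 := (ENNReal.tendsto_toReal ENNReal.zero_ne_top).comp h3
  simp only [TestFun.lpNorm, eLpNorm_eq_lintegral_rpow_enorm_toReal hp0 hp']
  exact h4

/-- Tame families are continuous in `L^p` and `L^q` by dominated convergence, and `T` is bounded.
This yields the measurability in the grid parameters. -/
theorem continuous_form [FirstCountableTopology α] {F G : α → TestFun n m} (hF : TameFamily F)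
    (hG : TameFamily G) {p q : ℝ≥0∞} (hp : 1 < p) (hp' : p ≠ ⊤) (hq : 1 < q) (hq' : q ≠ ⊤)
    {T : TestFun n m →ₗ[ℂ] TestFun n m →ₗ[ℂ] ℂ} {A : ℝ} (hT : FormBound p q T A) :
    Continuous fun w => T (F w) (G w) := by
  refine continuous_iff_continuousAt.2 fun w₀ => ?_
  obtain ⟨C, hC⟩ := hG.bound
  obtain ⟨R, hR⟩ := hG.support
  have hb : ∀ w, TestFun.lpNorm q (G w) ≤ C * ((2 * |R|) ^ n * (2 * |R|) ^ m) ^ q.toReal⁻¹ := by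
    intro w
    refine TestFun.lpNorm_le q (G w) (abs_nonneg _) (abs_nonneg _) (hC w) fun x hx => ?_
    have := (hR w x hx).trans (le_abs_self R)
    exact ⟨(norm_fst_le x).trans this, (norm_snd_le x).trans this⟩
  set D := C * ((2 * |R|) ^ n * (2 * |R|) ^ m) ^ q.toReal⁻¹
  have h1 := hF.tendsto_lpNorm hp hp' w₀
  have h2 := hG.tendsto_lpNorm hq hq' w₀
  have h3 := ((h1.const_mul A).mul_const D).add (h2.const_mul (A * TestFun.lpNorm p (F w₀)))
  simp only [mul_zero, zero_mul, add_zero] at h3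
  refine tendsto_iff_norm_sub_tendsto_zero.2 (squeeze_zero (fun _ => norm_nonneg _) (fun w => ?_) h3)
  have e : T (F w) (G w) - T (F w₀) (G w₀)
      = T (F w - F w₀) (G w) + T (F w₀) (G w - G w₀) := by
    rw [map_sub, map_sub, LinearMap.sub_apply]
    ring
  rw [e]
  refine (norm_add_le _ _).trans (add_le_add ((hT.2 _ _).trans ?_) (hT.2 _ _))
  exact mul_le_mul_of_nonneg_left (hb w) (mul_nonneg hT.1 (TestFun.lpNorm_nonneg _ _))

theorem average (k : ℤ) (f : TestFun n m) :
    TameFamily fun w : GridParam n => TestFun.average w k f := by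
  obtain ⟨M, R, _, _, hM, hR⟩ := TestFun.exists_bound f
  refine ⟨⟨M, fun w x => norm_avg_le_of_le w k (fun _ => hM _) _⟩,
    ⟨R + 2 ^ (-k), fun w x hx => ?_⟩, fun w₀ => ?_⟩
  · have := TestFun.support_average hR w k x hx
    exact max_le this.1 (this.2.trans (le_add_of_nonneg_right (by positivity)))
  · have h := ae_eventually_idx_eq w₀ k
    have h' : ∀ᵐ x : Space n m, ∀ᶠ w in 𝓝 w₀, idx w k x.1 = idx w₀ k x.1 :=
      Measure.quasiMeasurePreserving_fst.ae h
    filter_upwards [h'] with x hx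
    have e : ∀ w, (TestFun.average w k f : Space n m → ℂ) x = (((2 : ℝ) ^ k) ^ n) •
        ∫ x', {x' | idx w k x' = idx w k x.1}.indicator
          (fun x' => (f : Space n m → ℂ) (x', x.2)) x' := by
      intro w
      rw [TestFun.average_apply, avg, integral_indicator (measurableSet_setOf_idx_eq _ _ _)]
    simp only [e]
    refine ContinuousAt.fun_const_smul ?_ _
    have hi := TestFun.integrable_slice f x.2
    refine tendsto_integral_filter_of_dominated_convergence
      (fun x' => ‖(f : Space n m → ℂ) (x', x.2)‖) ?_ ?_ hi.norm ?_
    · exact Eventually.of_forall fun w =>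
        hi.aestronglyMeasurable.indicator (measurableSet_setOf_idx_eq _ _ _)
    · exact Eventually.of_forall fun w => Eventually.of_forall fun x' =>
        norm_indicator_le_norm_self _ _
    -- For fixed `x` and almost every `x'`, the positions of both points are locally constant in
    -- `w`, hence so is the condition that they share a cube.
    · filter_upwards [h] with x' hx'
      refine tendsto_const_nhds.congr' ?_
      filter_upwards [hx, hx'] with w h1 h2
      simp only [indicator_apply, mem_ofPred_eq, h1, h2]

theorem restrict (k : ℤ) (G : Set (Fin n → ℤ)) {F : GridParam n → TestFun n m}
    (hF : TameFamily F) : TameFamily fun w : GridParam n => TestFun.restrict w k G (F w) := by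
  classical
  obtain ⟨C, hC⟩ := hF.bound
  obtain ⟨R, hR⟩ := hF.support
  refine ⟨⟨C, fun w x => ?_⟩, ⟨R, fun w x hx => hR w x fun h => hx ?_⟩, fun w₀ => ?_⟩
  · rw [TestFun.restrict_apply]
    split_ifs
    · exact hC w x
    · rw [norm_zero]
      exact (norm_nonneg _).trans (hC w x)
  · rw [TestFun.restrict_apply, h, ite_self]
  · have h' : ∀ᵐ x : Space n m, ∀ᶠ w in 𝓝 w₀, idx w k x.1 = idx w₀ k x.1 :=
      Measure.quasiMeasurePreserving_fst.ae (ae_eventually_idx_eq w₀ k)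
    filter_upwards [h', hF.continuousAt w₀] with x hx hc
    by_cases h : idx w₀ k x.1 ∈ G
    · refine hc.congr ?_
      filter_upwards [hx] with w hw
      rw [TestFun.restrict_apply, hw, if_pos h]
    · refine continuousAt_const (y := (0 : ℂ)) |>.congr ?_
      filter_upwards [hx] with w hw
      rw [TestFun.restrict_apply, hw, if_neg h]

theorem diff (k : ℤ) (G : Set (Fin n → ℤ)) (f : TestFun n m) :
    TameFamily fun w : GridParam n => TestFun.diff w k G f :=
  ((average (k + 1) f).sub (average k f)).restrict k G

end TameFamily

theorem ae_eventually_haarInterval_eq (w₀ : GridParam n) (I : DyadicCube n) (η : Fin n → Bool) :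
    ∀ᵐ x : Fin n → ℝ, ∀ᶠ w in 𝓝 w₀, haar w I η x = haar w₀ I η x := by
  have h : ∀ᵐ x : Fin n → ℝ, ∀ a : Fin n, x a ≠ I.corner w₀ a ∧
      x a ≠ I.corner w₀ a + I.side / 2 ∧ x a ≠ I.corner w₀ a + I.side := by
    simp only [ae_all_iff, eventually_and]
    exact fun a => ⟨Measure.ae_eval_ne _ _ _, Measure.ae_eval_ne _ _ _, Measure.ae_eval_ne _ _ _⟩
  have hc : ∀ a, Continuous fun w : GridParam n => I.corner w a := fun a => by
    simp only [DyadicCube.corner_eq]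
    fun_prop
  have hlt : ∀ (t c : ℝ) (a : Fin n), t ≠ I.corner w₀ a + c →
      ∀ᶠ w in 𝓝 w₀, (I.corner w a + c ≤ t ↔ I.corner w₀ a + c ≤ t)
        ∧ (t < I.corner w a + c ↔ t < I.corner w₀ a + c) := by
    intro t c a ht
    have hcc : ContinuousAt (fun w : GridParam n => I.corner w a + c) w₀ :=
      ((hc a).add continuous_const).continuousAt
    rcases ht.lt_or_gt with h | h
    · filter_upwards [continuousAt_const.eventually_lt hcc h] with w hw
      simp [h, hw, h.not_ge, hw.not_ge]
    · filter_upwards [hcc.eventually_lt continuousAt_const h] with w hw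
      simp [h.le, hw.le, h.not_gt, hw.not_gt]
  filter_upwards [h] with x hx
  have : ∀ a, ∀ᶠ w in 𝓝 w₀, haarInterval (I.corner w a) I.side (η a) (x a)
      = haarInterval (I.corner w₀ a) I.side (η a) (x a) := by
    intro a
    have h0 := hlt (x a) 0 a (by simpa using (hx a).1)
    simp only [add_zero] at h0
    filter_upwards [h0, hlt _ _ a (hx a).2.1, hlt _ _ a (hx a).2.2] with w h1 h2 h3
    simp only [haarInterval, indicator_apply, mem_Ico, h1, h2, h3]
  filter_upwards [eventually_all.2 this] with w hw
  exact Finset.prod_congr rfl fun a _ => hw a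

theorem norm_le_of_mem_translate {w : GridParam n} {I : DyadicCube n} {x : Fin n → ℝ}
    (hx : x ∈ I.translate w) : ‖x‖ ≤ I.side * ‖I.pos‖ + 2 * I.side := by
  have hs := I.side_pos
  refine (pi_norm_le_iff_of_nonneg (by positivity)).2 fun a => ?_
  have h1 := hx a (mem_univ a)
  simp only [mem_Ico, DyadicCube.corner_eq] at h1
  have h2 := shift_nonneg w I.scale a
  have h3 : shift w I.scale a ≤ I.side := shift_le w I.scale a
  have h4 : |(I.pos a : ℝ)| ≤ ‖I.pos‖ := (norm_le_pi_norm I.pos a)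
  have h5 := abs_le.1 h4
  rw [Real.norm_eq_abs, abs_le]
  constructor <;> nlinarith [h1.1, h1.2, h5.1, h5.2]

theorem TameFamily.haarTensor (I : DyadicCube n) (η : Fin n → Bool) (J : DyadicCube m)
    (θ : Fin m → Bool) : TameFamily fun x : GridParam n × GridParam m =>
      haarTensor x.1 x.2 I η J θ := by
  refine ⟨⟨((√I.side)⁻¹ * 2) ^ n * ((√J.side)⁻¹ * 2) ^ m, fun w x => ?_⟩,
    ⟨max (I.side * ‖I.pos‖ + 2 * I.side) (J.side * ‖J.pos‖ + 2 * J.side), fun w x hx => ?_⟩,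
    fun w₀ => ?_⟩
  · simp only [BiHaar.haarTensor]
    rw [norm_mul, Complex.norm_real, Complex.norm_real]
    exact mul_le_mul (abs_haar_le _ I η x.1) (abs_haar_le _ J θ x.2) (abs_nonneg _)
      (by positivity)
  · have hx' : (haar w.1 I η x.1 : ℂ) ≠ 0 ∧ (haar w.2 J θ x.2 : ℂ) ≠ 0 := mul_ne_zero_iff.1 hx
    exact max_le_max
      (norm_le_of_mem_translate (support_haar_subset w.1 I η (by simpa using hx'.1)))
      (norm_le_of_mem_translate (support_haar_subset w.2 J θ (by simpa using hx'.2)))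
  · have h1 : ∀ᵐ x : Space n m, ∀ᶠ w in 𝓝 w₀.1, haar w I η x.1 = haar w₀.1 I η x.1 :=
      Measure.quasiMeasurePreserving_fst.ae (ae_eventually_haarInterval_eq w₀.1 I η)
    have h2 : ∀ᵐ x : Space n m, ∀ᶠ w in 𝓝 w₀.2, haar w J θ x.2 = haar w₀.2 J θ x.2 :=
      Measure.quasiMeasurePreserving_snd.ae (ae_eventually_haarInterval_eq w₀.2 J θ)
    filter_upwards [h1, h2] with x h1 h2
    refine continuousAt_const.congr (f := fun _ => (BiHaar.haarTensor w₀.1 w₀.2 I η J θ :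
      Space n m → ℂ) x) ?_
    filter_upwards [continuousAt_fst.eventually h1, continuousAt_snd.eventually h2] with w h3 h4
    simp only [BiHaar.haarTensor, h3, h4]

theorem continuous_pairing {α : Type*} [TopologicalSpace α] [FirstCountableTopology α]
    {F : α → TestFun n m} (hF : TameFamily F) (f : TestFun n m) :
    Continuous fun w => pairing f (F w) := by
  refine continuous_iff_continuousAt.2 fun w₀ => ?_
  obtain ⟨C, hC⟩ := hF.bound
  refine tendsto_integral_filter_of_dominated_convergence
    (fun x => ‖(f : Space n m → ℂ) x‖ * C) ?_ ?_ ?_ ?_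
  · exact Eventually.of_forall fun w =>
      ((TestFun.measurable f).mul (TestFun.measurable (F w))).aestronglyMeasurable
  · refine Eventually.of_forall fun w => Eventually.of_forall fun x => ?_
    rw [norm_mul]
    exact mul_le_mul_of_nonneg_left (hC w x) (norm_nonneg _)
  · exact (TestFun.integrable f).norm.mul_const C
  · filter_upwards [hF.continuousAt w₀] with x hx
    exact hx.tendsto.const_mul _

/-! ### Goodness in terms of binary digits, and its probability. -/

instance (n : ℕ) : IsProbabilityMeasure (gridMeasure n) := by
  unfold gridMeasure
  infer_instance

/-- The position of the cubes of scale `k` in those of scale `k - d`, from the bits between. -/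
def relShift (w : GridParam n) (k : ℤ) (d : ℕ) (a : Fin n) : ℤ :=
  ∑ t ∈ Finset.range d, 2 ^ t * (if w (k - t) a then 1 else 0)

theorem shift_sub_natCast (w : GridParam n) (k : ℤ) (d : ℕ) (a : Fin n) :
    shift w (k - d) a = shift w k a + (2 : ℝ) ^ (-k) * relShift w k d a := by
  induction d with
  | zero => simp [relShift]
  | succ d ih =>
    have e : k - ((d + 1 : ℕ) : ℤ) + 1 = k - d := by push_cast; ring
    have e2 : (2 : ℝ) ^ (-(k - d : ℤ)) = 2 ^ (-k) * 2 ^ d := by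
      rw [neg_sub, sub_eq_neg_add, zpow_add₀ two_ne_zero, zpow_natCast]
    have e3 : relShift w k (d + 1) a = relShift w k d a + 2 ^ d * (if w (k - d) a then 1 else 0) :=
      Finset.sum_range_succ _ _
    rw [shift_eq_add, e, ih, e2, e3]
    push_cast
    rw [bit]
    ring

theorem relShift_congr {w w' : GridParam n} {k : ℤ} (h : ∀ i ≤ k, w i = w' i) (d : ℕ) :
    relShift w k d = relShift w' k d := by
  funext a
  refine Finset.sum_congr rfl fun t _ => ?_
  rw [h _ (by lia)]

/-- The half-open cube with lower corner `c` and side length `l`. -/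
def box (c : Fin n → ℝ) (l : ℝ) : Set (Fin n → ℝ) := Set.pi univ fun a => Ico (c a) (c a + l)

theorem image_box {s : ℝ} (hs : 0 < s) (c c' : Fin n → ℝ) (l : ℝ) :
    (fun x => s • x + c) '' box c' l = box (s • c' + c) (s * l) := by
  ext y
  constructor
  · rintro ⟨x, hx, rfl⟩ a ha
    have h1 := hx a ha
    simp only [mem_Ico, Pi.add_apply, Pi.smul_apply, smul_eq_mul] at h1 ⊢
    constructor <;> nlinarith [h1.1, h1.2]
  · intro hy
    refine ⟨s⁻¹ • (y - c), fun a ha => ?_, ?_⟩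
    · have h1 := hy a ha
      simp only [mem_Ico, Pi.add_apply, Pi.smul_apply, smul_eq_mul, Pi.sub_apply] at h1 ⊢
      rw [le_inv_mul_iff₀ hs, inv_mul_lt_iff₀ hs]
      constructor <;> linarith [h1.1, h1.2]
    · simp [smul_smul, hs.ne']

theorem setDist_image {s : ℝ} (hs : 0 < s) (c : Fin n → ℝ) (A B : Set (Fin n → ℝ)) :
    setDist ((fun x => s • x + c) '' A) ((fun x => s • x + c) '' B) = s * setDist A B := by
  have h : ∀ x y : Fin n → ℝ, dist (s • x + c) (s • y + c) = s • dist x y := fun x y => by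
    rw [dist_add_right, dist_smul₀, Real.norm_of_nonneg hs.le, smul_eq_mul]
  have e : image2 dist ((fun x => s • x + c) '' A) ((fun x => s • x + c) '' B)
      = (fun t => s • t) '' image2 dist A B := by
    rw [image2_image_left, image2_image_right, image_image2]
    simp only [h]
  rw [setDist, setDist, e]
  exact Real.sInf_smul_of_nonneg hs.le _

theorem frontier_image {s : ℝ} (hs : 0 < s) (c : Fin n → ℝ) (A : Set (Fin n → ℝ)) :
    frontier ((fun x => s • x + c) '' A) = (fun x => s • x + c) '' frontier A :=
  (((Homeomorph.smulOfNeZero s hs.ne').trans (Homeomorph.addRight c)).image_frontier A).symm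

/-- The relative position `z` of two cubes with ratio of side lengths `2 ^ d` makes the smaller one
bad. -/
def BadPosition (δ : ℝ) (d : ℕ) (z : Fin n → ℤ) : Prop :=
  setDist (box 0 1) (frontier (box (fun a => (z a : ℝ)) (2 ^ d)))
    ≤ 2 * (2 ^ d) ^ (1 - gammaExp n δ)

theorem translate_eq_image (w : GridParam n) (I : DyadicCube n) :
    I.translate w = (fun x => I.side • x + I.corner w) '' box 0 1 := by
  rw [image_box I.side_pos, smul_zero, zero_add, mul_one]
  rfl

theorem translate_eq_image' (w : GridParam n) (k : ℤ) (p p' : Fin n → ℤ) (d : ℕ) :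
    (⟨k - d, p'⟩ : DyadicCube n).translate w = (fun x => (⟨k, p⟩ : DyadicCube n).side • x
      + (⟨k, p⟩ : DyadicCube n).corner w) ''
        box (fun a => ((2 ^ d * p' a - p a + relShift w k d a : ℤ) : ℝ)) (2 ^ d) := by
  have e2 : (2 : ℝ) ^ (-(k - d : ℤ)) = 2 ^ (-k) * 2 ^ d := by
    rw [neg_sub, sub_eq_neg_add, zpow_add₀ two_ne_zero, zpow_natCast]
  rw [image_box (DyadicCube.side_pos _), DyadicCube.translate, box]
  congr 1
  funext a
  have e : DyadicCube.corner w ⟨k - d, p'⟩ a = ((⟨k, p⟩ : DyadicCube n).side •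
      (fun a => ((2 ^ d * p' a - p a + relShift w k d a : ℤ) : ℝ))
        + (⟨k, p⟩ : DyadicCube n).corner w) a := by
    simp only [Pi.add_apply, Pi.smul_apply, DyadicCube.corner_eq, DyadicCube.side, smul_eq_mul]
    rw [shift_sub_natCast, e2]
    push_cast
    ring
  rw [e]
  simp only [DyadicCube.side, e2]

/-- The affine map taking the smaller cube to the unit cube scales both sides of the badness
inequality by its side length `ℓ`, because `ℓ ^ γ * (2 ^ d * ℓ) ^ (1 - γ) = ℓ * (2 ^ d) ^ (1 - γ)`.
Only the relative position and `d` remain. -/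
theorem isBad_iff_exists (δ : ℝ) (r : ℕ) (w : GridParam n) (k : ℤ) (p : Fin n → ℤ) :
    IsBad δ r w ⟨k, p⟩ ↔ ∃ d : ℕ, r ≤ d ∧ ∃ p' : Fin n → ℤ,
      BadPosition δ d fun a => 2 ^ d * p' a - p a + relShift w k d a := by
  have key : ∀ (d : ℕ) (p' : Fin n → ℤ),
      (setDist ((⟨k, p⟩ : DyadicCube n).translate w)
        (frontier ((⟨k - d, p'⟩ : DyadicCube n).translate w)) ≤
        2 * (⟨k, p⟩ : DyadicCube n).side ^ gammaExp n δ
          * (⟨k - d, p'⟩ : DyadicCube n).side ^ (1 - gammaExp n δ)) ↔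
      BadPosition δ d fun a => 2 ^ d * p' a - p a + relShift w k d a := by
    intro d p'
    have hs := (⟨k, p⟩ : DyadicCube n).side_pos
    have e : (⟨k - d, p'⟩ : DyadicCube n).side = (⟨k, p⟩ : DyadicCube n).side * 2 ^ d := by
      simp only [DyadicCube.side]
      rw [neg_sub, sub_eq_neg_add, zpow_add₀ two_ne_zero, zpow_natCast]
    rw [translate_eq_image w ⟨k, p⟩, translate_eq_image' w k p, frontier_image hs,
      setDist_image hs, e, Real.mul_rpow hs.le (by positivity), ← mul_assoc, mul_assoc (2 : ℝ),
      ← Real.rpow_add hs, add_sub_cancel, Real.rpow_one, mul_comm (2 : ℝ), mul_assoc,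
      mul_le_mul_iff_right₀ hs]
    rfl
  constructor
  · rintro ⟨⟨k', p'⟩, h1, h2⟩
    have h3 : (r : ℤ) + -k ≤ -k' := by
      rw [DyadicCube.side, DyadicCube.side, ← zpow_natCast, ← zpow_add₀ two_ne_zero] at h1
      exact (zpow_le_zpow_iff_right₀ one_lt_two).1 h1
    obtain ⟨d, hd⟩ := Int.eq_ofNat_of_zero_le (a := k - k') (by lia)
    obtain rfl : k' = k - d := by lia
    exact ⟨d, by lia, p', (key d p').1 h2⟩
  · rintro ⟨d, hd, p', h⟩
    refine ⟨⟨k - d, p'⟩, ?_, (key d p').2 h⟩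
    rw [DyadicCube.side, DyadicCube.side, ← zpow_natCast, ← zpow_add₀ two_ne_zero]
    exact (zpow_le_zpow_iff_right₀ one_lt_two).2 (by simp only; lia)

/-- The relative position modulo `2 ^ d`, for a bad position. -/
def BadResidue (δ : ℝ) (d : ℕ) (y : Fin n → ZMod (2 ^ d)) : Prop :=
  ∃ z : Fin n → ℤ, (∀ a, (z a : ZMod (2 ^ d)) = y a) ∧ BadPosition δ d z

/-- As `p'` runs through all positions of the larger cubes, the relative position runs through a
full residue class modulo `2 ^ d`. -/
theorem isBad_iff (δ : ℝ) (r : ℕ) (w : GridParam n) (k : ℤ) (p : Fin n → ℤ) :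
    IsBad δ r w ⟨k, p⟩ ↔ ∃ d : ℕ, r ≤ d ∧
      BadResidue δ d fun a => (relShift w k d a : ZMod (2 ^ d)) - (p a : ZMod (2 ^ d)) := by
  rw [isBad_iff_exists]
  refine exists_congr fun d => and_congr_right fun _ => ⟨?_, ?_⟩
  · rintro ⟨p', h⟩
    refine ⟨_, fun a => ?_, h⟩
    have : ((2 : ZMod (2 ^ d)) ^ d) = 0 := by exact_mod_cast ZMod.natCast_self (2 ^ d)
    push_cast
    rw [this]
    ring
  · rintro ⟨z, hz, h⟩
    have h1 : ∀ a, ∃ c, z a - (relShift w k d a - p a) = 2 ^ d * c := fun a => by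
      have := hz a
      beta_reduce at this
      rw [← Int.cast_sub, eq_comm, ZMod.intCast_eq_intCast_iff_dvd_sub] at this
      obtain ⟨c, hc⟩ := this
      exact ⟨c, by rw [hc]; push_cast; ring⟩
    choose p' hp' using h1
    refine ⟨p', ?_⟩
    convert h using 2 with a
    linarith [hp' a]

/-- The finer bits translate a cube and all larger cubes of its grid alike, so they do not affect
relative positions. -/
theorem isGood_congr {δ : ℝ} {r : ℕ} {w w' : GridParam n} {k : ℤ} (h : ∀ i ≤ k, w i = w' i)
    (p : Fin n → ℤ) : IsGood δ r w ⟨k, p⟩ ↔ IsGood δ r w' ⟨k, p⟩ := by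
  simp only [IsGood, isBad_iff, relShift_congr h]

theorem relShift_cast_eq (w : GridParam n) (k : ℤ) {d D : ℕ} (h : d ≤ D) (a : Fin n) :
    (relShift w k D a : ZMod (2 ^ d)) = relShift w k d a := by
  induction D, h using Nat.le_induction with
  | base => rfl
  | succ D hD ih =>
    have : ((2 : ZMod (2 ^ d)) ^ D) = 0 := by
      have h2 : ((2 : ZMod (2 ^ d)) ^ d) = 0 := by exact_mod_cast ZMod.natCast_self (2 ^ d)
      rw [← Nat.sub_add_cancel hD, pow_add, h2, mul_zero]
    rw [relShift, Finset.sum_range_succ, ← relShift]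
    push_cast
    rw [ih, this, zero_mul, add_zero]

/-- The residue modulo `2 ^ D` with the given binary digits. -/
def ofDigits (D : ℕ) (β : Fin D → Fin n → Bool) (a : Fin n) : ZMod (2 ^ D) :=
  ∑ t : Fin D, 2 ^ (t : ℕ) * (if β t a then 1 else 0)

theorem relShift_cast (w : GridParam n) (k : ℤ) (D : ℕ) (a : Fin n) :
    (relShift w k D a : ZMod (2 ^ D)) = ofDigits D (fun t => w (k - (t : ℕ))) a := by
  rw [relShift, ofDigits, Finset.sum_range]
  push_cast
  rfl

theorem exists_digits (D x : ℕ) (hx : x < 2 ^ D) :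
    ∃ β : ℕ → Bool, ∑ t ∈ Finset.range D, 2 ^ t * (if β t then 1 else 0) = x := by
  induction D generalizing x with
  | zero => exact ⟨fun _ => false, by simp at hx; simp [hx]⟩
  | succ D ih =>
    by_cases h : x < 2 ^ D
    · obtain ⟨β, hβ⟩ := ih x h
      refine ⟨Function.update β D false, ?_⟩
      rw [Finset.sum_range_succ, ← hβ]
      simp only [Function.update_self, Bool.false_eq_true, if_false, mul_zero, add_zero]
      refine Finset.sum_congr rfl fun t ht => ?_
      rw [Function.update_of_ne (Finset.mem_range.1 ht).ne]
    · obtain ⟨β, hβ⟩ := ih (x - 2 ^ D) (by rw [pow_succ] at hx; lia)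
      refine ⟨Function.update β D true, ?_⟩
      rw [Finset.sum_range_succ]
      simp only [Function.update_self, if_true, mul_one]
      have : ∑ t ∈ Finset.range D, 2 ^ t * (if Function.update β D true t = true then 1 else 0)
          = x - 2 ^ D := by
        rw [← hβ]
        refine Finset.sum_congr rfl fun t ht => ?_
        rw [Function.update_of_ne (Finset.mem_range.1 ht).ne]
      lia

/-- Hence uniform independent digits give a uniform residue, whose law is invariant under
translation by the position of a cube. -/
theorem bijective_ofDigits (n D : ℕ) : Function.Bijective (ofDigits (n := n) D) := by
  have : NeZero (2 ^ D) := ⟨by positivity⟩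
  refine (Fintype.bijective_iff_surjective_and_card _).2 ⟨fun z => ?_, ?_⟩
  · choose β hβ using fun a => exists_digits D (z a).val (ZMod.val_lt (z a))
    refine ⟨fun t a => β a t, funext fun a => ?_⟩
    have := congrArg (Nat.cast : ℕ → ZMod (2 ^ D)) (hβ a)
    rw [ZMod.natCast_zmod_val, Finset.sum_range] at this
    push_cast at this
    exact this
  · simp only [Fintype.card_fun, Fintype.card_bool, Fintype.card_fin, ZMod.card]
    rw [← pow_mul, ← pow_mul, mul_comm]

theorem gridMeasure_digits (k : ℤ) (D : ℕ) (S : Finset (Fin D → Fin n → Bool)) :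
    gridMeasure n {w | (fun t : Fin D => w (k - (t : ℕ))) ∈ S}
      = S.card * ((Fintype.card (Fin n → Bool) : ℝ≥0∞)⁻¹) ^ D := by
  classical
  have hm : Measurable fun (w : GridParam n) (t : Fin D) => w (k - (t : ℕ)) :=
    measurable_pi_iff.2 fun t => measurable_pi_apply _
  have h1 : ∀ β : Fin D → Fin n → Bool,
      gridMeasure n ((fun (w : GridParam n) (t : Fin D) => w (k - (t : ℕ))) ⁻¹' {β})
        = ((Fintype.card (Fin n → Bool) : ℝ≥0∞)⁻¹) ^ D := by
    intro β
    let e : Fin D ↪ ℤ := ⟨fun t => k - (t : ℕ), fun s t h => by ext; simp only at h; lia⟩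
    let β' : ℤ → Fin n → Bool := Function.extend e β fun _ _ => false
    have hβ' : ∀ t : Fin D, β' (k - (t : ℕ)) = β t := fun t => e.injective.extend_apply β _ t
    have e1 : ((fun (w : GridParam n) (t : Fin D) => w (k - (t : ℕ))) ⁻¹' {β})
        = Set.pi (Finset.univ.map e : Finset ℤ) fun i => {β' i} := by
      ext w
      simp only [mem_preimage, mem_singleton_iff, funext_iff, Set.mem_pi, Finset.coe_map,
        Finset.coe_univ, image_univ, mem_range, forall_exists_index, forall_apply_eq_imp_iff]
      refine forall_congr' fun t => forall_congr' fun a => ?_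
      rw [show β' (e t) = β t from hβ' t]
      rfl
    rw [e1, gridMeasure, Measure.infinitePi_pi _ fun i _ => measurableSet_singleton _]
    simp only [PMF.toMeasure_apply_singleton _ _ (measurableSet_singleton _),
      PMF.uniformOfFintype_apply, Finset.prod_const, Finset.card_map, Finset.card_univ,
      Fintype.card_fin]
  have h2 := sum_measure_preimage_singleton (μ := gridMeasure n) S
    (f := fun (w : GridParam n) (t : Fin D) => w (k - (t : ℕ)))
    fun β _ => hm (measurableSet_singleton β)
  simp only [h1, Finset.sum_const, nsmul_eq_mul] at h2
  exact h2.symm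

/-- Goodness with respect to the cubes that are at most `2 ^ D` times larger. -/
def GoodUpTo (δ : ℝ) (r D : ℕ) (w : GridParam n) (k : ℤ) (p : Fin n → ℤ) : Prop :=
  ∀ d ≤ D, r ≤ d →
    ¬ BadResidue δ d fun a => (relShift w k d a : ZMod (2 ^ d)) - (p a : ZMod (2 ^ d))

/-- The residue modulo `2 ^ D` determines those modulo `2 ^ d` for all `d ≤ D`. The set `S` does not
depend on the cube. -/
theorem goodUpTo_iff (δ : ℝ) (r D : ℕ) : ∃ S : Set (Fin n → ZMod (2 ^ D)), ∀ w k p,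
    GoodUpTo δ r D w k p ↔ (fun a => ofDigits D (fun t => w (k - (t : ℕ))) a - p a) ∈ S := by
  refine ⟨{y | ∀ (d : ℕ) (h : d ≤ D), r ≤ d →
    ¬ BadResidue δ d fun a => ZMod.castHom (pow_dvd_pow 2 h) (ZMod (2 ^ d)) (y a)},
    fun w k p => forall_congr' fun d => forall_congr' fun h => ?_⟩
  simp only [← relShift_cast, map_sub, map_intCast, relShift_cast_eq w k h]

theorem measurableSet_digits (k : ℤ) (D : ℕ) (S : Set (Fin D → Fin n → Bool)) :
    MeasurableSet {w : GridParam n | (fun t : Fin D => w (k - (t : ℕ))) ∈ S} :=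
  (measurable_pi_iff.2 fun t : Fin D => measurable_pi_apply (k - (t : ℕ)))
    (Set.toFinite S).measurableSet

theorem measurableSet_goodUpTo (δ : ℝ) (r D : ℕ) (k : ℤ) (p : Fin n → ℤ) :
    MeasurableSet {w : GridParam n | GoodUpTo δ r D w k p} := by
  obtain ⟨S, hS⟩ := goodUpTo_iff (n := n) δ r D
  simp only [hS]
  exact measurableSet_digits k D {β | (fun a => ofDigits D β a - (p a : ZMod (2 ^ D))) ∈ S}

theorem gridMeasure_goodUpTo (δ : ℝ) (r D : ℕ) (k : ℤ) (p : Fin n → ℤ) :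
    gridMeasure n {w | GoodUpTo δ r D w k p} = gridMeasure n {w | GoodUpTo δ r D w 0 0} := by
  classical
  have : NeZero (2 ^ D) := ⟨by positivity⟩
  obtain ⟨S, hS⟩ := goodUpTo_iff (n := n) δ r D
  have key : ∀ (k : ℤ) (p : Fin n → ℤ), gridMeasure n {w | GoodUpTo δ r D w k p}
      = (Finset.univ.filter (· ∈ S)).card * ((Fintype.card (Fin n → Bool) : ℝ≥0∞)⁻¹) ^ D := by
    intro k p
    have e := gridMeasure_digits k D
      (Finset.univ.filter fun β : Fin D → Fin n → Bool =>
        (fun a => ofDigits D β a - (p a : ZMod (2 ^ D))) ∈ S)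
    simp only [Finset.mem_filter, Finset.mem_univ, true_and] at e
    simp only [hS]
    rw [e]
    congr 2
    -- Digits to residue, then translation by the position: a bijection, so the number of favourable
    -- digit patterns is the cardinality of `S`.
    let E : (Fin D → Fin n → Bool) ≃ (Fin n → ZMod (2 ^ D)) :=
      (Equiv.ofBijective _ (bijective_ofDigits n D)).trans
        (Equiv.subRight fun a => (p a : ZMod (2 ^ D)))
    refine Finset.card_bij (fun β _ => E β) (fun β hβ => ?_) (fun β _ β' _ h => E.injective h)
      fun z hz => ⟨E.symm z, ?_, E.apply_symm_apply z⟩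
    · simp only [Finset.mem_filter, Finset.mem_univ, true_and] at hβ ⊢
      exact hβ
    · simp only [Finset.mem_filter, Finset.mem_univ, true_and] at hz ⊢
      have : (fun a => ofDigits D (E.symm z) a - (p a : ZMod (2 ^ D))) = E (E.symm z) := rfl
      rw [this, E.apply_symm_apply]
      exact hz
  rw [key, key]

theorem setOf_isGood_eq (δ : ℝ) (r : ℕ) (k : ℤ) (p : Fin n → ℤ) :
    {w : GridParam n | IsGood δ r w ⟨k, p⟩} = ⋂ D : ℕ, {w | GoodUpTo δ r D w k p} := by
  ext w
  simp only [IsGood, isBad_iff, mem_iInter, mem_ofPred_eq, GoodUpTo, not_exists, not_and]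
  exact ⟨fun h D d _ => h d, fun h d => h d d le_rfl⟩

theorem measurableSet_isGood (δ : ℝ) (r : ℕ) (I : DyadicCube n) :
    MeasurableSet {w : GridParam n | IsGood δ r w I} := by
  rw [setOf_isGood_eq δ r I.scale I.pos]
  exact MeasurableSet.iInter fun D => measurableSet_goodUpTo _ _ _ _ _

/-- Continuity of the measure along the decreasing events `GoodUpTo`, whose probabilities are the
same for all cubes. -/
theorem measureReal_isGood (δ : ℝ) (r : ℕ) (I : DyadicCube n) :
    (gridMeasure n).real {w | IsGood δ r w I} = goodProb n δ r := by
  have h : ∀ k p, Tendsto (fun D => gridMeasure n {w | GoodUpTo δ r D w k p}) atTop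
      (𝓝 (gridMeasure n {w | IsGood δ r w ⟨k, p⟩})) := fun k p => by
    rw [setOf_isGood_eq]
    refine tendsto_measure_iInter_atTop
      (fun D => (measurableSet_goodUpTo _ _ _ _ _).nullMeasurableSet) ?_ ⟨0, measure_ne_top _ _⟩
    exact fun D D' hD w hw d hd => hw d (hd.trans hD)
  have h1 := h I.scale I.pos
  simp only [gridMeasure_goodUpTo δ r _ I.scale I.pos] at h1
  rw [goodProb, Measure.real, Measure.real]
  congr 1
  exact tendsto_nhds_unique h1 (h 0 0)

/-! ### Independence of goodness and finer bits. -/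

/-- The bits of `w` up to `k`, and those of `w'` beyond. -/
def mix (k : ℤ) (x : GridParam n × GridParam n) : GridParam n :=
  fun i => if i ≤ k then x.1 i else x.2 i

theorem measurePreserving_mix (n : ℕ) (k : ℤ) :
    MeasurePreserving (mix (n := n) k) ((gridMeasure n).prod (gridMeasure n)) (gridMeasure n) := by
  classical
  have hm : Measurable (mix (n := n) k) := by
    refine measurable_pi_iff.2 fun i => ?_
    by_cases h : i ≤ k
    · simp only [mix, h, if_true]; fun_prop
    · simp only [mix, h, if_false]; fun_prop
  refine ⟨hm, ?_⟩
  refine Measure.eq_infinitePi _ fun s t ht => ?_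
  rw [Measure.map_apply hm (MeasurableSet.pi s.countable_toSet fun i _ => ht i)]
  have e : mix (n := n) k ⁻¹' Set.pi s t
      = Set.pi (s.filter (· ≤ k)) t ×ˢ Set.pi (s.filter fun i => ¬ i ≤ k) t := by
    ext x
    simp only [mem_preimage, Set.mem_pi, mem_prod, Finset.coe_filter, mem_ofPred_eq, mix,
      Finset.mem_coe]
    constructor
    · intro h
      exact ⟨fun i hi => by simpa [hi.2] using h i hi.1, fun i hi => by simpa [hi.2] using h i hi.1⟩
    · rintro ⟨h1, h2⟩ i hi
      split_ifs with h
      · exact h1 i ⟨hi, h⟩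
      · exact h2 i ⟨hi, h⟩
  rw [e, Measure.prod_prod, gridMeasure, Measure.infinitePi_pi _ fun i _ => ht i,
    Measure.infinitePi_pi _ fun i _ => ht i]
  exact Finset.prod_filter_mul_prod_filter_not s _ _

theorem measurable_goodInd (δ : ℝ) (r : ℕ) (I : DyadicCube n) :
    Measurable fun w => goodInd δ r w I :=
  Measurable.ite (measurableSet_isGood δ r I) measurable_const measurable_const

theorem integral_goodInd (δ : ℝ) (r : ℕ) (I : DyadicCube n) :
    ∫ w, goodInd δ r w I ∂(gridMeasure n) = goodProb n δ r := by
  have e : (fun w => goodInd δ r w I)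
      = {w | IsGood δ r w I}.indicator fun _ => (1 : ℂ) := by
    funext w
    by_cases h : IsGood δ r w I <;> simp [goodInd, h]
  rw [e, integral_indicator (measurableSet_isGood δ r I), setIntegral_const, measureReal_isGood]
  simp

/-- Goodness of a cube is independent of the grid of the cubes that are not larger. -/
theorem integral_goodInd_mul (δ : ℝ) (r : ℕ) (k : ℤ) (p : Fin n → ℤ) {X : GridParam n → ℂ}
    (hX : Measurable X) (hX' : ∀ w w', (∀ i, k < i → w i = w' i) → X w = X w') :
    ∫ w, goodInd δ r w ⟨k, p⟩ * X w ∂(gridMeasure n)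
      = goodProb n δ r * ∫ w, X w ∂(gridMeasure n) := by
  -- With `w` replaced by `mix k x`, the indicator depends only on `x.1` and `X` only on `x.2`, so
  -- the integral over the product factorizes.
  have hmp := measurePreserving_mix n k
  have h := integral_map (μ := (gridMeasure n).prod (gridMeasure n)) hmp.measurable.aemeasurable
    (f := fun w => goodInd δ r w ⟨k, p⟩ * X w)
    ((measurable_goodInd δ r ⟨k, p⟩).mul hX).aestronglyMeasurable
  rw [hmp.map_eq] at h
  rw [h, ← integral_goodInd δ r ⟨k, p⟩, ← integral_prod_mul]
  refine integral_congr_ae (Eventually.of_forall fun x => ?_)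
  simp only
  congr 1
  · have : IsGood δ r (mix k x) ⟨k, p⟩ ↔ IsGood δ r x.1 ⟨k, p⟩ :=
      isGood_congr (fun i hi => by simp [mix, hi]) p
    by_cases hg : IsGood δ r x.1 ⟨k, p⟩ <;> simp only [goodInd, this, hg, if_true, if_false]
  · exact hX' _ _ fun i hi => by simp [mix, hi]

/-! ### The one-parameter averaging formula. -/

namespace TestFun

theorem eLpNorm_ne_top (p : ℝ≥0∞) (f : TestFun n m) :
    eLpNorm (f : Space n m → ℂ) p volume ≠ ⊤ := by
  obtain ⟨C, hC⟩ := f.2.2.1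
  have hs := subset_closure (s := Function.support (f : Space n m → ℂ))
  have hB := f.2.2.2.isCompact_closure.measure_lt_top (μ := volume)
  have h := eLpNorm_le_of_ae_bound (p := p)
    (μ := volume.restrict (closure (Function.support (f : Space n m → ℂ))))
    (f := (f : Space n m → ℂ)) (Eventually.of_forall hC)
  rw [eLpNorm_restrict_eq_of_support_subset hs, Measure.restrict_apply_univ] at h
  exact ne_top_of_le_ne_top (ENNReal.mul_ne_top
    (ENNReal.rpow_ne_top_of_nonneg (by positivity) hB.ne) ENNReal.ofReal_ne_top) h

theorem lpNorm_sub_le {p : ℝ≥0∞} (hp : 1 < p) (f g : TestFun n m) :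
    lpNorm p (f - g) ≤ lpNorm p f + lpNorm p g := by
  rw [lpNorm, lpNorm, lpNorm, ← ENNReal.toReal_add (eLpNorm_ne_top p f) (eLpNorm_ne_top p g)]
  exact ENNReal.toReal_mono (ENNReal.add_ne_top.2 ⟨eLpNorm_ne_top p f, eLpNorm_ne_top p g⟩)
    (eLpNorm_sub_le (measurable f).aestronglyMeasurable (measurable g).aestronglyMeasurable hp.le)

-- Only finitely many cubes of a given scale contribute, and `W` works for every `w`; thus random
-- restrictions `G` become finite sums with random coefficients.
open scoped Classical in
theorem diff_eq_sum (k : ℤ) (f : TestFun n m) : ∃ W : Finset (Fin n → ℤ),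
    ∀ (w : GridParam n) (G : Set (Fin n → ℤ)),
      diff w k G f = ∑ p ∈ W, (if p ∈ G then (1 : ℂ) else 0) • diff w k {p} f := by
  obtain ⟨M, R, _, _, hM, hR⟩ := exists_bound f
  refine ⟨window n k (R + 2 ^ (-k)), fun w G => ?_⟩
  ext x
  rw [Submodule.coe_sum, Finset.sum_apply]
  simp only [Submodule.coe_smul, Pi.smul_apply, smul_eq_mul, diff_apply, mem_singleton_iff]
  by_cases hx : dif w k (fun x' => (f : Space n m → ℂ) (x', x.2)) x.1 = 0
  · simp [hx]
  · have h := idx_mem_window w k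
      (norm_le_of_dif_ne_zero (fun x' hx' => (hR (x', x.2) hx').1) hx)
    rw [Finset.sum_eq_single_of_mem _ h fun p _ hp => by simp [hp.symm]]
    simp

theorem average_congr {w w' : GridParam n} {k : ℤ} (h : ∀ i, k < i → w i = w' i)
    (f : TestFun n m) : average w k f = average w' k f := by
  ext x
  simp only [average_apply, avg, idx_congr h]

theorem diff_congr {w w' : GridParam n} {k : ℤ} (h : ∀ i, k < i → w i = w' i)
    (G : Set (Fin n → ℤ)) (f : TestFun n m) : diff w k G f = diff w' k G f := by
  ext x
  rw [diff, diff, average_congr h, average_congr fun i hi => h i (by lia), restrict_apply,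
    restrict_apply, idx_congr h]

theorem sum_diff_univ (w : GridParam n) {k l : ℤ} (hkl : k ≤ l) (f : TestFun n m) :
    ∑ i ∈ Finset.Ico k l, diff w i univ f = average w l f - average w k f := by
  simp only [diff_univ]
  induction l, hkl using Int.leInduction with
  | base => simp
  | succ l hl ih =>
    have : Finset.Ico k (l + 1) = insert l (Finset.Ico k l) := by
      ext i
      simp only [Finset.mem_Ico, Finset.mem_insert]
      lia
    rw [this, Finset.sum_insert (by simp), ih]
    abel

end TestFun

/-- The positions of the good cubes of scale `k`. -/
def goodSet (δ : ℝ) (r : ℕ) (w : GridParam n) (k : ℤ) : Set (Fin n → ℤ) :=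
  {p | IsGood δ r w ⟨k, p⟩}

theorem FormBound.flip {p q : ℝ≥0∞} {T : TestFun n m →ₗ[ℂ] TestFun n m →ₗ[ℂ] ℂ} {A : ℝ}
    (hT : FormBound p q T A) : FormBound q p T.flip A :=
  ⟨hT.1, fun f g => (hT.2 g f).trans_eq (by ring)⟩

section OneParameter

variable {p q : ℝ≥0∞} {T : TestFun n m →ₗ[ℂ] TestFun n m →ₗ[ℂ] ℂ} {A : ℝ}

theorem form_diff_goodSet (δ : ℝ) (r : ℕ) (k : ℤ) (f : TestFun n m) :
    ∃ W : Finset (Fin n → ℤ), ∀ (T : TestFun n m →ₗ[ℂ] TestFun n m →ₗ[ℂ] ℂ) (w : GridParam n)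
      (h : TestFun n m),
      T (TestFun.diff w k (goodSet δ r w k) f) h
          = ∑ p ∈ W, goodInd δ r w ⟨k, p⟩ * T (TestFun.diff w k {p} f) h ∧
        T (TestFun.diff w k univ f) h = ∑ p ∈ W, T (TestFun.diff w k {p} f) h := by
  classical
  obtain ⟨W, hW⟩ := TestFun.diff_eq_sum k f
  refine ⟨W, fun T w h => ⟨?_, ?_⟩⟩
  · rw [hW, map_sum, LinearMap.sum_apply]
    refine Finset.sum_congr rfl fun p _ => ?_
    rw [map_smul, LinearMap.smul_apply, smul_eq_mul]
    by_cases hp : IsGood δ r w ⟨k, p⟩ <;> simp [goodInd, goodSet, hp]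
  · rw [hW, map_sum, LinearMap.sum_apply]
    simp

theorem measurable_form_diff_goodSet (hp : 1 < p) (hp' : p ≠ ⊤) (hq : 1 < q) (hq' : q ≠ ⊤)
    (hT : FormBound p q T A) (δ : ℝ) (r : ℕ) (k : ℤ) (f : TestFun n m)
    {Y : GridParam n → TestFun n m} (hY : TameFamily Y) :
    Measurable fun w => T (TestFun.diff w k (goodSet δ r w k) f) (Y w) := by
  obtain ⟨W, hW⟩ := form_diff_goodSet (n := n) (m := m) δ r k f
  simp only [(hW T _ _).1]
  exact Finset.measurable_fun_sum _ fun p _ => (measurable_goodInd δ r ⟨k, p⟩).mul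
    ((TameFamily.diff k {p} f).continuous_form hY hp hp' hq hq' hT).measurable

theorem integrable_of_norm_le {X : GridParam n → ℂ} (hX : Measurable X) {C : ℝ}
    (hC : ∀ w, ‖X w‖ ≤ C) : Integrable X (gridMeasure n) :=
  Integrable.of_bound hX.aestronglyMeasurable C (Eventually.of_forall hC)

theorem norm_form_le (hT : FormBound p q T A) {f g : TestFun n m} {a b : ℝ}
    (hf : TestFun.lpNorm p f ≤ a) (hg : TestFun.lpNorm q g ≤ b) : ‖T f g‖ ≤ A * a * b := by
  have h0 := TestFun.lpNorm_nonneg p f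
  have h1 := TestFun.lpNorm_nonneg q g
  have hA := hT.1
  have ha : 0 ≤ a := h0.trans hf
  refine (hT.2 f g).trans ?_
  gcongr

/-- A tame family is bounded in `L^q`. -/
theorem TameFamily.exists_lpNorm_le {α : Type*} [TopologicalSpace α] {F : α → TestFun n m}
    (hF : TameFamily F) (p : ℝ≥0∞) : ∃ C, ∀ w, TestFun.lpNorm p (F w) ≤ C := by
  obtain ⟨C, hC⟩ := hF.bound
  obtain ⟨R, hR⟩ := hF.support
  refine ⟨_, fun w => TestFun.lpNorm_le (R := |R|) (S := |R|) p (F w) (abs_nonneg _) (abs_nonneg _)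
    (hC w) fun x hx => ?_⟩
  have := (hR w x hx).trans (le_abs_self R)
  exact ⟨(norm_fst_le x).trans this, (norm_snd_le x).trans this⟩

/-- Splitting into single positions leaves deterministic labels, so `integral_goodInd_mul` applies
to each; `hY'` ensures that the second argument uses only the bits beyond `k`. -/
theorem integral_form_diff_goodSet (hp : 1 < p) (hp' : p ≠ ⊤) (hq : 1 < q) (hq' : q ≠ ⊤)
    (hT : FormBound p q T A) (δ : ℝ) (r : ℕ) (k : ℤ) (f : TestFun n m)
    {Y : GridParam n → TestFun n m} (hY : TameFamily Y)
    (hY' : ∀ w w', (∀ i, k < i → w i = w' i) → Y w = Y w') :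
    ∫ w, T (TestFun.diff w k (goodSet δ r w k) f) (Y w) ∂(gridMeasure n)
      = goodProb n δ r * ∫ w, T (TestFun.diff w k univ f) (Y w) ∂(gridMeasure n) := by
  obtain ⟨W, hW⟩ := form_diff_goodSet (n := n) (m := m) δ r k f
  have hm : ∀ s : Fin n → ℤ, Measurable fun w => T (TestFun.diff w k {s} f) (Y w) := fun s =>
    ((TameFamily.diff k {s} f).continuous_form hY hp hp' hq hq' hT).measurable
  obtain ⟨C, hC⟩ := hY.exists_lpNorm_le q
  have hb : ∀ s : Fin n → ℤ, ∃ D, ∀ w, ‖T (TestFun.diff w k {s} f) (Y w)‖ ≤ D := fun s => by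
    obtain ⟨D, hD⟩ := (TameFamily.diff k {s} f).exists_lpNorm_le p
    exact ⟨_, fun w => norm_form_le hT (hD w) (hC w)⟩
  simp only [(hW T _ _).1, (hW T _ _).2]
  rw [integral_finsetSum _ fun s _ => ?_, integral_finsetSum _ fun s _ => ?_, Finset.mul_sum]
  · refine Finset.sum_congr rfl fun s _ => integral_goodInd_mul δ r k s (hm s) fun w w' h => ?_
    rw [TestFun.diff_congr h, hY' w w' h]
  · obtain ⟨D, hD⟩ := hb s
    exact integrable_of_norm_le (hm s) hD
  · obtain ⟨D, hD⟩ := hb s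
    refine integrable_of_norm_le (C := D) ((measurable_goodInd δ r ⟨k, s⟩).mul (hm s)) fun w => ?_
    rw [norm_mul]
    refine (mul_le_of_le_one_left (norm_nonneg _) ?_).trans (hD w)
    rw [goodInd]
    split_ifs <;> simp

open scoped Classical in
/-- The part of the form at the scales `k₁` and `k₂`, restricted to positions in `G` for the cubes
with the smaller side length. -/
noncomputable def scaleForm (T : TestFun n m →ₗ[ℂ] TestFun n m →ₗ[ℂ] ℂ) (f g : TestFun n m)
    (w : GridParam n) (G : ℤ → Set (Fin n → ℤ)) (k₁ k₂ : ℤ) : ℂ :=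
  T (TestFun.diff w k₁ (if k₂ ≤ k₁ then G k₁ else univ) f)
    (TestFun.diff w k₂ (if k₂ ≤ k₁ then univ else G k₂) g)

/-- Summation over all scales between `-N` and `N`: the larger cubes give averages. -/
theorem sum_scaleForm (f g : TestFun n m) (w : GridParam n) (G : ℤ → Set (Fin n → ℤ)) (a b : ℤ) :
    ∑ k₁ ∈ Finset.Ico a b, ∑ k₂ ∈ Finset.Ico a b, scaleForm T f g w G k₁ k₂
      = ∑ k ∈ Finset.Ico a b,
          (T (TestFun.diff w k (G k) f) (TestFun.average w (k + 1) g)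
            + T (TestFun.average w k f) (TestFun.diff w k (G k) g))
        - ∑ k ∈ Finset.Ico a b,
          (T (TestFun.diff w k (G k) f) (TestFun.average w a g)
            + T (TestFun.average w a f) (TestFun.diff w k (G k) g)) := by
  -- Ties belong to this case, as in `DyadicCube.smaller`. Hence the telescoped average of `g` is at
  -- scale `k₁ + 1`, while that of `f` in `e2` is only at scale `k₂`.
  have e1 : ∀ k₁ ∈ Finset.Ico a b, ∑ k₂ ∈ (Finset.Ico a b).filter (· ≤ k₁),
      scaleForm T f g w G k₁ k₂ = T (TestFun.diff w k₁ (G k₁) f) (TestFun.average w (k₁ + 1) g)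
        - T (TestFun.diff w k₁ (G k₁) f) (TestFun.average w a g) := by
    intro k₁ hk
    have hf : (Finset.Ico a b).filter (· ≤ k₁) = Finset.Ico a (k₁ + 1) := by
      ext i
      simp only [Finset.mem_filter, Finset.mem_Ico] at hk ⊢
      lia
    rw [← map_sub, ← TestFun.sum_diff_univ w (by simp only [Finset.mem_Ico] at hk; lia), map_sum, hf]
    refine Finset.sum_congr rfl fun k₂ hk₂ => ?_
    have : k₂ ≤ k₁ := by simp only [Finset.mem_Ico] at hk₂; lia
    rw [scaleForm, if_pos this, if_pos this]
  have e2 : ∀ k₂ ∈ Finset.Ico a b, ∑ k₁ ∈ (Finset.Ico a b).filter (fun k₁ => ¬ k₂ ≤ k₁),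
      scaleForm T f g w G k₁ k₂ = T (TestFun.average w k₂ f) (TestFun.diff w k₂ (G k₂) g)
        - T (TestFun.average w a f) (TestFun.diff w k₂ (G k₂) g) := by
    intro k₂ hk
    have hf : (Finset.Ico a b).filter (fun k₁ => ¬ k₂ ≤ k₁) = Finset.Ico a k₂ := by
      ext i
      simp only [Finset.mem_filter, Finset.mem_Ico] at hk ⊢
      lia
    rw [← LinearMap.sub_apply, ← map_sub,
      ← TestFun.sum_diff_univ w (by simp only [Finset.mem_Ico] at hk; lia), map_sum,
      LinearMap.sum_apply, hf]
    refine Finset.sum_congr rfl fun k₁ hk₁ => ?_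
    have : ¬ k₂ ≤ k₁ := by simp only [Finset.mem_Ico] at hk₁; lia
    rw [scaleForm, if_neg this, if_neg this]
  have e3 : ∑ k₁ ∈ Finset.Ico a b, ∑ k₂ ∈ Finset.Ico a b, scaleForm T f g w G k₁ k₂
      = ∑ k₁ ∈ Finset.Ico a b, ∑ k₂ ∈ (Finset.Ico a b).filter (· ≤ k₁), scaleForm T f g w G k₁ k₂
        + ∑ k₂ ∈ Finset.Ico a b, ∑ k₁ ∈ (Finset.Ico a b).filter (fun k₁ => ¬ k₂ ≤ k₁),
          scaleForm T f g w G k₁ k₂ := by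
    simp only [Finset.sum_filter]
    rw [Finset.sum_comm (f := fun k₂ k₁ => if ¬ k₂ ≤ k₁ then scaleForm T f g w G k₁ k₂ else 0),
      ← Finset.sum_add_distrib]
    refine Finset.sum_congr rfl fun k₁ _ => ?_
    rw [← Finset.sum_add_distrib]
    refine Finset.sum_congr rfl fun k₂ _ => ?_
    by_cases h : k₂ ≤ k₁ <;> simp [h]
  rw [e3, Finset.sum_congr rfl e1, Finset.sum_congr rfl e2, ← Finset.sum_add_distrib,
    ← Finset.sum_sub_distrib]
  exact Finset.sum_congr rfl fun k _ => by ring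

theorem sum_scaleForm_univ (f g : TestFun n m) (w : GridParam n) {a b : ℤ} (hab : a ≤ b) :
    ∑ k₁ ∈ Finset.Ico a b, ∑ k₂ ∈ Finset.Ico a b, scaleForm T f g w (fun _ => univ) k₁ k₂
      = T (TestFun.average w b f - TestFun.average w a f)
          (TestFun.average w b g - TestFun.average w a g) := by
  rw [← TestFun.sum_diff_univ w hab, ← TestFun.sum_diff_univ w hab, map_sum, Finset.sum_comm]
  refine Finset.sum_congr rfl fun k₂ _ => ?_
  rw [map_sum, LinearMap.sum_apply]
  refine Finset.sum_congr rfl fun k₁ _ => ?_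
  simp [scaleForm]

theorem measurable_scaleForm (hp : 1 < p) (hp' : p ≠ ⊤) (hq : 1 < q) (hq' : q ≠ ⊤)
    (hT : FormBound p q T A) (δ : ℝ) (r : ℕ) (f g : TestFun n m) (k₁ k₂ : ℤ) :
    Measurable fun w => scaleForm T f g w (goodSet δ r w) k₁ k₂ := by
  by_cases h : k₂ ≤ k₁
  · simp only [scaleForm, h, if_true]
    exact measurable_form_diff_goodSet hp hp' hq hq' hT δ r k₁ f (TameFamily.diff k₂ univ g)
  · simp only [scaleForm, h, if_false]
    exact measurable_form_diff_goodSet hq hq' hp hp' hT.flip δ r k₂ g (TameFamily.diff k₁ univ f)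

theorem exists_norm_scaleForm_le (hn : 0 < n) (hm : 0 < m) (hp : 1 < p) (hq : 1 < q)
    (hT : FormBound p q T A) {f g : TestFun n m} {M L R M' L' R' : ℝ}
    (hf : LipBound f M L R) (hg : LipBound g M' L' R') :
    ∃ C, ∀ w G k₁ k₂,
      ‖scaleForm T f g w G k₁ k₂‖ ≤ C * (TestFun.weight p k₁ * TestFun.weight q k₂) := by
  have hR := hf.R_nonneg
  have hR' := hg.R_nonneg
  have hM := hf.M_nonneg
  have hM' := hg.M_nonneg
  have hL := hf.L_nonneg
  have hL' := hg.L_nonneg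
  have h1 := difConst_nonneg n hR
  have h2 := difConst_nonneg n hR'
  have h3 := TestFun.lpConst_nonneg n m p (R := R + 1) (by linarith)
  have h4 := TestFun.lpConst_nonneg n m q (R := R' + 1) (by linarith)
  refine ⟨A * ((2 * L + difConst n R * M) * TestFun.lpConst n m p (R + 1))
    * ((2 * L' + difConst n R' * M') * TestFun.lpConst n m q (R' + 1)), fun w G k₁ k₂ => ?_⟩
  refine (norm_form_le hT
    ((TestFun.lpNorm_diff_le hn hm hp hf w k₁ _).trans (mul_le_mul_of_nonneg_left
      (TestFun.smallPart_mul_decay_le_weight p k₁) (by positivity)))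
    ((TestFun.lpNorm_diff_le hn hm hq hg w k₂ _).trans (mul_le_mul_of_nonneg_left
      (TestFun.smallPart_mul_decay_le_weight q k₂) (by positivity)))).trans_eq ?_
  ring

end OneParameter

section OneParameter

variable {p q : ℝ≥0∞} {T : TestFun n m →ₗ[ℂ] TestFun n m →ₗ[ℂ] ℂ} {A : ℝ}

theorem TestFun.lpNorm_diff_le_univ (p : ℝ≥0∞) (w : GridParam n) (k : ℤ) (G : Set (Fin n → ℤ))
    (f : TestFun n m) :
    TestFun.lpNorm p (TestFun.diff w k G f) ≤ TestFun.lpNorm p (TestFun.diff w k univ f) := by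
  classical
  refine ENNReal.toReal_mono (TestFun.eLpNorm_ne_top p _) (eLpNorm_mono fun x => ?_)
  rw [TestFun.diff_apply w k univ, if_pos (mem_univ _)]
  exact TestFun.norm_diff_apply_le w k G f x

theorem integrable_form_diff_goodSet (hp : 1 < p) (hp' : p ≠ ⊤) (hq : 1 < q) (hq' : q ≠ ⊤)
    (hT : FormBound p q T A) (δ : ℝ) (r : ℕ) (k : ℤ) (f : TestFun n m)
    {Y : GridParam n → TestFun n m} (hY : TameFamily Y) :
    Integrable (fun w => T (TestFun.diff w k (goodSet δ r w k) f) (Y w)) (gridMeasure n) := by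
  obtain ⟨C, hC⟩ := hY.exists_lpNorm_le q
  obtain ⟨D, hD⟩ := (TameFamily.diff k univ f).exists_lpNorm_le p
  exact integrable_of_norm_le (measurable_form_diff_goodSet hp hp' hq hq' hT δ r k f hY)
    fun w => norm_form_le hT ((TestFun.lpNorm_diff_le_univ p w k _ f).trans (hD w)) (hC w)

theorem integrable_form (hp : 1 < p) (hp' : p ≠ ⊤) (hq : 1 < q) (hq' : q ≠ ⊤)
    (hT : FormBound p q T A) {X Y : GridParam n → TestFun n m} (hX : TameFamily X)
    (hY : TameFamily Y) : Integrable (fun w => T (X w) (Y w)) (gridMeasure n) := by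
  obtain ⟨C, hC⟩ := hX.exists_lpNorm_le p
  obtain ⟨D, hD⟩ := hY.exists_lpNorm_le q
  exact integrable_of_norm_le (hX.continuous_form hY hp hp' hq hq' hT).measurable
    fun w => norm_form_le hT (hC w) (hD w)

/-- Each remainder pairs an average at scale `-N`, of size `decay`, with a martingale difference
whose norms are summable over `k`. The bound holds for every choice of `G`, so it covers both the
good cubes and all cubes. -/
theorem exists_norm_sum_form_average_le (hn : 0 < n) (hm : 0 < m) (hp : 1 < p) (hq : 1 < q)
    (hT : FormBound p q T A) {f g : TestFun n m} {M L R M' L' R' : ℝ}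
    (hf : LipBound f M L R) (hg : LipBound g M' L' R') :
    ∃ C, ∀ (w : GridParam n) (G : ℤ → Set (Fin n → ℤ)) (N : ℕ),
      ‖∑ k ∈ Finset.Ico (-(N : ℤ)) N,
          (T (TestFun.diff w k (G k) f) (TestFun.average w (-(N : ℤ)) g)
            + T (TestFun.average w (-(N : ℤ)) f) (TestFun.diff w k (G k) g))‖
        ≤ C * (decay p (-(N : ℤ)) + decay q (-(N : ℤ))) := by
  have hR := hf.R_nonneg
  have hR' := hg.R_nonneg
  have hM := hf.M_nonneg
  have hM' := hg.M_nonneg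
  have hL := hf.L_nonneg
  have hL' := hg.L_nonneg
  have h1 := difConst_nonneg n hR
  have h2 := difConst_nonneg n hR'
  have h3 := TestFun.lpConst_nonneg n m p (R := R + 1) (by linarith)
  have h4 := TestFun.lpConst_nonneg n m q (R := R' + 1) (by linarith)
  have hA := hT.1
  set a := (1 + (2 * R) ^ n) * M * TestFun.lpConst n m p (R + 1) with ha
  set b := (1 + (2 * R') ^ n) * M' * TestFun.lpConst n m q (R' + 1) with hb
  set c := (2 * L + difConst n R * M) * TestFun.lpConst n m p (R + 1) with hc
  set d := (2 * L' + difConst n R' * M') * TestFun.lpConst n m q (R' + 1) with hd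
  have ha0 : 0 ≤ a := by positivity
  have hb0 : 0 ≤ b := by positivity
  have hc0 : 0 ≤ c := by positivity
  have hd0 : 0 ≤ d := by positivity
  set P := ∑' k, TestFun.weight p k
  set Q := ∑' k, TestFun.weight q k
  have hP : 0 ≤ P := tsum_nonneg fun k => TestFun.weight_nonneg p k
  have hQ : 0 ≤ Q := tsum_nonneg fun k => TestFun.weight_nonneg q k
  refine ⟨A * c * b * P + A * a * d * Q, fun w G N => ?_⟩
  have dp := decay_pos p (-(N : ℤ))
  have dq := decay_pos q (-(N : ℤ))
  have hb1 : ∀ k ∈ Finset.Ico (-(N : ℤ)) N,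
      ‖T (TestFun.diff w k (G k) f) (TestFun.average w (-(N : ℤ)) g)
            + T (TestFun.average w (-(N : ℤ)) f) (TestFun.diff w k (G k) g)‖
        ≤ A * c * b * decay q (-(N : ℤ)) * TestFun.weight p k
          + A * a * d * decay p (-(N : ℤ)) * TestFun.weight q k := by
    intro k _
    have e1 := TestFun.lpNorm_average_le hn hm hp hf w (-(N : ℤ))
    have e2 := TestFun.lpNorm_average_le hn hm hq hg w (-(N : ℤ))
    have e3 := (TestFun.lpNorm_diff_le hn hm hp hf w k (G k)).trans
      (mul_le_mul_of_nonneg_left (TestFun.smallPart_mul_decay_le_weight p k) hc0)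
    have e4 := (TestFun.lpNorm_diff_le hn hm hq hg w k (G k)).trans
      (mul_le_mul_of_nonneg_left (TestFun.smallPart_mul_decay_le_weight q k) hd0)
    refine (norm_add_le _ _).trans
      ((add_le_add (norm_form_le hT e3 e2) (norm_form_le hT e1 e4)).trans_eq ?_)
    ring
  refine (norm_sum_le_of_le _ hb1).trans ?_
  rw [Finset.sum_add_distrib, ← Finset.mul_sum, ← Finset.mul_sum]
  have s1 : ∑ k ∈ Finset.Ico (-(N : ℤ)) N, TestFun.weight p k ≤ P :=
    (TestFun.summable_weight hp).sum_le_tsum _ fun k _ => TestFun.weight_nonneg p k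
  have s2 : ∑ k ∈ Finset.Ico (-(N : ℤ)) N, TestFun.weight q k ≤ Q :=
    (TestFun.summable_weight hq).sum_le_tsum _ fun k _ => TestFun.weight_nonneg q k
  calc _ ≤ A * c * b * decay q (-(N : ℤ)) * P + A * a * d * decay p (-(N : ℤ)) * Q := by gcongr
    _ ≤ A * c * b * decay q (-(N : ℤ)) * P + A * a * d * decay p (-(N : ℤ)) * Q
        + (A * c * b * P * decay p (-(N : ℤ)) + A * a * d * Q * decay q (-(N : ℤ))) :=
      le_add_of_nonneg_right (by positivity)
    _ = _ := by ring

theorem exists_lpNorm_average_sub_average_le (hn : 0 < n) (hm : 0 < m) (hp : 1 < p)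
    {f : TestFun n m} {M L R : ℝ} (hf : LipBound f M L R) :
    ∃ u : ℕ → ℝ, Tendsto u atTop (𝓝 0) ∧ ∀ (w : GridParam n) (N : ℕ),
      TestFun.lpNorm p (TestFun.average w N f - TestFun.average w (-(N : ℤ)) f - f) ≤ u N := by
  refine ⟨fun N => L * (1 / 2) ^ N * TestFun.lpConst n m p (R + 1)
    + (1 + (2 * R) ^ n) * M * TestFun.lpConst n m p (R + 1) * decay p (-(N : ℤ)), ?_,
    fun w N => ?_⟩
  · have h1 := tendsto_pow_atTop_nhds_zero_of_lt_one (r := (1 / 2 : ℝ)) (by norm_num) (by norm_num)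
    have h2 := ((h1.const_mul L).mul_const (TestFun.lpConst n m p (R + 1))).add
      ((TestFun.tendsto_decay_neg hp).const_mul ((1 + (2 * R) ^ n) * M * TestFun.lpConst n m p (R + 1)))
    simpa using h2
  · have e : TestFun.average w N f - TestFun.average w (-(N : ℤ)) f - f
        = (TestFun.average w N f - f) - TestFun.average w (-(N : ℤ)) f := by abel
    have h1 := TestFun.lpNorm_average_sub_le p hf w (Int.natCast_nonneg N)
    rw [zpow_neg, zpow_natCast, ← inv_pow, ← one_div] at h1
    rw [e]
    exact (TestFun.lpNorm_sub_le hp _ _).trans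
      (add_le_add h1 (TestFun.lpNorm_average_le hn hm hp hf w _))

theorem exists_norm_form_average_sub_le (hn : 0 < n) (hm : 0 < m) (hp : 1 < p) (hq : 1 < q)
    (hT : FormBound p q T A) {f g : TestFun n m} {M L R M' L' R' : ℝ}
    (hf : LipBound f M L R) (hg : LipBound g M' L' R') :
    ∃ u : ℕ → ℝ, Tendsto u atTop (𝓝 0) ∧ ∀ (w : GridParam n) (N : ℕ),
      ‖T (TestFun.average w N f - TestFun.average w (-(N : ℤ)) f)
          (TestFun.average w N g - TestFun.average w (-(N : ℤ)) g) - T f g‖ ≤ u N := by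
  obtain ⟨u, hu, hu'⟩ := exists_lpNorm_average_sub_average_le hn hm hp hf
  obtain ⟨v, hv, hv'⟩ := exists_lpNorm_average_sub_average_le hn hm hq hg
  refine ⟨fun N => A * u N * TestFun.lpNorm q g + A * TestFun.lpNorm p f * v N + A * u N * v N,
    ?_, fun w N => ?_⟩
  · have h := (((hu.const_mul A).mul_const (TestFun.lpNorm q g)).add
      (hv.const_mul (A * TestFun.lpNorm p f))).add ((hu.const_mul A).mul hv)
    simpa using h
  · set x := TestFun.average w N f - TestFun.average w (-(N : ℤ)) f
    set y := TestFun.average w N g - TestFun.average w (-(N : ℤ)) g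
    have e : T x y - T f g = T (x - f) g + T f (y - g) + T (x - f) (y - g) := by
      simp only [map_sub, LinearMap.sub_apply]
      ring
    rw [e]
    refine norm_add₃_le.trans (add_le_add_three ?_ ?_ ?_)
    · exact norm_form_le hT (hu' w N) le_rfl
    · exact norm_form_le hT le_rfl (hv' w N)
    · exact norm_form_le hT (hu' w N) (hv' w N)

theorem norm_integral_le_of_forall {X : GridParam n → ℂ} {C : ℝ} (hC : ∀ w, ‖X w‖ ≤ C) :
    ‖∫ w, X w ∂(gridMeasure n)‖ ≤ C := by
  simpa using norm_integral_le_of_norm_le_const (μ := gridMeasure n) (Eventually.of_forall hC)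

/-- The two contributions to the sum of the scales where the smaller cubes have scale `k` and the
larger ones are summed up to averages. -/
noncomputable def mainPart (T : TestFun n m →ₗ[ℂ] TestFun n m →ₗ[ℂ] ℂ) (f g : TestFun n m)
    (k : ℤ) (G : Set (Fin n → ℤ)) (w : GridParam n) : ℂ :=
  T (TestFun.diff w k G f) (TestFun.average w (k + 1) g)
    + T (TestFun.average w k f) (TestFun.diff w k G g)

/-- The contributions of the averages over the cubes of the lowest scale `a`. -/
noncomputable def remainder (T : TestFun n m →ₗ[ℂ] TestFun n m →ₗ[ℂ] ℂ) (f g : TestFun n m)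
    (a k : ℤ) (G : Set (Fin n → ℤ)) (w : GridParam n) : ℂ :=
  T (TestFun.diff w k G f) (TestFun.average w a g)
    + T (TestFun.average w a f) (TestFun.diff w k G g)

theorem integrable_form_diff_goodSet_right (hp : 1 < p) (hp' : p ≠ ⊤) (hq : 1 < q) (hq' : q ≠ ⊤)
    (hT : FormBound p q T A) (δ : ℝ) (r : ℕ) (k : ℤ) (g : TestFun n m)
    {X : GridParam n → TestFun n m} (hX : TameFamily X) :
    Integrable (fun w => T (X w) (TestFun.diff w k (goodSet δ r w k) g)) (gridMeasure n) :=
  integrable_form_diff_goodSet hq hq' hp hp' hT.flip δ r k g hX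

theorem integral_form_diff_goodSet_right (hp : 1 < p) (hp' : p ≠ ⊤) (hq : 1 < q) (hq' : q ≠ ⊤)
    (hT : FormBound p q T A) (δ : ℝ) (r : ℕ) (k : ℤ) (g : TestFun n m)
    {X : GridParam n → TestFun n m} (hX : TameFamily X)
    (hX' : ∀ w w', (∀ i, k < i → w i = w' i) → X w = X w') :
    ∫ w, T (X w) (TestFun.diff w k (goodSet δ r w k) g) ∂(gridMeasure n)
      = goodProb n δ r * ∫ w, T (X w) (TestFun.diff w k univ g) ∂(gridMeasure n) :=
  integral_form_diff_goodSet hq hq' hp hp' hT.flip δ r k g hX hX'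

theorem integrable_mainPart_goodSet (hp : 1 < p) (hp' : p ≠ ⊤) (hq : 1 < q) (hq' : q ≠ ⊤)
    (hT : FormBound p q T A) (δ : ℝ) (r : ℕ) (f g : TestFun n m) (k : ℤ) :
    Integrable (fun w => mainPart T f g k (goodSet δ r w k) w) (gridMeasure n) :=
  (integrable_form_diff_goodSet hp hp' hq hq' hT δ r k f (TameFamily.average (k + 1) g)).add
    (integrable_form_diff_goodSet_right hp hp' hq hq' hT δ r k g (TameFamily.average k f))

theorem integrable_mainPart_univ (hp : 1 < p) (hp' : p ≠ ⊤) (hq : 1 < q) (hq' : q ≠ ⊤)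
    (hT : FormBound p q T A) (f g : TestFun n m) (k : ℤ) :
    Integrable (mainPart T f g k univ) (gridMeasure n) :=
  (integrable_form hp hp' hq hq' hT (TameFamily.diff k univ f) (TameFamily.average (k + 1) g)).add
    (integrable_form hp hp' hq hq' hT (TameFamily.average k f) (TameFamily.diff k univ g))

theorem integrable_remainder_goodSet (hp : 1 < p) (hp' : p ≠ ⊤) (hq : 1 < q) (hq' : q ≠ ⊤)
    (hT : FormBound p q T A) (δ : ℝ) (r : ℕ) (f g : TestFun n m) (a k : ℤ) :
    Integrable (fun w => remainder T f g a k (goodSet δ r w k) w) (gridMeasure n) :=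
  (integrable_form_diff_goodSet hp hp' hq hq' hT δ r k f (TameFamily.average a g)).add
    (integrable_form_diff_goodSet_right hp hp' hq hq' hT δ r k g (TameFamily.average a f))

theorem integrable_remainder_univ (hp : 1 < p) (hp' : p ≠ ⊤) (hq : 1 < q) (hq' : q ≠ ⊤)
    (hT : FormBound p q T A) (f g : TestFun n m) (a k : ℤ) :
    Integrable (remainder T f g a k univ) (gridMeasure n) :=
  (integrable_form hp hp' hq hq' hT (TameFamily.diff k univ f) (TameFamily.average a g)).add
    (integrable_form hp hp' hq hq' hT (TameFamily.average a f) (TameFamily.diff k univ g))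

theorem integral_mainPart_goodSet (hp : 1 < p) (hp' : p ≠ ⊤) (hq : 1 < q) (hq' : q ≠ ⊤)
    (hT : FormBound p q T A) (δ : ℝ) (r : ℕ) (f g : TestFun n m) (k : ℤ) :
    ∫ w, mainPart T f g k (goodSet δ r w k) w ∂(gridMeasure n)
      = goodProb n δ r * ∫ w, mainPart T f g k univ w ∂(gridMeasure n) := by
  simp only [mainPart]
  rw [integral_add
      (integrable_form_diff_goodSet hp hp' hq hq' hT δ r k f (TameFamily.average (k + 1) g))
      (integrable_form_diff_goodSet_right hp hp' hq hq' hT δ r k g (TameFamily.average k f)),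
    integral_add (integrable_form hp hp' hq hq' hT (TameFamily.diff k univ f)
        (TameFamily.average (k + 1) g))
      (integrable_form hp hp' hq hq' hT (TameFamily.average k f) (TameFamily.diff k univ g)),
    integral_form_diff_goodSet hp hp' hq hq' hT δ r k f (TameFamily.average (k + 1) g)
        fun w w' h => TestFun.average_congr (fun i hi => h i (by lia)) g,
    integral_form_diff_goodSet_right hp hp' hq hq' hT δ r k g (TameFamily.average k f)
        fun w w' h => TestFun.average_congr h f]
  ring

/-- `sum_scaleForm` is used twice: with good cubes, where `integral_mainPart_goodSet` extracts
`π_good`, and with all cubes in reverse. The right side collects the errors, all of which tend to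
`0` for `a = -N`, `b = N`. -/
theorem sum_integral_scaleForm_sub (hp : 1 < p) (hp' : p ≠ ⊤) (hq : 1 < q) (hq' : q ≠ ⊤)
    (hT : FormBound p q T A) (δ : ℝ) (r : ℕ) (f g : TestFun n m)
    (hi : ∀ k₁ k₂, Integrable (fun w => scaleForm T f g w (goodSet δ r w) k₁ k₂) (gridMeasure n))
    {a b : ℤ} (hab : a ≤ b) :
    ∑ K ∈ Finset.Ico a b ×ˢ Finset.Ico a b,
        ∫ w, scaleForm T f g w (goodSet δ r w) K.1 K.2 ∂(gridMeasure n) - goodProb n δ r * T f g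
      = goodProb n δ r * ∫ w, (T (TestFun.average w b f - TestFun.average w a f)
            (TestFun.average w b g - TestFun.average w a g) - T f g) ∂(gridMeasure n)
        + goodProb n δ r * ∫ w, ∑ k ∈ Finset.Ico a b, remainder T f g a k univ w ∂(gridMeasure n)
        - ∫ w, ∑ k ∈ Finset.Ico a b, remainder T f g a k (goodSet δ r w k) w ∂(gridMeasure n) := by
  have e1 : ∑ K ∈ Finset.Ico a b ×ˢ Finset.Ico a b,
      ∫ w, scaleForm T f g w (goodSet δ r w) K.1 K.2 ∂(gridMeasure n)
      = ∫ w, (∑ k ∈ Finset.Ico a b, mainPart T f g k (goodSet δ r w k) w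
          - ∑ k ∈ Finset.Ico a b, remainder T f g a k (goodSet δ r w k) w) ∂(gridMeasure n) := by
    rw [← integral_finsetSum (f := fun (K : ℤ × ℤ) w =>
      scaleForm T f g w (goodSet δ r w) K.1 K.2) _ fun K _ => hi K.1 K.2]
    refine integral_congr_ae (Eventually.of_forall fun w => ?_)
    beta_reduce
    rw [Finset.sum_product]
    exact sum_scaleForm f g w (goodSet δ r w) a b
  have e2 : ∀ w, ∑ k ∈ Finset.Ico a b, mainPart T f g k univ w
      = T (TestFun.average w b f - TestFun.average w a f)
            (TestFun.average w b g - TestFun.average w a g)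
        + ∑ k ∈ Finset.Ico a b, remainder T f g a k univ w := by
    intro w
    have h1 := sum_scaleForm (T := T) f g w (fun _ => univ) a b
    rw [sum_scaleForm_univ f g w hab] at h1
    rw [h1]
    simp only [mainPart, remainder, sub_add_cancel]
  have iT := integrable_form hp hp' hq hq' hT
      ((TameFamily.average b f).sub (TameFamily.average a f))
      ((TameFamily.average b g).sub (TameFamily.average a g))
  have iR := integrable_finsetSum (Finset.Ico a b) fun k _ =>
    integrable_remainder_univ hp hp' hq hq' hT f g a k
  rw [e1, integral_sub
    (integrable_finsetSum _ fun k _ => integrable_mainPart_goodSet hp hp' hq hq' hT δ r f g k)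
    (integrable_finsetSum _ fun k _ => integrable_remainder_goodSet hp hp' hq hq' hT δ r f g a k),
    integral_finsetSum _ fun k _ => integrable_mainPart_goodSet hp hp' hq hq' hT δ r f g k,
    Finset.sum_congr rfl fun k _ => integral_mainPart_goodSet hp hp' hq hq' hT δ r f g k,
    ← Finset.mul_sum,
    ← integral_finsetSum _ fun k _ => integrable_mainPart_univ hp hp' hq hq' hT f g k,
    integral_congr_ae (Eventually.of_forall e2), integral_add iT iR,
    integral_sub iT (integrable_const _)]
  simp only [integral_const, probReal_univ, one_smul]
  ring

/-- The one-parameter averaging formula. -/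
theorem hasSum_integral_scaleForm (hn : 0 < n) (hm : 0 < m) (hp : 1 < p) (hp' : p ≠ ⊤)
    (hq : 1 < q) (hq' : q ≠ ⊤) (hT : FormBound p q T A) {f g : TestFun n m}
    {M L R M' L' R' : ℝ} (hf : LipBound f M L R) (hg : LipBound g M' L' R') (δ : ℝ) (r : ℕ) :
    HasSum (fun K : ℤ × ℤ => ∫ w, scaleForm T f g w (goodSet δ r w) K.1 K.2 ∂(gridMeasure n))
      (goodProb n δ r * T f g) := by
  obtain ⟨C, hC⟩ := exists_norm_scaleForm_le hn hm hp hq hT hf hg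
  have hsum : Summable fun K : ℤ × ℤ =>
      ∫ w, scaleForm T f g w (goodSet δ r w) K.1 K.2 ∂(gridMeasure n) := by
    refine Summable.of_norm_bounded (((TestFun.summable_weight hp).mul_of_nonneg
      (TestFun.summable_weight hq) (TestFun.weight_nonneg p)
      (TestFun.weight_nonneg q)).mul_left C) fun K => ?_
    exact norm_integral_le_of_forall fun w => hC w _ _ _
  -- Absolute convergence provides some sum `c`; its value is then identified along the squares
  -- `[-N, N) × [-N, N)`.
  obtain ⟨c, hc⟩ := hsum
  have hsq : Tendsto (fun N : ℕ => Finset.Ico (-(N : ℤ)) N ×ˢ Finset.Ico (-(N : ℤ)) N)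
      atTop atTop := by
    refine Monotone.tendsto_atTop_finset (fun N N' h => ?_) fun K => ?_
    · have : Finset.Ico (-(N : ℤ)) N ⊆ Finset.Ico (-(N' : ℤ)) N' :=
        Finset.Ico_subset_Ico (by lia) (by lia)
      exact Finset.product_subset_product this this
    · refine ⟨K.1.natAbs + K.2.natAbs + 1, ?_⟩
      simp only [Finset.mem_product, Finset.mem_Ico]
      lia
  obtain ⟨D, hD⟩ := exists_norm_sum_form_average_le hn hm hp hq hT hf hg
  obtain ⟨u, hu, hu'⟩ := exists_norm_form_average_sub_le hn hm hp hq hT hf hg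
  have hi : ∀ k₁ k₂, Integrable (fun w => scaleForm T f g w (goodSet δ r w) k₁ k₂)
      (gridMeasure n) := fun k₁ k₂ => integrable_of_norm_le
    (measurable_scaleForm hp hp' hq hq' hT δ r f g k₁ k₂) fun w => hC w _ _ _
  have hzero : Tendsto (fun N : ℕ => ∑ K ∈ Finset.Ico (-(N : ℤ)) N ×ˢ Finset.Ico (-(N : ℤ)) N,
      ∫ w, scaleForm T f g w (goodSet δ r w) K.1 K.2 ∂(gridMeasure n)) atTop
        (𝓝 (goodProb n δ r * T f g)) := by
    rw [tendsto_iff_norm_sub_tendsto_zero]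
    have hdec := ((TestFun.tendsto_decay_neg hp).add (TestFun.tendsto_decay_neg hq)).const_mul D
    have hlim := ((hu.const_mul ‖(goodProb n δ r : ℂ)‖).add
      (hdec.const_mul ‖(goodProb n δ r : ℂ)‖)).add hdec
    simp only [add_zero, mul_zero] at hlim
    refine squeeze_zero (fun _ => norm_nonneg _) (fun N => ?_) hlim
    rw [sum_integral_scaleForm_sub hp hp' hq hq' hT δ r f g hi (by lia)]
    refine (norm_sub_le _ _).trans (add_le_add ((norm_add_le _ _).trans (add_le_add ?_ ?_)) ?_)
    · rw [norm_mul]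
      exact mul_le_mul_of_nonneg_left (norm_integral_le_of_forall fun w => hu' w N) (norm_nonneg _)
    · rw [norm_mul]
      exact mul_le_mul_of_nonneg_left
        (norm_integral_le_of_forall fun w => hD w (fun _ => univ) N) (norm_nonneg _)
    · exact norm_integral_le_of_forall fun w => hD w (goodSet δ r w) N
  rw [← tendsto_nhds_unique (hc.comp hsq) hzero]
  exact hc

end OneParameter

/-! ### Haar expansions in two parameters. -/

namespace TestFun

theorem integrable_haar_mul_snd (v : GridParam m) (J : DyadicCube m) (θ : Fin m → Bool)
    (f : TestFun n m) :
    Integrable fun x : Space n m => (haar v J θ x.2 : ℂ) * (f : Space n m → ℂ) x := by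
  refine (integrable f).bdd_mul (c := ((√J.side)⁻¹ * 2) ^ m)
    (Complex.measurable_ofReal.comp ((measurable_haar v J θ).comp
      measurable_snd)).aestronglyMeasurable (Eventually.of_forall fun x => ?_)
  rw [Complex.norm_real]
  exact abs_haar_le v J θ x.2

theorem pairing_haarTensor (w : GridParam n) (v : GridParam m) (I : DyadicCube n)
    (η : Fin n → Bool) (J : DyadicCube m) (θ : Fin m → Bool) (f : TestFun n m) :
    pairing f (haarTensor w v I η J θ)
      = ∫ x, (haar w I η x : ℂ) * ∫ y, (haar v J θ y : ℂ) * (f : Space n m → ℂ) (x, y) := by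
  have hi : Integrable fun x : Space n m =>
      (haar w I η x.1 : ℂ) * ((haar v J θ x.2 : ℂ) * (f : Space n m → ℂ) x) := by
    refine (integrable_haar_mul_snd v J θ f).bdd_mul (c := ((√I.side)⁻¹ * 2) ^ n)
      (Complex.measurable_ofReal.comp ((measurable_haar w I η).comp
        measurable_fst)).aestronglyMeasurable (Eventually.of_forall fun x => ?_)
    rw [Complex.norm_real]
    exact abs_haar_le w I η x.1
  rw [Measure.volume_eq_prod] at hi
  calc pairing f (haarTensor w v I η J θ)
      = ∫ x : Space n m, (haar w I η x.1 : ℂ) * ((haar v J θ x.2 : ℂ) * (f : Space n m → ℂ) x) := by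
        refine integral_congr_ae (Eventually.of_forall fun x => ?_)
        simp only [haarTensor]
        ring
    _ = _ := by
        rw [Measure.volume_eq_prod, integral_prod _ hi]
        simp only [integral_const_mul]

/-- The Haar expansion of the bi-parameter martingale difference on a pair of cubes. -/
theorem sum_pairing_smul_haarTensor (w : GridParam n) (v : GridParam m) (I : DyadicCube n)
    (J : DyadicCube m) (f : TestFun n m) :
    ∑ η : CancIndex n, ∑ θ : CancIndex m,
        pairing f (haarTensor w v I η J θ) • haarTensor w v I η J θ
      = diff w I.scale {I.pos} (diffSnd v J.scale {J.pos} f) := by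
  classical
  ext x
  have hB : ∀ θ : Fin m → Bool, Integrable fun x' : Fin n → ℝ =>
      ∫ y, (haar v J θ y : ℂ) * (f : Space n m → ℂ) (x', y) := fun θ => by
    have := integrable_haar_mul_snd v J θ f
    rw [Measure.volume_eq_prod] at this
    exact this.integral_prod_left
  have e1 : ∀ x' : Fin n → ℝ, (diffSnd v J.scale {J.pos} f : Space n m → ℂ) (x', x.2)
      = ∑ θ : CancIndex m, (haar v J θ x.2 : ℂ) *
        ∫ y, (haar v J θ y : ℂ) * (f : Space n m → ℂ) (x', y) := by
    intro x'
    refine Eq.trans ?_ (sum_haar_mul_integral v J (integrable_slice (swap n m f) x') x.2).symm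
    rw [diffSnd_apply]
    simp only [mem_singleton_iff]
    split_ifs <;> rfl
  rw [diff_apply]
  simp only [mem_singleton_iff]
  rw [← sum_haar_mul_integral w I (integrable_slice _ x.2), Submodule.coe_sum, Finset.sum_apply]
  refine Finset.sum_congr rfl fun η _ => ?_
  simp only [e1, Finset.mul_sum]
  rw [integral_finsetSum (f := fun (θ : CancIndex m) x' => (haar w I η x' : ℂ) *
    ((haar v J θ x.2 : ℂ) * ∫ y, (haar v J θ y : ℂ) * (f : Space n m → ℂ) (x', y))) _
    fun θ _ => integrable_haar_mul w I η ((hB θ).const_mul _), Submodule.coe_sum,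
    Finset.sum_apply, Finset.mul_sum]
  refine Finset.sum_congr rfl fun θ _ => ?_
  simp only [Submodule.coe_smul, Pi.smul_apply, smul_eq_mul, haarTensor]
  have e2 : ∀ x' : Fin n → ℝ, (haar w I η x' : ℂ) * ((haar v J θ x.2 : ℂ) *
      ∫ y, (haar v J θ y : ℂ) * (f : Space n m → ℂ) (x', y))
      = (haar v J θ x.2 : ℂ) * ((haar w I η x' : ℂ) *
      ∫ y, (haar v J θ y : ℂ) * (f : Space n m → ℂ) (x', y)) := fun x' => by ring
  simp only [e2, integral_const_mul]
  have e3 := pairing_haarTensor w v I η J θ f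
  simp only [haarTensor] at e3
  rw [e3]
  ring

-- The restriction in the second variable is constant in `x.1`, so it commutes with the martingale
-- difference in the first.
open scoped Classical in
theorem diff_diffSnd_apply (w : GridParam n) (v : GridParam m) (k l : ℤ) (G : Set (Fin n → ℤ))
    (H : Set (Fin m → ℤ)) (f : TestFun n m) (x : Space n m) :
    (diff w k G (diffSnd v l H f) : Space n m → ℂ) x
      = if idx w k x.1 ∈ G ∧ idx v l x.2 ∈ H then
          (diff w k univ (diffSnd v l univ f) : Space n m → ℂ) x else 0 := by
  have h0 : dif w k (fun _ => (0 : ℂ)) x.1 = 0 := by simp [dif, avg]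
  simp only [diff_apply, diffSnd_apply, mem_univ, if_true]
  by_cases h1 : idx w k x.1 ∈ G <;> by_cases h2 : idx v l x.2 ∈ H <;> simp [h1, h2, h0]

open scoped Classical in
theorem diff_diffSnd_eq_sum {f : TestFun n m} {R : ℝ}
    (hR : ∀ x, (f : Space n m → ℂ) x ≠ 0 → ‖x.1‖ ≤ R ∧ ‖x.2‖ ≤ R) (w : GridParam n)
    (v : GridParam m) (k l : ℤ) (G : Set (Fin n → ℤ)) (H : Set (Fin m → ℤ)) :
    diff w k G (diffSnd v l H f)
      = ∑ p ∈ window n k (R + 2 ^ (-k)), ∑ q ∈ window m l (R + 2 ^ (-l)),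
        ((if p ∈ G then (1 : ℂ) else 0) * (if q ∈ H then (1 : ℂ) else 0)) •
          diff w k {p} (diffSnd v l {q} f) := by
  ext x
  simp only [Submodule.coe_sum, Finset.sum_apply, Submodule.coe_smul, Pi.smul_apply, smul_eq_mul]
  simp only [diff_diffSnd_apply w v k l {_}, diff_diffSnd_apply w v k l G, mem_singleton_iff]
  by_cases hx : (diff w k univ (diffSnd v l univ f) : Space n m → ℂ) x = 0
  · simp [hx]
  · have hs : ∀ x, (diffSnd v l univ f : Space n m → ℂ) x ≠ 0 → ‖x.1‖ ≤ R ∧ ‖x.2‖ ≤ R + 2 ^ (-l) :=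
      fun x hx => (support_diff (f := swap n m f) (fun x hx => (hR x.swap hx).symm)
        v l univ x.swap hx).symm
    have h := support_diff hs w k univ x hx
    rw [Finset.sum_eq_single_of_mem _ (idx_mem_window w k h.1) fun p _ hp => by simp [hp.symm],
      Finset.sum_eq_single_of_mem _ (idx_mem_window v l h.2) fun p _ hp => by simp [hp.symm]]
    by_cases h1 : idx w k x.1 ∈ G <;> by_cases h2 : idx v l x.2 ∈ H <;> simp [h1, h2]

theorem diff_diffSnd_singleton_eq_zero {f : TestFun n m} {R : ℝ}
    (hR : ∀ x, (f : Space n m → ℂ) x ≠ 0 → ‖x.1‖ ≤ R ∧ ‖x.2‖ ≤ R) (w : GridParam n)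
    (v : GridParam m) (k l : ℤ) {p : Fin n → ℤ} {q : Fin m → ℤ}
    (h : ¬ (p ∈ window n k (R + 2 ^ (-k)) ∧ q ∈ window m l (R + 2 ^ (-l)))) :
    diff w k {p} (diffSnd v l {q} f) = 0 := by
  classical
  rw [diff_diffSnd_eq_sum hR]
  refine Finset.sum_eq_zero fun p' hp' => Finset.sum_eq_zero fun q' hq' => ?_
  have : ¬ (p' = p ∧ q' = q) := by
    rintro ⟨rfl, rfl⟩
    exact h ⟨hp', hq'⟩
  rw [not_and_or] at this
  rcases this with h | h <;> simp [h]

/-- The only place where smoothness enters: a compactly supported `C¹` function is Lipschitz, with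
one constant for both variables in the maximum norm of the product. -/
theorem exists_lipBound (f : TestFun n m) (hf : ContDiff ℝ 1 (f : Space n m → ℂ)) :
    ∃ M L R, LipBound f M L R ∧ LipBound (swap n m f) M L R := by
  obtain ⟨M, R, hM0, hR0, hM, hR⟩ := exists_bound f
  have hc : HasCompactSupport (f : Space n m → ℂ) := f.2.2.2.isCompact_closure
  obtain ⟨L, hL⟩ := hf.lipschitzWith_of_hasCompactSupport hc one_ne_zero
  refine ⟨M, L, R, ⟨hM0, L.2, hR0, hM, hR, fun x x' y => ?_⟩,
    ⟨hM0, L.2, hR0, fun x => hM x.swap, fun x hx => (hR x.swap hx).symm, fun x x' y => ?_⟩⟩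
  · refine (hL.norm_sub_le (x, y) (x', y)).trans_eq ?_
    rw [Prod.mk_sub_mk, sub_self, Prod.norm_mk, norm_zero, max_eq_left (norm_nonneg _)]
  · refine (hL.norm_sub_le (y, x) (y, x')).trans_eq ?_
    rw [Prod.mk_sub_mk, sub_self, Prod.norm_mk, norm_zero, max_eq_right (norm_nonneg _)]

end TestFun

/-! ### Iteration of the one-parameter formula. -/

/-- The form with the two variables interchanged. -/
noncomputable def swapForm (T : TestFun n m →ₗ[ℂ] TestFun n m →ₗ[ℂ] ℂ) :
    TestFun m n →ₗ[ℂ] TestFun m n →ₗ[ℂ] ℂ :=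
  T.compl₁₂ (TestFun.swap m n) (TestFun.swap m n)

theorem FormBound.swapForm {p q : ℝ≥0∞} {T : TestFun n m →ₗ[ℂ] TestFun n m →ₗ[ℂ] ℂ} {A : ℝ}
    (hT : FormBound p q T A) : FormBound p q (swapForm T) A :=
  ⟨hT.1, fun f g => by
    have := hT.2 (TestFun.swap m n f) (TestFun.swap m n g)
    rwa [TestFun.lpNorm_swap, TestFun.lpNorm_swap] at this⟩

section BiParameter

variable {p q : ℝ≥0∞} {T : TestFun n m →ₗ[ℂ] TestFun n m →ₗ[ℂ] ℂ} {A : ℝ}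

-- Writes the goodness factor as separate restrictions of the two positions, one of them void, in
-- the shape used by `scaleForm`.
open scoped Classical in
theorem goodInd_smaller (δ : ℝ) (r : ℕ) (w : GridParam n) (k₁ k₂ : ℤ) (p₁ p₂ : Fin n → ℤ) :
    goodInd δ r w ((⟨k₁, p₁⟩ : DyadicCube n).smaller ⟨k₂, p₂⟩)
      = (if p₁ ∈ (if k₂ ≤ k₁ then goodSet δ r w k₁ else univ) then (1 : ℂ) else 0)
        * (if p₂ ∈ (if k₂ ≤ k₁ then univ else goodSet δ r w k₂) then (1 : ℂ) else 0) := by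
  have h : (⟨k₁, p₁⟩ : DyadicCube n).side ≤ (⟨k₂, p₂⟩ : DyadicCube n).side ↔ k₂ ≤ k₁ := by
    rw [DyadicCube.side, DyadicCube.side, zpow_le_zpow_iff_right₀ one_lt_two, neg_le_neg_iff]
  by_cases hk : k₂ ≤ k₁
  · rw [DyadicCube.smaller, if_pos (h.2 hk)]
    by_cases hg : IsGood δ r w ⟨k₁, p₁⟩ <;> simp [goodInd, goodSet, hk, hg]
  · rw [DyadicCube.smaller, if_neg (fun h' => hk (h.1 h'))]
    by_cases hg : IsGood δ r w ⟨k₂, p₂⟩ <;> simp [goodInd, goodSet, hk, hg]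

theorem map_sum_smul_sum_smul {ι ι' κ κ' : Type*} (T : TestFun n m →ₗ[ℂ] TestFun n m →ₗ[ℂ] ℂ)
    (s : Finset ι) (s' : Finset ι') (t : Finset κ) (t' : Finset κ') (a : ι → κ → ℂ)
    (b : ι' → κ' → ℂ) (x : ι → κ → TestFun n m) (y : ι' → κ' → TestFun n m) :
    (T (∑ i ∈ s, ∑ j ∈ t, a i j • x i j) (∑ i ∈ s', ∑ j ∈ t', b i j • y i j) : ℂ)
      = ∑ i ∈ s, ∑ i' ∈ s', ∑ j ∈ t, ∑ j' ∈ t', a i j * b i' j' * T (x i j) (y i' j') := by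
  rw [LinearMap.map_sum₂ T]
  refine Finset.sum_congr rfl fun i _ => ?_
  rw [LinearMap.map_sum₂ T]
  refine Eq.trans ?_ Finset.sum_comm
  refine Finset.sum_congr rfl fun j _ => ?_
  rw [map_sum (T (a i j • x i j))]
  refine Finset.sum_congr rfl fun i' _ => ?_
  rw [map_sum (T (a i j • x i j))]
  refine Finset.sum_congr rfl fun j' _ => ?_
  simp only [map_smul, LinearMap.smul_apply, smul_eq_mul]
  ring

theorem scaleTerm_eq (δ : ℝ) (r : ℕ) (f g : TestFun n m) (w : GridParam n) (v : GridParam m)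
    (K : ℤ × ℤ × ℤ × ℤ) (P : (Fin n → ℤ) × (Fin n → ℤ) × (Fin m → ℤ) × (Fin m → ℤ)) :
    scaleTerm δ r T f g w v K P
      = goodInd δ r w ((⟨K.1, P.1⟩ : DyadicCube n).smaller ⟨K.2.1, P.2.1⟩)
        * goodInd δ r v ((⟨K.2.2.1, P.2.2.1⟩ : DyadicCube m).smaller ⟨K.2.2.2, P.2.2.2⟩)
        * T (TestFun.diff w K.1 {P.1} (TestFun.diffSnd v K.2.2.1 {P.2.2.1} f))
          (TestFun.diff w K.2.1 {P.2.1} (TestFun.diffSnd v K.2.2.2 {P.2.2.2} g)) := by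
  have h1 := TestFun.sum_pairing_smul_haarTensor w v ⟨K.1, P.1⟩ ⟨K.2.2.1, P.2.2.1⟩ f
  have h2 := TestFun.sum_pairing_smul_haarTensor w v ⟨K.2.1, P.2.1⟩ ⟨K.2.2.2, P.2.2.2⟩ g
  simp only at h1 h2
  rw [← h1, ← h2, scaleTerm, averagingTerm]
  rw [map_sum_smul_sum_smul]
  refine congrArg₂ (· * ·) rfl ?_
  refine Finset.sum_congr rfl fun η₁ _ => Finset.sum_congr rfl fun η₂ _ =>
    Finset.sum_congr rfl fun θ₁ _ => Finset.sum_congr rfl fun θ₂ _ => ?_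
  ring

/-- The finite sets depend only on the supports of `f` and `g` and on the scales, not on the grids;
this turns `scaleSum` into one fixed finite sum, for its measurability and for `scaleSum_eq`. -/
theorem exists_support_scaleTerm_subset (f g : TestFun n m) (K : ℤ × ℤ × ℤ × ℤ) :
    ∃ (W₁ W₂ : Finset (Fin n → ℤ)) (V₁ V₂ : Finset (Fin m → ℤ)),
      (∀ (w : GridParam n) (v : GridParam m) (G : Set (Fin n → ℤ)) (H : Set (Fin m → ℤ)),
        TestFun.diff w K.1 G (TestFun.diffSnd v K.2.2.1 H f)
          = ∑ p ∈ W₁, ∑ q ∈ V₁, ((G.indicator 1 p : ℂ) * (H.indicator 1 q : ℂ)) •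
            TestFun.diff w K.1 {p} (TestFun.diffSnd v K.2.2.1 {q} f)) ∧
      (∀ (w : GridParam n) (v : GridParam m) (G : Set (Fin n → ℤ)) (H : Set (Fin m → ℤ)),
        TestFun.diff w K.2.1 G (TestFun.diffSnd v K.2.2.2 H g)
          = ∑ p ∈ W₂, ∑ q ∈ V₂, ((G.indicator 1 p : ℂ) * (H.indicator 1 q : ℂ)) •
            TestFun.diff w K.2.1 {p} (TestFun.diffSnd v K.2.2.2 {q} g)) ∧
      ∀ (T : TestFun n m →ₗ[ℂ] TestFun n m →ₗ[ℂ] ℂ) (δ : ℝ) (r : ℕ) (w : GridParam n)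
        (v : GridParam m), Function.support (scaleTerm δ r T f g w v K)
          ⊆ (W₁ ×ˢ W₂ ×ˢ V₁ ×ˢ V₂ : Finset _) := by
  classical
  obtain ⟨M, R, _, _, _, hR⟩ := TestFun.exists_bound f
  obtain ⟨M', R', _, _, _, hR'⟩ := TestFun.exists_bound g
  refine ⟨window n K.1 (R + 2 ^ (-K.1)), window n K.2.1 (R' + 2 ^ (-K.2.1)),
    window m K.2.2.1 (R + 2 ^ (-K.2.2.1)), window m K.2.2.2 (R' + 2 ^ (-K.2.2.2)),
    fun w v G H => ?_, fun w v G H => ?_, fun T δ r w v P hP => ?_⟩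
  · simp only [indicator_apply, Pi.one_apply]
    exact TestFun.diff_diffSnd_eq_sum hR w v _ _ G H
  · simp only [indicator_apply, Pi.one_apply]
    exact TestFun.diff_diffSnd_eq_sum hR' w v _ _ G H
  · rw [Function.mem_support, scaleTerm_eq] at hP
    have h1 : P.1 ∈ window n K.1 (R + 2 ^ (-K.1)) ∧
        P.2.2.1 ∈ window m K.2.2.1 (R + 2 ^ (-K.2.2.1)) := by
      by_contra h
      rw [TestFun.diff_diffSnd_singleton_eq_zero hR w v _ _ h] at hP
      simp at hP
    have h2 : P.2.1 ∈ window n K.2.1 (R' + 2 ^ (-K.2.1)) ∧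
        P.2.2.2 ∈ window m K.2.2.2 (R' + 2 ^ (-K.2.2.2)) := by
      by_contra h
      rw [TestFun.diff_diffSnd_singleton_eq_zero hR' w v _ _ h] at hP
      simp at hP
    simp only [Finset.mem_coe, Finset.mem_product]
    exact ⟨h1.1, h2.1, h1.2, h2.2⟩

open scoped Classical in
/-- The sum over all cubes of given scales, in terms of martingale differences. -/
theorem scaleSum_eq (δ : ℝ) (r : ℕ) (f g : TestFun n m) (w : GridParam n) (v : GridParam m)
    (K : ℤ × ℤ × ℤ × ℤ) :
    scaleSum δ r T f g w v K = scaleForm T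
      (TestFun.diffSnd v K.2.2.1
        (if K.2.2.2 ≤ K.2.2.1 then goodSet δ r v K.2.2.1 else univ) f)
      (TestFun.diffSnd v K.2.2.2
        (if K.2.2.2 ≤ K.2.2.1 then univ else goodSet δ r v K.2.2.2) g)
      w (goodSet δ r w) K.1 K.2.1 := by
  obtain ⟨W₁, W₂, V₁, V₂, h1, h2, h3⟩ := exists_support_scaleTerm_subset f g K
  rw [scaleSum, tsum_eq_sum (s := W₁ ×ˢ W₂ ×ˢ V₁ ×ˢ V₂) fun P hP => by
    by_contra h
    exact hP (h3 T δ r w v h)]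
  rw [scaleForm, h1, h2, map_sum_smul_sum_smul]
  simp only [Finset.sum_product]
  refine Finset.sum_congr rfl fun p₁ _ => Finset.sum_congr rfl fun p₂ _ =>
    Finset.sum_congr rfl fun q₁ _ => Finset.sum_congr rfl fun q₂ _ => ?_
  rw [scaleTerm_eq, goodInd_smaller, goodInd_smaller]
  simp only [indicator_apply, Pi.one_apply]
  ring

theorem measurable_scaleSum (hp : 1 < p) (hp' : p ≠ ⊤) (hq : 1 < q) (hq' : q ≠ ⊤)
    (hT : FormBound p q T A) (δ : ℝ) (r : ℕ) (f g : TestFun n m) (K : ℤ × ℤ × ℤ × ℤ) :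
    Measurable fun x : GridParam n × GridParam m => scaleSum δ r T f g x.1 x.2 K := by
  obtain ⟨W₁, W₂, V₁, V₂, _, _, h3⟩ := exists_support_scaleTerm_subset f g K
  have e : (fun x : GridParam n × GridParam m => scaleSum δ r T f g x.1 x.2 K)
      = fun x => ∑ P ∈ W₁ ×ˢ W₂ ×ˢ V₁ ×ˢ V₂, scaleTerm δ r T f g x.1 x.2 K P := by
    funext x
    rw [scaleSum, tsum_eq_sum fun P hP => ?_]
    by_contra h
    exact hP (h3 T δ r x.1 x.2 h)
  rw [e]
  refine Finset.measurable_fun_sum _ fun P _ => ?_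
  unfold scaleTerm averagingTerm
  refine Measurable.mul ?_ ?_
  · exact ((measurable_goodInd δ r _).comp measurable_fst).mul
      ((measurable_goodInd δ r _).comp measurable_snd)
  · refine Finset.measurable_fun_sum _ fun η₁ _ => Finset.measurable_fun_sum _ fun η₂ _ =>
      Finset.measurable_fun_sum _ fun θ₁ _ => Finset.measurable_fun_sum _ fun θ₂ _ => ?_
    have t1 := TameFamily.haarTensor ⟨K.1, P.1⟩ η₁ ⟨K.2.2.1, P.2.2.1⟩ θ₁
    have t2 := TameFamily.haarTensor ⟨K.2.1, P.2.1⟩ η₂ ⟨K.2.2.2, P.2.2.2⟩ θ₂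
    exact ((t1.continuous_form t2 hp hp' hq hq' hT).measurable.mul
      (continuous_pairing t1 f).measurable).mul (continuous_pairing t2 g).measurable

theorem exists_norm_scaleSum_le (hn : 0 < n) (hm : 0 < m) (hp : 1 < p) (hq : 1 < q)
    (hT : FormBound p q T A) (δ : ℝ) (r : ℕ) {f g : TestFun n m} {M L R M' L' R' : ℝ}
    (hf : LipBound f M L R) (hf' : LipBound (TestFun.swap n m f) M L R)
    (hg : LipBound g M' L' R') (hg' : LipBound (TestFun.swap n m g) M' L' R') :
    ∃ B : ℤ × ℤ × ℤ × ℤ → ℝ, Summable B ∧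
      ∀ w v K, ‖scaleSum δ r T f g w v K‖ ≤ B K := by
  obtain ⟨C, hC⟩ := TestFun.lpNorm_diff_diffSnd_le hn hm hp hf hf'
  obtain ⟨D, hD⟩ := TestFun.lpNorm_diff_diffSnd_le hn hm hq hg hg'
  have sp := TestFun.summable_weight hp
  have sq := TestFun.summable_weight hq
  have np := TestFun.weight_nonneg p
  have nq := TestFun.weight_nonneg q
  have s1 := sp.mul_of_nonneg sq np nq
  have n1 : 0 ≤ fun x : ℤ × ℤ => TestFun.weight p x.1 * TestFun.weight q x.2 :=
    fun x => mul_nonneg (np _) (nq _)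
  have s2 := sq.mul_of_nonneg s1 nq n1
  have s3 := sp.mul_of_nonneg s2 np fun x => mul_nonneg (nq _) (n1 _)
  refine ⟨_, s3.mul_left (A * C * D), fun w v K => ?_⟩
  classical
  rw [scaleSum_eq, scaleForm]
  refine (norm_form_le hT (hC _ _ _ _ _ _) (hD _ _ _ _ _ _)).trans_eq ?_
  ring

/-- For fixed `v` the scales in `ℝᵐ` are frozen and the formula in `ℝⁿ` is applied to `diffSnd` of
`f` and `g`; these are again Lipschitz in the first variable, with constants that may depend on the
frozen scales. -/
theorem integral_gridSum (hn : 0 < n) (hm : 0 < m) (hp : 1 < p) (hp' : p ≠ ⊤) (hq : 1 < q)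
    (hq' : q ≠ ⊤) (hT : FormBound p q T A) (δ : ℝ) (r : ℕ) {f g : TestFun n m}
    {M L R M' L' R' : ℝ}
    (hf : LipBound f M L R) (hf' : LipBound (TestFun.swap n m f) M L R)
    (hg : LipBound g M' L' R') (hg' : LipBound (TestFun.swap n m g) M' L' R') :
    ∫ v, (∫ w, gridSum δ r T f g w v ∂(gridMeasure n)) ∂(gridMeasure m)
      = goodProb n δ r * (goodProb m δ r * T f g) := by
  classical
  obtain ⟨B, hB, hB'⟩ := exists_norm_scaleSum_le hn hm hp hq hT δ r hf hf' hg hg'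
  have hms := measurable_scaleSum hp hp' hq hq' hT δ r f g
  have inner : ∀ v, ∫ w, gridSum δ r T f g w v ∂(gridMeasure n) = goodProb n δ r *
      ∑' L : ℤ × ℤ, scaleForm (swapForm T) (TestFun.swap n m f) (TestFun.swap n m g) v
        (goodSet δ r v) L.1 L.2 := by
    intro v
    have hmv : ∀ K, Measurable fun w => scaleSum δ r T f g w v K := fun K => by
      have := (hms K).comp (measurable_prodMk_right (y := v))
      simpa only [Function.comp_def] using this
    have hi : ∀ K, Integrable (fun w => scaleSum δ r T f g w v K) (gridMeasure n) := fun K =>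
      integrable_of_norm_le (hmv K) fun w => hB' w v K
    have h1 := hasSum_integral_of_summable_integral_norm hi
      (Summable.of_nonneg_of_le (fun K => integral_nonneg fun w => norm_nonneg _) (fun K => by
        refine (integral_mono (hi K).norm (integrable_const (B K)) fun w => hB' w v K).trans_eq ?_
        simp) hB)
    -- Puts the scales in `ℝᵐ` outside and those in `ℝⁿ` inside, so that each fibre is a
    -- one-parameter sum.
    let e : (ℤ × ℤ) × (ℤ × ℤ) ≃ ℤ × ℤ × ℤ × ℤ :=
      { toFun := fun x => (x.2.1, x.2.2, x.1.1, x.1.2)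
        invFun := fun K => ((K.2.2.1, K.2.2.2), (K.1, K.2.1))
        left_inv := fun _ => rfl
        right_inv := fun _ => rfl }
    have h2 := e.hasSum_iff.2 h1
    have h3 : HasSum (fun L : ℤ × ℤ => (goodProb n δ r : ℂ) * scaleForm (swapForm T)
        (TestFun.swap n m f) (TestFun.swap n m g) v (goodSet δ r v) L.1 L.2) _ :=
      h2.prod_fiberwise fun L => by
        have b1 := (TestFun.diffSnd_bound hf hf' v L.1
          (if L.2 ≤ L.1 then goodSet δ r v L.1 else univ)).1
        have b2 := (TestFun.diffSnd_bound hg hg' v L.2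
          (if L.2 ≤ L.1 then univ else goodSet δ r v L.2)).1
        have h4 := hasSum_integral_scaleForm hn hm hp hp' hq hq' hT b1 b2 δ r
        simp only [Function.comp_def, scaleSum_eq]
        -- With the variables interchanged, `T` at the two second-variable differences is by
        -- definition `scaleForm (swapForm T)`.
        exact h4
    exact h3.tsum_eq.symm.trans tsum_mul_left
  simp only [inner]
  have hT' := hT.swapForm
  have hms' := fun L : ℤ × ℤ => measurable_scaleForm hp hp' hq hq' hT' δ r
    (TestFun.swap n m f) (TestFun.swap n m g) L.1 L.2
  obtain ⟨C, hC⟩ := exists_norm_scaleForm_le hm hn hp hq hT' hf' hg'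
  have hs := (((TestFun.summable_weight hp).mul_of_nonneg (TestFun.summable_weight hq)
    (TestFun.weight_nonneg p) (TestFun.weight_nonneg q))).mul_left C
  have hi := fun L : ℤ × ℤ => integrable_of_norm_le (hms' L) fun v => hC v (goodSet δ r v) L.1 L.2
  have h1 := hasSum_integral_of_summable_integral_norm hi
    (Summable.of_nonneg_of_le (fun K => integral_nonneg fun w => norm_nonneg _) (fun L => by
      refine (integral_mono (hi L).norm (integrable_const _)
        fun v => hC v (goodSet δ r v) L.1 L.2).trans_eq ?_
      simp) hs)
  rw [integral_const_mul, h1.unique (hasSum_integral_scaleForm hm hn hp hp' hq hq' hT' hf' hg' δ r)]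
  rfl

end BiParameter

end BiHaar

theorem mainTheorem3 {n m : ℕ} (hn : 0 < n) (hm : 0 < m) (δ : ℝ) (hδ : 0 < δ) (r : ℕ)
    (hπn : 0 < goodProb n δ r) (hπm : 0 < goodProb m δ r)
    (p q : ℝ≥0∞) (hp : 1 < p) (hp' : p ≠ ⊤) (hq : 1 < q) (hq' : q ≠ ⊤)
    (T : TestFun n m →ₗ[ℂ] TestFun n m →ₗ[ℂ] ℂ) (A : ℝ)
    (hT : ∀ f g : TestFun n m, ‖T f g‖ ≤
      A * (eLpNorm (f : Space n m → ℂ) p volume).toReal *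
        (eLpNorm (g : Space n m → ℂ) q volume).toReal)
    (f g : TestFun n m)
    (hf : ContDiff ℝ 1 (f : Space n m → ℂ)) (hg : ContDiff ℝ 1 (g : Space n m → ℂ)) :
    -- the probability of being good does not depend on the cube
    (∀ I : DyadicCube n, (gridMeasure n).real {w | IsGood δ r w I} = goodProb n δ r) ∧
    (∀ J : DyadicCube m, (gridMeasure m).real {v | IsGood δ r v J} = goodProb m δ r) ∧
    -- for fixed grids and fixed scales of the four cubes, only finitely many terms are not zero
    (∀ w v K, (Function.support (scaleTerm δ r T f g w v K)).Finite) ∧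
    -- for fixed grids, the sum over the scales converges absolutely
    (∀ w v, Summable (scaleSum δ r T f g w v)) ∧
    -- the sum is an integrable random variable
    Integrable (fun x : GridParam n × GridParam m => gridSum δ r T f g x.1 x.2)
      ((gridMeasure n).prod (gridMeasure m)) ∧
    -- the averaging formula
    T f g = 1 / ((goodProb n δ r : ℂ) * (goodProb m δ r : ℂ)) *
      ∫ w, (∫ v, gridSum δ r T f g w v ∂(gridMeasure m)) ∂(gridMeasure n) := by
  -- The sign of `A` is not prescribed, whereas `FormBound` requires a nonnegative constant.
  have hT' : FormBound p q T |A| := ⟨abs_nonneg A, fun f g => (hT f g).trans <|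
    mul_le_mul_of_nonneg_right (mul_le_mul_of_nonneg_right (le_abs_self A)
      ENNReal.toReal_nonneg) ENNReal.toReal_nonneg⟩
  obtain ⟨M, L, R, hf₁, hf₂⟩ := TestFun.exists_lipBound f hf
  obtain ⟨M', L', R', hg₁, hg₂⟩ := TestFun.exists_lipBound g hg
  obtain ⟨B, hB, hB'⟩ := exists_norm_scaleSum_le hn hm hp hq hT' δ r hf₁ hf₂ hg₁ hg₂
  have hs : ∀ w v, Summable (scaleSum δ r T f g w v) := fun w v => hB.of_norm_bounded (hB' w v)
  have hi : Integrable (fun x : GridParam n × GridParam m => gridSum δ r T f g x.1 x.2)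
      ((gridMeasure n).prod (gridMeasure m)) := by
    have hmeas : Measurable fun x : GridParam n × GridParam m => gridSum δ r T f g x.1 x.2 :=
      measurable_of_tendsto_metrizable'
        (f := fun (S : Finset (ℤ × ℤ × ℤ × ℤ)) (x : GridParam n × GridParam m) =>
          ∑ K ∈ S, scaleSum δ r T f g x.1 x.2 K) Filter.atTop
        (fun S => Finset.measurable_fun_sum S fun K _ =>
          measurable_scaleSum hp hp' hq hq' hT' δ r f g K)
        (tendsto_pi_nhds.2 fun x => (hs x.1 x.2).hasSum)
    exact Integrable.of_bound hmeas.aestronglyMeasurable (∑' K, B K)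
      (Filter.Eventually.of_forall fun x => tsum_of_norm_bounded hB.hasSum (hB' x.1 x.2))
  refine ⟨measureReal_isGood δ r, measureReal_isGood δ r, fun w v K => ?_, hs, hi, ?_⟩
  · obtain ⟨W₁, W₂, V₁, V₂, -, -, h⟩ := exists_support_scaleTerm_subset f g K
    exact (Finset.finite_toSet _).subset (h T δ r w v)
  · have h₁ : (goodProb n δ r : ℂ) ≠ 0 := Complex.ofReal_ne_zero.2 hπn.ne'
    have h₂ : (goodProb m δ r : ℂ) ≠ 0 := Complex.ofReal_ne_zero.2 hπm.ne'
    -- `integral_gridSum` integrates over `w` first; integrability on the product permits the change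
    -- of order.
    rw [integral_integral_swap hi, integral_gridSum hn hm hp hp' hq hq' hT' δ r hf₁ hf₂ hg₁ hg₂]
    field_simp
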